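/- For $c=(c_1,c_2,c_3)\in\mathbb{R}^3$ consider the equation $$(1-x^2)U'+2xU+\tfrac12U^2=c_1(1-x)+c_2(1+x)+c_3(1-x^2),\qquad -1<x<1. \tag{1}$$ Let $\bar c_3(c_1,c_2)=-\frac12\left(\sqrt{1+c_1}+\sqrt{1+c_2}\right)\left(\sqrt{1+c_1}+\sqrt{1+c_2}+2\right)$ and $J=\{c\in\mathbb{R}^3: c_1\ge-1,\ c_2\ge-1,\ c_3\ge\bar c_3(c_1,c_2)\}$. For $c\in J$ let $U^{+}_\theta(c)$ and $U^-_\theta(c)$ be the largest and the smallest solution of (1) in $(-1,1)$ (both exist and lie in $C^\infty(-1,1)\cap C^0[-1,1]$), and put $\gamma^{\pm}(c)=U^{\pm}_\theta(c)(0)$. Let $I=\{(c,\gamma): c\in J,\ \gamma^-(c)\le\gamma\le\gamma^+(c)\}$ and, for $(c,\gamma)\in I$, let $U^{c,\gamma}_\theta\in C^\infty(-1,1)\cap C^0[-1,1]$ be the unique solution of (1) with $U^{c,\gamma}_\theta(0)=\gamma$. Let $J_1,J_2,J_3,J_4$ be the sets of those $c\in J$ with $c_3>\bar c_3(c_1,c_2)$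 and, respectively, $c_1>-1,\,c_2>-1$; $c_1=-1,\,c_2>-1$; $c_1>-1,\,c_2=-1$; $c_1=c_2=-1$. For $1\le k\le4$ let $I_{k,1}$, $I_{k,2}$, $I_{k,3}$ be the sets of those $(c,\gamma)\in I$ with $c\in J_k$ and, respectively, $\gamma^-(c)<\gamma<\gamma^+(c)$; $\gamma=\gamma^+(c)$; $\gamma=\gamma^-(c)$. On $I_{k,l}$ the solution $U^{c,\gamma}_\theta$ is regarded as a function of the free parameters of that set: the parameter $\gamma$ is free if $l=1$, while for $l=2$ (resp. $l=3$) one substitutes $\gamma=\gamma^+(c)$ (resp. $\gamma=\gamma^-(c)$) and regards $U^{c,\gamma^{\pm}(c)}_\theta$ as a function of $c\in J_k$; the coordinate $c_1$ is fixed to $-1$ if $k=2,4$, and $c_2$ is fixed to $-1$ if $k=3,4$. The derivatives $\partial_c^\alpha\partial_\gamma^j$, with $\alpha=(\alpha_1,\alpha_2,\alpha_3)$ and $|\alpha|=\alpha_1+\alpha_2+\alpha_3$, are taken in this sense. **Theorem.** Let $1\le k\le4$ and $1\le l\le3$. Then $U^{c,\gamma}_\theta(x)$ is $C^\infty$ in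 the free parameters of $I_{k,l}$ and $x\in(-1,1)$, jointly. Moreover, for every compact set $K\subset I_{k,l}$ and every integer $m\ge0$ there is a constant $C=C(m,K)$ such that the following holds for all $(c,\gamma)\in K$ and all $-1<x<1$. (i) If $k=1$, or $(k,l)=(2,2)$, or $(k,l)=(3,3)$, then $$|\partial_c^\alpha\partial_\gamma^jU^{c,\gamma}_\theta(x)|\le C\quad\text{for all } 0\le|\alpha|+j\le m,$$ where $j=0$ if $l=2,3$; $\alpha_1=0$ if $k=2$; and $\alpha_2=0$ if $k=3$. (ii) If $(k,l)=(2,1)$, $(2,3)$ or $(4,3)$, then $$\left(\ln\tfrac{1+x}{3}\right)^2|\partial_c^\alpha\partial_\gamma^jU^{c,\gamma}_\theta(x)|\le C\quad\text{for all } 1\le|\alpha|+j\le m,\ \alpha_1=0,$$ where $j=0$ if $l=3$, and $\alpha_2=0$ if $k=4$. (iii) If $(k,l)=(3,1)$, $(3,2)$ or $(4,2)$, then $$\left(\ln\tfrac{1-x}{3}\right)^2|\partial_c^\alpha\partial_\gamma^jU^{c,\gamma}_\theta(x)|\le C\quad\text{for all } 1\le|\alpha|+j\le m,\ \alpha_2=0,$$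 where $j=0$ if $l=2$, and $\alpha_1=0$ if $k=4$. (iv) If $(k,l)=(4,1)$, then $$\left(\ln\tfrac{1+x}{3}\right)^2\left(\ln\tfrac{1-x}{3}\right)^2|\partial_c^\alpha\partial_\gamma^jU^{c,\gamma}_\theta(x)|\le C\quad\text{for all } 1\le|\alpha|+j\le m,\ \alpha_1=\alpha_2=0.$$ -/

import Mathlib

open Set
open scoped ContDiff

namespace HomNS

noncomputable section

/-- `P_c(x) = c₁(1-x) + c₂(1+x) + c₃(1-x²)`; the components `c₁, c₂, c₃` are `c 0, c 1, c 2`. -/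
def P (c : Fin 3 → ℝ) (x : ℝ) : ℝ :=
  c 0 * (1 - x) + c 1 * (1 + x) + c 2 * (1 - x ^ 2)

/-- `f` solves `(1-x²) f' + 2 x f + f²/2 = P_c` in `(-1,1)`. -/
def IsSolution (c : Fin 3 → ℝ) (f : ℝ → ℝ) : Prop :=
  DifferentiableOn ℝ f (Ioo (-1) 1) ∧
    ∀ x ∈ Ioo (-1 : ℝ) 1,
      (1 - x ^ 2) * deriv f x + 2 * x * f x + (1 / 2) * f x ^ 2 = P c x

/-- A solution in `C^∞(-1,1) ∩ C⁰[-1,1]`. -/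
def IsRegularSolution (c : Fin 3 → ℝ) (f : ℝ → ℝ) : Prop :=
  IsSolution c f ∧ ContDiffOn ℝ ∞ f (Ioo (-1) 1) ∧ ContinuousOn f (Icc (-1) 1)

/-- `f` is the largest solution in `(-1,1)`. -/
def IsMaximalSolution (c : Fin 3 → ℝ) (f : ℝ → ℝ) : Prop :=
  IsRegularSolution c f ∧ ∀ g, IsSolution c g → ∀ x ∈ Ioo (-1 : ℝ) 1, g x ≤ f x

/-- `f` is the smallest solution in `(-1,1)`. -/
def IsMinimalSolution (c : Fin 3 → ℝ) (f : ℝ → ℝ) : Prop :=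
  IsRegularSolution c f ∧ ∀ g, IsSolution c g → ∀ x ∈ Ioo (-1 : ℝ) 1, f x ≤ g x

open Classical in
/-- `U^+(c)`, the largest solution (it exists for `c ∈ J`, and is then unique on `[-1,1]`). -/
def Uplus (c : Fin 3 → ℝ) : ℝ → ℝ :=
  if h : ∃ f, IsMaximalSolution c f then h.choose else 0

open Classical in
/-- `U^-(c)`, the smallest solution (it exists for `c ∈ J`, and is then unique on `[-1,1]`). -/
def Uminus (c : Fin 3 → ℝ) : ℝ → ℝ :=
  if h : ∃ f, IsMinimalSolution c f then h.choose else 0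

/-- `γ^+(c) = U^+(c)(0)`. -/
def gammaPlus (c : Fin 3 → ℝ) : ℝ := Uplus c 0

/-- `γ^-(c) = U^-(c)(0)`. -/
def gammaMinus (c : Fin 3 → ℝ) : ℝ := Uminus c 0

/-- The critical value `c̄₃(c₁,c₂)`. -/
def cbar (c₁ c₂ : ℝ) : ℝ :=
  -(1 / 2) * (√(1 + c₁) + √(1 + c₂)) * (√(1 + c₁) + √(1 + c₂) + 2)

/-- The set `J ⊆ ℝ³`. -/
def J : Set (Fin 3 → ℝ) :=
  {c | -1 ≤ c 0 ∧ -1 ≤ c 1 ∧ cbar (c 0) (c 1) ≤ c 2}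

/-- The set `I ⊆ ℝ³ × ℝ` of admissible `(c, γ)`. -/
def I : Set ((Fin 3 → ℝ) × ℝ) :=
  {p | p.1 ∈ J ∧ gammaMinus p.1 ≤ p.2 ∧ p.2 ≤ gammaPlus p.1}

open Classical in
/-- `U^{c,γ}`, the solution in `C^∞(-1,1) ∩ C⁰[-1,1]` with value `γ` at `0` (it exists for
`(c, γ) ∈ I`, and is then unique on `[-1,1]`). -/
def U (c : Fin 3 → ℝ) (γ : ℝ) : ℝ → ℝ :=
  if h : ∃ f, IsRegularSolution c f ∧ f 0 = γ then h.choose else 0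

/-- The strata `J_k`, `1 ≤ k ≤ 4`, of `J` (for other `k` the set is empty). -/
def Jk : ℕ → Set (Fin 3 → ℝ)
  | 1 => {c | c ∈ J ∧ -1 < c 0 ∧ -1 < c 1 ∧ cbar (c 0) (c 1) < c 2}
  | 2 => {c | c ∈ J ∧ c 0 = -1 ∧ -1 < c 1 ∧ cbar (c 0) (c 1) < c 2}
  | 3 => {c | c ∈ J ∧ -1 < c 0 ∧ c 1 = -1 ∧ cbar (c 0) (c 1) < c 2}
  | 4 => {c | c ∈ J ∧ c 0 = -1 ∧ c 1 = -1 ∧ cbar (c 0) (c 1) < c 2}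
  | _ => ∅

/-- The strata `I_{k,l}`, `1 ≤ k ≤ 4`, `1 ≤ l ≤ 3`, of `I` (empty for other indices). -/
def Ikl (k : ℕ) : ℕ → Set ((Fin 3 → ℝ) × ℝ)
  | 1 => {p | p ∈ I ∧ p.1 ∈ Jk k ∧ gammaMinus p.1 < p.2 ∧ p.2 < gammaPlus p.1}
  | 2 => {p | p ∈ I ∧ p.1 ∈ Jk k ∧ p.2 = gammaPlus p.1}
  | 3 => {p | p ∈ I ∧ p.1 ∈ Jk k ∧ p.2 = gammaMinus p.1}
  | _ => ∅

/-- The partial derivative `∂g/∂c_{i+1}`. It is the derivative along the line `c + t eᵢ`, so on a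
stratum where some coordinate of `c` is frozen, the derivatives in the remaining coordinates
involve the values of `g` on that stratum only. -/
def partialC (i : Fin 3) (g : (Fin 3 → ℝ) → ℝ) : (Fin 3 → ℝ) → ℝ :=
  fun c => lineDeriv ℝ g c (Pi.single i 1)

/-- `∂_c^α g` for a multi-index `α = (α₁, α₂, α₃)`. -/
def partialCMulti (α : Fin 3 → ℕ) (g : (Fin 3 → ℝ) → ℝ) : (Fin 3 → ℝ) → ℝ :=
  (partialC 0)^[α 0] ((partialC 1)^[α 1] ((partialC 2)^[α 2] g))

/-- The solution as a function of the free parameters of the strata `I_{k,l}`: of `(c, γ)` if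
`l = 1`, and of `c` alone, with `γ = γ^±(c)` substituted, if `l = 2, 3`. -/
def Ustratum (l : ℕ) (c : Fin 3 → ℝ) (γ x : ℝ) : ℝ :=
  if l = 2 then U c (gammaPlus c) x
  else if l = 3 then U c (gammaMinus c) x
  else U c γ x

/-- `∂_c^α ∂_γ^j U^{c,γ}(x)` on the strata `I_{k,l}`. -/
def dU (l : ℕ) (α : Fin 3 → ℕ) (j : ℕ) (c : Fin 3 → ℝ) (γ x : ℝ) : ℝ :=
  partialCMulti α (fun c' => iteratedDeriv j (fun γ' => Ustratum l c' γ' x) γ) c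

end

end HomNS

/-! Put t = (1+x)/2, a = √(1+c₁), b = √(1+c₂) and κ = (c₃ - c̄₃)/2, so that κ > 0 on all strata.
Writing U = U* + 4y, where U* (`Ustar`) solves the equation for κ = 0, turns (1) into the Riccati
equation `IsRiccati`, and y = t(1-t)Z'/Z linearises it to a hypergeometric equation. The power
series solution `Zf`, regular at t = 0, has positive coefficients; it yields the solution `Ym`, and
reflection t ↦ 1-t yields `Yp`. These are the largest and the smallest solution, and positive
combinations of the two linear solutions give everything in between (`Ymix`).

The gap to `Ym` satisfies a Bernoulli equation, which integrates explicitly (`IsRiccati.formula`):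
Ym - y = (1-t) G(t) / (t^a (E + ∫_t^{1/2} s^{-1-a} G(s) ds)), where G = `Gf` is smooth up to t = 0,
G(0) = 1, and E > 0 is a smooth function of the parameters if y < Ym.

If a > 0, the denominator is bounded below and all its parameter derivatives are bounded uniformly
in t, hence so are those of y (`SmoothParams.unifSmoothOn_of_pos`). If a = 0, it is w + O(1) with w
= 1 + log(1/(2t)), and y = -1/w + F/w² with F uniformly smooth
(`SmoothParams.exists_unifSmoothOn_of_zero`). The term -1/w contains no parameters, so each
derivative of order at least one is O(w⁻²): this is the weight (ln((1+x)/3))². The maximal solution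
is `Ym` itself, smooth through t = 0, and needs no weight at x = -1. The reflection y(t) ↦ -y(1-t)
exchanges a with b and maximal with minimal, which gives the endpoint x = 1.

Smooth dependence on parameters rests on joint smoothness of `Zf` (`contDiffAt_Zf`), obtained from
resolvents in a Banach algebra of bounded sequences. Since √(1+c₁) is not smooth at c₁ = -1, each
stratum is embedded in an open set on which a frozen root is replaced by 0; there `Uext` is smooth,
and `abs_dU_le` bounds the partial derivatives along the stratum by the full derivatives of `Uext`.
-/

namespace HomNS

open Filter Topology

/-! ### Families smooth in a parameter, uniformly in an index. -/

section UniformSmoothness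

variable {E V W Y X X' : Type*} [NormedAddCommGroup E] [NormedSpace ℝ E]
  [NormedAddCommGroup V] [NormedSpace ℝ V] [NormedAddCommGroup W] [NormedSpace ℝ W]
  [NormedAddCommGroup Y] [NormedSpace ℝ Y]

/-- A family `p ↦ f p x` of functions that are smooth on `Ω`, with all derivatives in `p` bounded
locally uniformly in `p` and uniformly in the index `x`. -/
structure UnifSmoothOn (Ω : Set E) (f : E → X → V) : Prop where
  smooth : ∀ x, ContDiffOn ℝ ∞ (fun p => f p x) Ω
  bound : ∀ p₀ ∈ Ω, ∀ n : ℕ, ∃ C, ∀ᶠ p in 𝓝 p₀, ∀ x, ‖iteratedFDeriv ℝ n (fun p => f p x) p‖ ≤ C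

variable {Ω : Set E}

lemma eventually_iteratedFDeriv_le {h : E → V} (hΩ : IsOpen Ω) (hh : ContDiffOn ℝ ∞ h Ω)
    {p₀ : E} (hp : p₀ ∈ Ω) (n : ℕ) :
    ∀ᶠ p in 𝓝 p₀, ‖iteratedFDeriv ℝ n h p‖ ≤ ‖iteratedFDeriv ℝ n h p₀‖ + 1 := by
  have h1 : ContinuousOn (iteratedFDeriv ℝ n h) Ω :=
    (hh.continuousOn_iteratedFDerivWithin (m := n) (by exact_mod_cast le_top)
      hΩ.uniqueDiffOn).congr (fun x hx => (iteratedFDerivWithin_of_isOpen n hΩ hx).symm)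
  have h2 := (h1.continuousAt (hΩ.mem_nhds hp)).norm
  exact (h2.eventually_lt continuousAt_const (lt_add_one _)).mono fun p hp => hp.le

lemma unifSmoothOn_of_param {h : E → V} (hΩ : IsOpen Ω) (hh : ContDiffOn ℝ ∞ h Ω) :
    UnifSmoothOn Ω (fun p (_ : X) => h p) :=
  ⟨fun _ => hh, fun _ hp n =>
    ⟨_, (eventually_iteratedFDeriv_le hΩ hh hp n).mono fun _ h _ => h⟩⟩

lemma unifSmoothOn_of_index {h : X → V} {C : ℝ} (hC : ∀ x, ‖h x‖ ≤ C) :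
    UnifSmoothOn Ω (fun _ x => h x) := by
  refine ⟨fun _ => contDiffOn_const, fun p₀ _ n => ⟨max C 0, Eventually.of_forall fun p x => ?_⟩⟩
  rcases Nat.eq_zero_or_pos n with rfl | hn
  · simpa using Or.inl (hC x)
  · rw [iteratedFDeriv_const_of_ne hn.ne']
    simp

lemma UnifSmoothOn.prodMk {f : E → X → V} {g : E → X → W} (hΩ : IsOpen Ω)
    (hf : UnifSmoothOn Ω f) (hg : UnifSmoothOn Ω g) :
    UnifSmoothOn Ω (fun p x => (f p x, g p x)) := by
  refine ⟨fun x => (hf.smooth x).prodMk (hg.smooth x), fun p₀ hp n => ?_⟩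
  obtain ⟨C, hC⟩ := hf.bound p₀ hp n
  obtain ⟨D, hD⟩ := hg.bound p₀ hp n
  refine ⟨max C D, ?_⟩
  filter_upwards [hC, hD, hΩ.mem_nhds hp] with p h1 h2 h3 x
  rw [iteratedFDeriv_prodMk ((hf.smooth x).contDiffAt (hΩ.mem_nhds h3))
    ((hg.smooth x).contDiffAt (hΩ.mem_nhds h3)) (by exact_mod_cast le_top),
    ContinuousMultilinearMap.opNorm_prod]
  exact max_le_max (h1 x) (h2 x)

lemma UnifSmoothOn.reindex {f : E → X → V} (hf : UnifSmoothOn Ω f) (e : X' → X) :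
    UnifSmoothOn Ω (fun p x => f p (e x)) :=
  ⟨fun x => hf.smooth (e x), fun p₀ hp n => by
    obtain ⟨C, hC⟩ := hf.bound p₀ hp n
    exact ⟨C, hC.mono fun p h x => h (e x)⟩⟩

lemma iteratedFDeriv_congr_of_isOpen {f g : E → V} (hΩ : IsOpen Ω) (h : ∀ p ∈ Ω, f p = g p)
    {p : E} (hp : p ∈ Ω) (n : ℕ) : iteratedFDeriv ℝ n f p = iteratedFDeriv ℝ n g p :=
  (show f =ᶠ[𝓝 p] g by
    filter_upwards [hΩ.mem_nhds hp] with q hq using h q hq).iteratedFDeriv ℝ n |>.eq_of_nhds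

lemma UnifSmoothOn.congr {f g : E → X → V} (hΩ : IsOpen Ω) (hf : UnifSmoothOn Ω f)
    (h : ∀ p ∈ Ω, ∀ x, g p x = f p x) : UnifSmoothOn Ω g := by
  refine ⟨fun x => (hf.smooth x).congr fun p hp => h p hp x, fun p₀ hp n => ?_⟩
  obtain ⟨C, hC⟩ := hf.bound p₀ hp n
  refine ⟨C, ?_⟩
  filter_upwards [hC, hΩ.mem_nhds hp] with p h1 h2 x
  rw [iteratedFDeriv_congr_of_isOpen hΩ (fun p hp => h p hp x) h2]
  exact h1 x

lemma UnifSmoothOn.exists_bound_on_compact {f : E → X → V} (hf : UnifSmoothOn Ω f) {K : Set E}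
    (hK : IsCompact K) (hKΩ : K ⊆ Ω) (n : ℕ) :
    ∃ C, ∀ p ∈ K, ∀ x, ‖iteratedFDeriv ℝ n (fun p => f p x) p‖ ≤ C := by
  refine hK.induction_on (p := fun S => ∃ C, ∀ p ∈ S, ∀ x,
    ‖iteratedFDeriv ℝ n (fun p => f p x) p‖ ≤ C) ⟨0, by simp⟩
    (fun s t hst ⟨C, hC⟩ => ⟨C, fun p hp => hC p (hst hp)⟩) ?_ ?_
  · rintro s t ⟨C, hC⟩ ⟨D, hD⟩
    exact ⟨max C D, fun p hp x => hp.elim (fun h => (hC p h x).trans (le_max_left _ _))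
      fun h => (hD p h x).trans (le_max_right _ _)⟩
  · intro p hp
    obtain ⟨C, hC⟩ := hf.bound p (hKΩ hp) n
    exact ⟨_, mem_nhdsWithin_of_mem_nhds hC, C, fun q hq => hq⟩

/-- Faà di Bruno bound. A single compact set containing all values f p x for p near p₀ makes the
bounds on the outer derivatives uniform in x. -/
lemma UnifSmoothOn.comp_index {Φ : V → X → W} {Ω' : Set V} {f : E → X → V} (hΩ : IsOpen Ω)
    (hf : UnifSmoothOn Ω f) (hΩ' : IsOpen Ω') (hΦ : UnifSmoothOn Ω' Φ)
    (hm : ∀ p ∈ Ω, ∀ x, f p x ∈ Ω')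
    (hQ : ∀ p₀ ∈ Ω, ∃ Q ⊆ Ω', IsCompact Q ∧ ∀ᶠ p in 𝓝 p₀, ∀ x, f p x ∈ Q) :
    UnifSmoothOn Ω (fun p x => Φ (f p x) x) := by
  refine ⟨fun x => (hΦ.smooth x).comp (hf.smooth x) fun p hp => hm p hp x, fun p₀ hp n => ?_⟩
  obtain ⟨Q, hQs, hQc, hQe⟩ := hQ p₀ hp
  choose C hC using hΦ.exists_bound_on_compact hQc hQs
  choose B hB using hf.bound p₀ hp
  have hev : ∀ᶠ p in 𝓝 p₀, ∀ i ∈ Finset.range (n + 1), ∀ x,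
      ‖iteratedFDeriv ℝ i (fun p => f p x) p‖ ≤ B i :=
    (Finset.eventually_all _).2 fun i _ => hB i
  -- The shape n! * C * D ^ n comes from the estimate for composites, which asks for inner
  -- derivatives of order i bounded by D ^ i. The summand 1 gives D ≥ 1, hence D ≤ D ^ i for i ≥ 1.
  refine ⟨n.factorial * (∑ i ∈ Finset.range (n + 1), |C i|) *
    (1 + ∑ i ∈ Finset.range (n + 1), |B i|) ^ n, ?_⟩
  filter_upwards [hQe, hev, hΩ.mem_nhds hp] with p h1 h2 h3 x
  have hle : ∀ (c : ℕ → ℝ), ∀ i ≤ n, c i ≤ ∑ i ∈ Finset.range (n + 1), |c i| := fun c i hi =>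
    (le_abs_self _).trans (Finset.single_le_sum (f := fun i => |c i|) (fun _ _ => abs_nonneg _)
      (Finset.mem_range.2 (by omega)))
  rw [← iteratedFDerivWithin_of_isOpen n hΩ h3]
  refine norm_iteratedFDerivWithin_comp_le (hΦ.smooth x) (hf.smooth x) (by exact_mod_cast le_top)
    hΩ'.uniqueDiffOn hΩ.uniqueDiffOn (fun p hp => hm p hp x) h3
    (fun i hi => ?_) (fun i hi1 hi => ?_)
  · rw [iteratedFDerivWithin_of_isOpen i hΩ' (hQs (h1 x))]
    exact (hC i _ (h1 x) x).trans (hle C i hi)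
  rw [iteratedFDerivWithin_of_isOpen i hΩ h3]
  have hS : 0 ≤ ∑ i ∈ Finset.range (n + 1), |B i| := Finset.sum_nonneg fun _ _ => abs_nonneg _
  calc _ ≤ B i := h2 i (Finset.mem_range.2 (by omega)) x
    _ ≤ _ := hle B i hi
    _ ≤ 1 + ∑ i ∈ Finset.range (n + 1), |B i| := by linarith
    _ ≤ _ := le_self_pow₀ (by linarith) (by omega)

lemma UnifSmoothOn.comp {Φ : V → W} {Ω' : Set V} {f : E → X → V} (hΩ : IsOpen Ω)
    (hf : UnifSmoothOn Ω f) (hΩ' : IsOpen Ω') (hΦ : ContDiffOn ℝ ∞ Φ Ω')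
    (hm : ∀ p ∈ Ω, ∀ x, f p x ∈ Ω')
    (hQ : ∀ p₀ ∈ Ω, ∃ Q ⊆ Ω', IsCompact Q ∧ ∀ᶠ p in 𝓝 p₀, ∀ x, f p x ∈ Q) :
    UnifSmoothOn Ω (fun p x => Φ (f p x)) :=
  hf.comp_index hΩ hΩ' (unifSmoothOn_of_param hΩ' hΦ) hm hQ

lemma UnifSmoothOn.eventually_bound {f : E → X → V} (hf : UnifSmoothOn Ω f) {p₀ : E}
    (hp : p₀ ∈ Ω) : ∃ C, ∀ᶠ p in 𝓝 p₀, ∀ x, ‖f p x‖ ≤ C := by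
  simpa using hf.bound p₀ hp 0

lemma UnifSmoothOn.comp_of_contDiff [ProperSpace V] {Φ : V → W} {f : E → X → V} (hΩ : IsOpen Ω)
    (hf : UnifSmoothOn Ω f) (hΦ : ContDiff ℝ ∞ Φ) : UnifSmoothOn Ω (fun p x => Φ (f p x)) := by
  refine hf.comp hΩ isOpen_univ hΦ.contDiffOn (fun _ _ _ => mem_univ _) fun p₀ hp => ?_
  obtain ⟨C, hC⟩ := hf.eventually_bound hp
  exact ⟨Metric.closedBall 0 C, subset_univ _, isCompact_closedBall _ _, by simpa using hC⟩

lemma UnifSmoothOn.add {f g : E → X → ℝ} (hΩ : IsOpen Ω) (hf : UnifSmoothOn Ω f)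
    (hg : UnifSmoothOn Ω g) : UnifSmoothOn Ω (fun p x => f p x + g p x) :=
  (hf.prodMk hΩ hg).comp_of_contDiff hΩ (Φ := fun v : ℝ × ℝ => v.1 + v.2) (by fun_prop)

lemma UnifSmoothOn.sub {f g : E → X → ℝ} (hΩ : IsOpen Ω) (hf : UnifSmoothOn Ω f)
    (hg : UnifSmoothOn Ω g) : UnifSmoothOn Ω (fun p x => f p x - g p x) :=
  (hf.prodMk hΩ hg).comp_of_contDiff hΩ (Φ := fun v : ℝ × ℝ => v.1 - v.2) (by fun_prop)

lemma UnifSmoothOn.mul {f g : E → X → ℝ} (hΩ : IsOpen Ω) (hf : UnifSmoothOn Ω f)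
    (hg : UnifSmoothOn Ω g) : UnifSmoothOn Ω (fun p x => f p x * g p x) :=
  (hf.prodMk hΩ hg).comp_of_contDiff hΩ (Φ := fun v : ℝ × ℝ => v.1 * v.2) (by fun_prop)

lemma UnifSmoothOn.inv {f : E → X → ℝ} (hΩ : IsOpen Ω) (hf : UnifSmoothOn Ω f)
    (hpos : ∀ p ∈ Ω, ∀ x, 0 < f p x)
    (hc : ∀ p₀ ∈ Ω, ∃ c > 0, ∀ᶠ p in 𝓝 p₀, ∀ x, c ≤ f p x) :
    UnifSmoothOn Ω (fun p x => (f p x)⁻¹) := by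
  refine hf.comp hΩ (Φ := fun v : ℝ => v⁻¹) (Ω' := Ioi 0) isOpen_Ioi
    (contDiffOn_id.inv fun x hx => (mem_Ioi.1 hx).ne') hpos fun p₀ hp => ?_
  obtain ⟨c, hc, hce⟩ := hc p₀ hp
  obtain ⟨C, hC⟩ := hf.eventually_bound hp
  refine ⟨Icc c C, fun v hv => hc.trans_le hv.1, isCompact_Icc, ?_⟩
  filter_upwards [hce, hC] with p h1 h2 x using ⟨h1 x, (le_abs_self _).trans (h2 x)⟩

/-- The source of uniformity away from singular points: smoothness jointly in parameter and time,
with the time confined to a compact set. -/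
lemma unifSmoothOn_of_joint [ProperSpace E] {Φ : E × Y → W} {Ω' : Set (E × Y)} {s : X → Y}
    {Q : Set Y} (hΩ : IsOpen Ω) (hΩ' : IsOpen Ω') (hΦ : ContDiffOn ℝ ∞ Φ Ω') (hQ : IsCompact Q)
    (hs : ∀ x, s x ∈ Q) (hsub : Ω ×ˢ Q ⊆ Ω') : UnifSmoothOn Ω (fun p x => Φ (p, s x)) := by
  obtain ⟨C, hC⟩ := hQ.isBounded.exists_norm_le
  refine ((unifSmoothOn_of_param (X := X) hΩ contDiffOn_id).prodMk hΩ
    (unifSmoothOn_of_index fun x => hC _ (hs x))).comp hΩ hΩ' hΦ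
    (fun p hp x => hsub ⟨hp, hs x⟩) fun p₀ hp => ?_
  obtain ⟨r, hr, hrs⟩ := Metric.nhds_basis_closedBall.mem_iff.1 (hΩ.mem_nhds hp)
  refine ⟨Metric.closedBall p₀ r ×ˢ Q, (prod_mono hrs le_rfl).trans hsub,
    (isCompact_closedBall _ _).prod hQ, ?_⟩
  filter_upwards [Metric.closedBall_mem_nhds p₀ hr] with p h x using ⟨h, hs x⟩

lemma UnifSmoothOn.of_local {f : E → X → V}
    (h : ∀ p₀ ∈ Ω, ∃ Ω₀, IsOpen Ω₀ ∧ p₀ ∈ Ω₀ ∧ UnifSmoothOn Ω₀ f) : UnifSmoothOn Ω f := by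
  refine ⟨fun x p hp => ?_, fun p hp n => ?_⟩
  · obtain ⟨Ω₀, ho, hm, hu⟩ := h p hp
    exact ((hu.smooth x).contDiffAt (ho.mem_nhds hm)).contDiffWithinAt
  · obtain ⟨Ω₀, ho, hm, hu⟩ := h p hp
    exact hu.bound p hm n

end UniformSmoothness

end HomNS

namespace HomNS

open Filter Topology MeasureTheory

/-! ### Integrals depending smoothly on parameters. -/

section ParametricIntegral

lemma continuousOn_section {E V : Type*} [TopologicalSpace E] [TopologicalSpace V] {Ω : Set E}
    {Ω' : Set (E × ℝ)} {α β : ℝ} {Φ : E × ℝ → V} (hΦ : ContinuousOn Φ Ω')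
    (hsub : Ω ×ˢ Icc α β ⊆ Ω') {p : E} (hp : p ∈ Ω) : ContinuousOn (fun s => Φ (p, s)) (Icc α β) :=
  hΦ.comp (by fun_prop) fun s hs => hsub ⟨hp, hs⟩

variable {E V : Type} [NormedAddCommGroup E] [NormedSpace ℝ E]
  [NormedAddCommGroup V] [NormedSpace ℝ V] {Ω : Set E} {Ω' : Set (E × ℝ)} {α β : ℝ}

/-- The partial derivative in the first variable. -/
noncomputable def fderivFst (Φ : E × ℝ → V) (q : E × ℝ) : E →L[ℝ] V :=
  (fderiv ℝ Φ q).comp (ContinuousLinearMap.inl ℝ E ℝ)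

lemma contDiffOn_fderivFst {Φ : E × ℝ → V} (hΩ' : IsOpen Ω') (hΦ : ContDiffOn ℝ ∞ Φ Ω') :
    ContDiffOn ℝ ∞ (fderivFst Φ) Ω' :=
  ((contDiffOn_infty_iff_fderiv_of_isOpen hΩ').1 hΦ).2.clm_comp contDiffOn_const

lemma hasFDerivAt_fst {Φ : E × ℝ → V} (hΩ' : IsOpen Ω') (hΦ : ContDiffOn ℝ ∞ Φ Ω') {p : E} {s : ℝ}
    (h : (p, s) ∈ Ω') : HasFDerivAt (fun p => Φ (p, s)) (fderivFst Φ (p, s)) p :=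
  ((hΦ.contDiffAt (hΩ'.mem_nhds h)).differentiableAt (by simp)).hasFDerivAt.comp p
    (hasFDerivAt_prodMk_left p s)

variable [ProperSpace E]

lemma hasFDerivAt_integral_of_joint {Φ : E × ℝ → V} (hΩ : IsOpen Ω) (hΩ' : IsOpen Ω')
    (hΦ : ContDiffOn ℝ ∞ Φ Ω') (hαβ : α ≤ β) (hsub : Ω ×ˢ Icc α β ⊆ Ω') {p₀ : E} (hp : p₀ ∈ Ω) :
    HasFDerivAt (fun p => ∫ s in α..β, Φ (p, s)) (∫ s in α..β, fderivFst Φ (p₀, s)) p₀ := by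
  obtain ⟨r, hr, hrs⟩ := Metric.nhds_basis_closedBall.mem_iff.1 (hΩ.mem_nhds hp)
  have hD := (contDiffOn_fderivFst hΩ' hΦ).continuousOn
  obtain ⟨C, hC⟩ := ((isCompact_closedBall p₀ r).prod (isCompact_Icc (a := α) (b := β))
    ).exists_bound_of_continuousOn (hD.mono ((prod_mono hrs le_rfl).trans hsub))
  have hI : ∀ s, s ∈ uIoc α β → s ∈ Icc α β := fun s hs => by
    rw [uIoc_of_le hαβ] at hs; exact Ioc_subset_Icc_self hs
  have hint : ∀ {G : Type} [NormedAddCommGroup G] [NormedSpace ℝ G] (Ψ : E × ℝ → G),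
      ContinuousOn Ψ Ω' → ∀ p ∈ Ω, IntervalIntegrable (fun s => Ψ (p, s)) volume α β :=
    fun Ψ h p hp => (continuousOn_section h hsub hp).intervalIntegrable_of_Icc hαβ
  refine intervalIntegral.hasFDerivAt_integral_of_dominated_of_fderiv_le (bound := fun _ => C)
    (F := fun p s => Φ (p, s)) (F' := fun p s => fderivFst Φ (p, s))
    (Metric.closedBall_mem_nhds p₀ hr) ?_ (hint _ hΦ.continuousOn _ hp)
    (hint _ hD _ hp).def'.aestronglyMeasurable
    (Eventually.of_forall fun s hs p hp => hC (p, s) ⟨hp, hI s hs⟩) (by simp)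
    (Eventually.of_forall fun s hs p hp => hasFDerivAt_fst hΩ' hΦ (hsub ⟨hrs hp, hI s hs⟩))
  filter_upwards [hΩ.mem_nhds hp] with p hp
  exact (hint _ hΦ.continuousOn _ hp).def'.aestronglyMeasurable

/-- The value space is quantified inside the induction because the derivative of the integral is an
integral with values in `E →L[ℝ] V`. -/
lemma contDiffOn_integral_nat (hΩ : IsOpen Ω) (hΩ' : IsOpen Ω') (hαβ : α ≤ β)
    (hsub : Ω ×ˢ Icc α β ⊆ Ω') (n : ℕ) : ∀ {V : Type} [NormedAddCommGroup V] [NormedSpace ℝ V]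
    {Φ : E × ℝ → V}, ContDiffOn ℝ ∞ Φ Ω' →
      ContDiffOn ℝ n (fun p => ∫ s in α..β, Φ (p, s)) Ω := by
  induction n with
  | zero =>
    intro V _ _ Φ hΦ
    rw [Nat.cast_zero, contDiffOn_zero]
    exact fun p hp => (hasFDerivAt_integral_of_joint hΩ hΩ' hΦ hαβ hsub
      hp).continuousAt.continuousWithinAt
  | succ n ih =>
    intro V _ _ Φ hΦ
    rw [Nat.cast_succ, contDiffOn_succ_iff_fderiv_of_isOpen hΩ]
    refine ⟨fun p hp => (hasFDerivAt_integral_of_joint hΩ hΩ' hΦ hαβ hsub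
      hp).differentiableAt.differentiableWithinAt, by simp, ?_⟩
    exact (ih (contDiffOn_fderivFst hΩ' hΦ)).congr fun p hp =>
      (hasFDerivAt_integral_of_joint hΩ hΩ' hΦ hαβ hsub hp).fderiv

lemma contDiffOn_integral {Φ : E × ℝ → V} (hΩ : IsOpen Ω) (hΩ' : IsOpen Ω')
    (hΦ : ContDiffOn ℝ ∞ Φ Ω') (hαβ : α ≤ β) (hsub : Ω ×ˢ Icc α β ⊆ Ω') :
    ContDiffOn ℝ ∞ (fun p => ∫ s in α..β, Φ (p, s)) Ω :=
  contDiffOn_infty.2 fun n => contDiffOn_integral_nat hΩ hΩ' hαβ hsub n hΦ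

lemma norm_iteratedFDeriv_integral_le (hΩ : IsOpen Ω) (hΩ' : IsOpen Ω') (hαβ : α ≤ β)
    (hsub : Ω ×ˢ Icc α β ⊆ Ω') {g : ℝ → ℝ} (hg : IntervalIntegrable g volume α β) {p : E}
    (hp : p ∈ Ω) (n : ℕ) : ∀ {V : Type} [NormedAddCommGroup V] [NormedSpace ℝ V]
    {Φ : E × ℝ → V}, ContDiffOn ℝ ∞ Φ Ω' →
      (∀ s ∈ Icc α β, ‖iteratedFDeriv ℝ n (fun p => Φ (p, s)) p‖ ≤ g s) →
      ‖iteratedFDeriv ℝ n (fun p => ∫ s in α..β, Φ (p, s)) p‖ ≤ ∫ s in α..β, g s := by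
  induction n with
  | zero =>
    intro V _ _ Φ hΦ hle
    simp only [norm_iteratedFDeriv_zero] at hle ⊢
    exact intervalIntegral.norm_integral_le_of_norm_le hαβ
      (Eventually.of_forall fun s hs => hle s (Ioc_subset_Icc_self hs)) hg
  | succ n ih =>
    intro V _ _ Φ hΦ hle
    rw [← norm_iteratedFDeriv_fderiv, iteratedFDeriv_congr_of_isOpen hΩ (fun p hp =>
      (hasFDerivAt_integral_of_joint hΩ hΩ' hΦ hαβ hsub hp).fderiv) hp]
    refine ih (contDiffOn_fderivFst hΩ' hΦ) fun s hs => ?_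
    rw [← iteratedFDeriv_congr_of_isOpen hΩ (fun p hp =>
      (hasFDerivAt_fst hΩ' hΦ (hsub ⟨hp, hs⟩)).fderiv) hp, norm_iteratedFDeriv_fderiv]
    exact hle s hs

/-- Integrals of uniformly smooth families against weights of bounded mass. -/
lemma UnifSmoothOn.integral {X : Type*} {α β : X → ℝ} {F : E → X → ℝ → ℝ} {wt : X → ℝ → ℝ}
    {Ω' : X → Set (E × ℝ)} {C : ℝ} (hΩ : IsOpen Ω) (hΩ' : ∀ x, IsOpen (Ω' x))
    (hαβ : ∀ x, α x ≤ β x) (hsub : ∀ x, Ω ×ˢ Icc (α x) (β x) ⊆ Ω' x)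
    (hF : UnifSmoothOn Ω
      (fun p (i : {i : X × ℝ // i.2 ∈ Icc (α i.1) (β i.1)}) => F p i.1.1 i.1.2))
    (hsm : ∀ x, ContDiffOn ℝ ∞ (fun q : E × ℝ => wt x q.2 * F q.1 x q.2) (Ω' x))
    (hw : ∀ x, ∀ s ∈ Icc (α x) (β x), 0 ≤ wt x s)
    (hwi : ∀ x, IntervalIntegrable (wt x) volume (α x) (β x))
    (hwC : ∀ x, ∫ s in α x..β x, wt x s ≤ C) :
    UnifSmoothOn Ω (fun p x => ∫ s in α x..β x, wt x s * F p x s) := by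
  refine ⟨fun x => contDiffOn_integral hΩ (hΩ' x) (hsm x) (hαβ x) (hsub x), fun p₀ hp n => ?_⟩
  obtain ⟨B, hB⟩ := hF.bound p₀ hp n
  refine ⟨C * max B 0, ?_⟩
  filter_upwards [hB, hΩ.mem_nhds hp] with p h1 h2 x
  refine (norm_iteratedFDeriv_integral_le hΩ (hΩ' x) (hαβ x) (hsub x)
    ((hwi x).mul_const (max B 0)) h2 n (hsm x) fun s hs => ?_).trans ?_
  · have hsF := hF.smooth ⟨(x, s), hs⟩
    rw [show (fun p => wt x s * F p x s) = wt x s • fun p => F p x s from rfl,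
      iteratedFDeriv_const_smul_apply
        ((hsF.contDiffAt (hΩ.mem_nhds h2)).of_le (by exact_mod_cast le_top)), norm_smul,
      Real.norm_of_nonneg (hw x s hs)]
    exact mul_le_mul_of_nonneg_left ((h1 ⟨(x, s), hs⟩).trans (le_max_left _ _)) (hw x s hs)
  · rw [intervalIntegral.integral_mul_const]
    exact mul_le_mul_of_nonneg_right (hwC x) (le_max_right _ _)

end ParametricIntegral

end HomNS

namespace HomNS

open Filter Topology

/-! ### Termwise differentiation of power series. -/

section PowerSeries

/-- The power series with coefficients `c` converges absolutely in the open unit disc. -/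
def SummableInUnitDisc (c : ℕ → ℝ) : Prop :=
  ∀ r : ℝ, 0 ≤ r → r < 1 → Summable fun n => |c n| * r ^ n

lemma SummableInUnitDisc.summable {c : ℕ → ℝ} (hc : SummableInUnitDisc c) {t : ℝ} (ht : |t| < 1) :
    Summable fun n => c n * t ^ n :=
  Summable.of_norm (by simpa [abs_mul, abs_pow] using hc |t| (abs_nonneg t) ht)

/-- The factor n + 1 costs only a slightly larger radius ρ < 1, since (n + 1)(r/ρ)^n is bounded. -/
lemma SummableInUnitDisc.deriv {c : ℕ → ℝ} (hc : SummableInUnitDisc c) :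
    SummableInUnitDisc fun n => (n + 1 : ℝ) * c (n + 1) := by
  intro r hr0 hr1
  obtain ⟨ρ, hρ, hρ1⟩ := exists_between hr1
  have hρ0 : 0 < ρ := hr0.trans_lt hρ
  have hq : ‖r / ρ‖ < 1 := by
    rw [Real.norm_of_nonneg (by positivity), div_lt_one hρ0]; exact hρ
  have h1 : Summable fun n : ℕ => (n : ℝ) ^ 1 * (r / ρ) ^ n :=
    summable_pow_mul_geometric_of_norm_lt_one 1 hq
  have h2 : Tendsto (fun n : ℕ => (n : ℝ) ^ 1 * (r / ρ) ^ n + (r / ρ) ^ n) atTop (𝓝 (0 + 0)) :=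
    h1.tendsto_atTop_zero.add (tendsto_pow_atTop_nhds_zero_of_norm_lt_one hq)
  obtain ⟨C, hC⟩ := h2.bddAbove_range
  have h3 : Summable fun n => C * ρ⁻¹ * (|c (n + 1)| * ρ ^ (n + 1)) :=
    ((summable_nat_add_iff 1).2 (hc ρ hρ0.le hρ1)).mul_left _
  refine Summable.of_nonneg_of_le (fun n => by positivity) (fun n => ?_) h3
  have h4 : (n : ℝ) ^ 1 * (r / ρ) ^ n + (r / ρ) ^ n ≤ C := hC ⟨n, rfl⟩
  have h5 : |((n : ℝ) + 1) * c (n + 1)| * r ^ n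
      = ((n : ℝ) ^ 1 * (r / ρ) ^ n + (r / ρ) ^ n) * (|c (n + 1)| * ρ ^ n) := by
    rw [abs_mul, abs_of_nonneg (by positivity : (0 : ℝ) ≤ (n : ℝ) + 1), div_pow]
    field_simp
  rw [h5]
  refine (mul_le_mul_of_nonneg_right h4 (by positivity)).trans_eq ?_
  rw [pow_succ]
  field_simp

lemma SummableInUnitDisc.hasDerivAt {c : ℕ → ℝ} (hc : SummableInUnitDisc c) {t : ℝ}
    (ht : |t| < 1) : HasDerivAt (fun s => ∑' n, c n * s ^ n)
      (∑' n : ℕ, ((n + 1 : ℝ) * c (n + 1)) * t ^ n) t := by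
  obtain ⟨r, hr, hr1⟩ := exists_between ht
  have hr0 : 0 < r := (abs_nonneg t).trans_lt hr
  have hu : Summable fun n : ℕ => |c n| * (n * r ^ (n - 1)) := by
    refine (summable_nat_add_iff 1).1 ((hc.deriv r hr0.le hr1).congr fun n => ?_)
    rw [abs_mul, abs_of_nonneg (by positivity : (0 : ℝ) ≤ (n : ℝ) + 1)]
    push_cast
    ring
  have hm : t ∈ Ioo (-r) r := ⟨by linarith [neg_abs_le t], by linarith [le_abs_self t]⟩
  have key := hasDerivAt_tsum_of_isPreconnected (g := fun n s => c n * s ^ n)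
    (g' := fun n s => c n * (n * s ^ (n - 1))) hu isOpen_Ioo isPreconnected_Ioo
    (fun n y _ => (hasDerivAt_pow n y).const_mul (c n)) (fun n y hy => ?_) hm (hc.summable ht) hm
  · refine key.congr_deriv ?_
    have hs : Summable fun n : ℕ => c n * (n * t ^ (n - 1)) := by
      refine (summable_nat_add_iff 1).1 ((hc.deriv.summable ht).congr fun n => ?_)
      push_cast
      ring
    rw [hs.tsum_eq_zero_add]
    simp only [Nat.cast_zero, zero_mul, mul_zero, zero_add]
    refine tsum_congr fun n => ?_
    push_cast
    ring
  · rw [norm_mul, norm_mul, norm_pow, Real.norm_eq_abs, Real.norm_eq_abs, Real.norm_eq_abs,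
      abs_of_nonneg (by positivity : (0 : ℝ) ≤ (n : ℝ))]
    have : |y| ≤ r := abs_le.2 ⟨hy.1.le, hy.2.le⟩
    gcongr

/-- Lets tZ', tZ'' and t²Z'' be written as series in the same powers t^n as Z, so that a
differential equation can be checked coefficient by coefficient. -/
lemma SummableInUnitDisc.mul_tsum_shift {c : ℕ → ℝ} (hc : SummableInUnitDisc c) (h0 : c 0 = 0)
    {t : ℝ} (ht : |t| < 1) : t * ∑' n, c (n + 1) * t ^ n = ∑' n, c n * t ^ n := by
  rw [(hc.summable ht).tsum_eq_zero_add, h0, zero_mul, zero_add, ← tsum_mul_left]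
  exact tsum_congr fun n => by ring

lemma SummableInUnitDisc.of_shift {c : ℕ → ℝ} (hc : SummableInUnitDisc fun n => c (n + 1)) :
    SummableInUnitDisc c := fun r h0 h1 => by
  refine (summable_nat_add_iff 1).1 (((hc r h0 h1).mul_left r).congr fun n => ?_)
  ring

end PowerSeries

/-! ### The hypergeometric solution regular at the origin. -/

section Hypergeometric

variable {a b κ t : ℝ}

/-- The ratio of consecutive coefficients of the hypergeometric series `Zf`. -/
noncomputable def coefRatio (a b κ : ℝ) (n : ℕ) : ℝ :=
  ((n : ℝ) ^ 2 + n * (1 + a + b) + κ) / ((n + 1) * (n + 1 + a))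

/-- The coefficients of the hypergeometric series `Zf`. -/
noncomputable def coef (a b κ : ℝ) : ℕ → ℝ
  | 0 => 1
  | n + 1 => coefRatio a b κ n * coef a b κ n

/-- The solution of `t(1-t) Z'' + ((1+a) - (2+a+b) t) Z' = κ Z` with `Z(0) = 1` that is regular
at `t = 0`. -/
noncomputable def Zf (a b κ t : ℝ) : ℝ := ∑' n, coef a b κ n * t ^ n

/-- The derivative of `Zf` in `t`. -/
noncomputable def Zf' (a b κ t : ℝ) : ℝ := ∑' n : ℕ, ((n + 1 : ℝ) * coef a b κ (n + 1)) * t ^ n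

/-- For n ≥ 1, a + b > -2 gives n² + n(1+a+b) > n² - n ≥ 0; the condition κ > 0 is decisive at n =
0. -/
lemma coefRatio_pos (ha : -1 < a) (hb : -1 < b) (hκ : 0 < κ) (n : ℕ) : 0 < coefRatio a b κ n := by
  have hn : (0 : ℝ) ≤ n := n.cast_nonneg
  refine div_pos ?_ (mul_pos (by positivity) (by linarith))
  rcases Nat.eq_zero_or_pos n with rfl | h
  · simpa using hκ
  · have h1 : (1 : ℝ) ≤ n := by exact_mod_cast h
    nlinarith

lemma coef_pos (ha : -1 < a) (hb : -1 < b) (hκ : 0 < κ) : ∀ n, 0 < coef a b κ n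
  | 0 => one_pos
  | n + 1 => mul_pos (coefRatio_pos ha hb hκ n) (coef_pos ha hb hκ n)

lemma tendsto_inv_nat_add_one : Tendsto (fun n : ℕ => 1 / ((n : ℝ) + 1)) atTop (𝓝 0) :=
  tendsto_one_div_add_atTop_nhds_zero_nat

lemma tendsto_nat_div_add_one : Tendsto (fun n : ℕ => (n : ℝ) / (n + 1)) atTop (𝓝 1) :=
  tendsto_natCast_div_add_atTop 1

/-- Everything is expressed through the convergent sequences n/(n+1) and 1/(n+1). This shows the
limit, and also exhibits the ratios as a smooth function of the parameters in the algebra `BSeq`. -/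
lemma coefRatio_eq (ha : -1 < a) (n : ℕ) : coefRatio a b κ n =
    ((n : ℝ) / (n + 1) * (n / (n + 1)) + (1 + a + b) * (n / (n + 1) * (1 / (n + 1)))
      + κ * (1 / (n + 1) * (1 / (n + 1)))) * (1 + a * (1 / ((n : ℝ) + 1)))⁻¹ := by
  have hn : (0 : ℝ) ≤ n := n.cast_nonneg
  have h1 : (n : ℝ) + 1 ≠ 0 := by positivity
  have h2 : (n : ℝ) + 1 + a ≠ 0 := by linarith
  have h3 : 1 + a * (1 / ((n : ℝ) + 1)) = (n + 1 + a) / (n + 1) := by field_simp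
  rw [h3, coefRatio]
  field_simp

lemma tendsto_coefRatio (ha : -1 < a) : Tendsto (coefRatio a b κ) atTop (𝓝 1) := by
  have hu := tendsto_nat_div_add_one
  have hv := tendsto_inv_nat_add_one
  have := ((((hu.mul hu).add ((hu.mul hv).const_mul (1 + a + b))).add
    ((hv.mul hv).const_mul κ))).mul (((hv.const_mul a).const_add 1).inv₀ (by simp))
  refine (this.congr fun n => (coefRatio_eq ha n).symm).trans_eq ?_
  simp

lemma summable_coef (ha : -1 < a) (hb : -1 < b) (hκ : 0 < κ) :
    SummableInUnitDisc (coef a b κ) := by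
  intro r h0 h1
  have hp := coef_pos ha hb hκ
  rcases h0.eq_or_lt with rfl | h0
  · exact summable_of_ne_finset_zero (s := {0}) fun n hn => by
      rw [Finset.mem_singleton] at hn; simp [hn]
  refine summable_of_ratio_test_tendsto_lt_one h1
    (Eventually.of_forall fun n => (mul_pos (abs_pos.2 (hp n).ne') (pow_pos h0 n)).ne') ?_
  have : Tendsto (fun n => coefRatio a b κ n * r) atTop (𝓝 (1 * r)) :=
    (tendsto_coefRatio ha).mul_const r
  rw [one_mul] at this
  refine this.congr fun n => ?_
  have h2 := (hp n).ne'
  have h3 := coefRatio_pos ha hb hκ n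
  rw [norm_mul, norm_mul, norm_pow, norm_pow, Real.norm_of_nonneg h0.le, norm_norm' ,
    norm_norm', abs_of_pos (hp n), abs_of_pos (hp (n + 1)), coef, pow_succ]
  field_simp
where
  norm_norm' {x : ℝ} : ‖|x|‖ = |x| := by simp

lemma Zf_zero : Zf a b κ 0 = 1 := by
  rw [Zf, tsum_eq_single 0 fun n hn => by simp [hn]]
  simp [coef]

lemma hasDerivAt_Zf (ha : -1 < a) (hb : -1 < b) (hκ : 0 < κ) (ht : |t| < 1) :
    HasDerivAt (Zf a b κ) (Zf' a b κ t) t :=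
  (summable_coef ha hb hκ).hasDerivAt ht

lemma Zf_pos (ha : -1 < a) (hb : -1 < b) (hκ : 0 < κ) (h0 : 0 ≤ t) (ht : t < 1) :
    0 < Zf a b κ t :=
  ((summable_coef ha hb hκ).summable (by rwa [abs_of_nonneg h0])).tsum_pos
    (fun n => mul_nonneg (coef_pos ha hb hκ n).le (pow_nonneg h0 n)) 0 (by simp [coef])

lemma Zf'_pos (ha : -1 < a) (hb : -1 < b) (hκ : 0 < κ) (h0 : 0 ≤ t) (ht : t < 1) :
    0 < Zf' a b κ t :=
  ((summable_coef ha hb hκ).deriv.summable (by rwa [abs_of_nonneg h0])).tsum_pos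
    (fun n => mul_nonneg (mul_nonneg (by positivity) (coef_pos ha hb hκ _).le) (pow_nonneg h0 n)) 0
    (by simpa using coef_pos ha hb hκ 1)

/-- The hypergeometric equation in divergence form. -/
lemma hasDerivAt_Zf' (ha : -1 < a) (hb : -1 < b) (hκ : 0 < κ) (ht : |t| < 1) :
    HasDerivAt (fun s => s * (1 - s) * Zf' a b κ s)
      (κ * Zf a b κ t - (a * (1 - t) - b * t) * Zf' a b κ t) t := by
  have hc := summable_coef ha hb hκ
  set f := coef a b κ with hf
  have h1 := hc.deriv
  have h2 := h1.deriv
  have hd : HasDerivAt (Zf' a b κ) _ t := h1.hasDerivAt ht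
  have hp : HasDerivAt (fun s : ℝ => s * (1 - s)) (1 - 2 * t) t := by
    refine ((hasDerivAt_id t).mul ((hasDerivAt_id t).const_sub 1)).congr_deriv ?_
    simp only [id]
    ring
  refine (hp.mul hd).congr_deriv ?_
  set Z2 := ∑' n : ℕ, ((n + 1 : ℝ) * (((n + 1 : ℕ) + 1 : ℝ) * f (n + 1 + 1))) * t ^ n with hZ2
  have s1 : SummableInUnitDisc fun n : ℕ => (n : ℝ) * f n :=
    SummableInUnitDisc.of_shift (by simpa using h1)
  have s2 : SummableInUnitDisc fun n : ℕ => (n : ℝ) * ((n + 1 : ℝ) * f (n + 1)) :=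
    SummableInUnitDisc.of_shift (by simpa using h2)
  have s3 : SummableInUnitDisc fun n : ℕ => ((n : ℝ) - 1) * (n * f n) := by
    refine SummableInUnitDisc.of_shift ?_
    simpa using s2
  -- The series for tZ', tZ'' and t²Z''; `Z2` is the sum of the twice differentiated series.
  have e1 : t * Zf' a b κ t = ∑' n : ℕ, (n : ℝ) * f n * t ^ n := by
    rw [← s1.mul_tsum_shift (by simp) ht, Zf']
    simp [hf]
  have e2 : t * Z2 = ∑' n : ℕ, (n : ℝ) * ((n + 1 : ℝ) * f (n + 1)) * t ^ n := by
    rw [← s2.mul_tsum_shift (by simp) ht, hZ2]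
    simp
  have e3 : t * (t * Z2) = ∑' n : ℕ, ((n : ℝ) - 1) * (n * f n) * t ^ n := by
    rw [← s3.mul_tsum_shift (by simp) ht, e2]
    simp
  have H1 := e1 ▸ (s1.summable ht).hasSum
  have H2 := e2 ▸ (s2.summable ht).hasSum
  have H3 := e3 ▸ (s3.summable ht).hasSum
  have H4 : HasSum _ (Zf' a b κ t) := (h1.summable ht).hasSum
  have H5 : HasSum _ (Zf a b κ t) := (hc.summable ht).hasSum
  have H := (((H2.sub H3).add (H4.mul_left (1 + a))).sub (H1.mul_left (2 + a + b))).sub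
    (H5.mul_left κ)
  -- The coefficient of t^n in the differential equation vanishes by the two-term recursion defining
  -- `coef`.
  have H0 : (fun n : ℕ => (n : ℝ) * ((n + 1 : ℝ) * f (n + 1)) * t ^ n
      - ((n : ℝ) - 1) * (n * f n) * t ^ n + (1 + a) * ((n + 1 : ℝ) * f (n + 1) * t ^ n)
      - (2 + a + b) * ((n : ℝ) * f n * t ^ n) - κ * (f n * t ^ n)) = fun _ => 0 := by
    funext n
    have hn : (0 : ℝ) ≤ n := n.cast_nonneg
    have h1 : (n : ℝ) + 1 ≠ 0 := by positivity
    have h2 : (n : ℝ) + 1 + a ≠ 0 := by linarith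
    have : (n + 1 : ℝ) * (n + 1 + a) * f (n + 1) = ((n : ℝ) ^ 2 + n * (1 + a + b) + κ) * f n := by
      simp only [hf, coef, coefRatio]
      field_simp
    linear_combination t ^ n * this
  have := H.unique (H0 ▸ hasSum_zero)
  linear_combination this

end Hypergeometric

end HomNS

namespace HomNS

open Filter Topology

/-! ### Joint smoothness of the hypergeometric function in its parameters and argument. -/

section JointSmoothness

/-- The Banach algebra of bounded real sequences. -/
def BSeq : Type := BoundedContinuousFunction ℕ ℝ

namespace BSeq

noncomputable instance : NormedCommRing BSeq :=
  inferInstanceAs (NormedCommRing (BoundedContinuousFunction ℕ ℝ))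

noncomputable instance : NormedAlgebra ℝ BSeq :=
  inferInstanceAs (NormedAlgebra ℝ (BoundedContinuousFunction ℕ ℝ))

instance : CompleteSpace BSeq :=
  inferInstanceAs (CompleteSpace (BoundedContinuousFunction ℕ ℝ))

/-- The `n`-th term of a bounded sequence. -/
noncomputable def ev (n : ℕ) : BSeq →L[ℝ] ℝ :=
  LinearMap.mkContinuous
    { toFun := fun g => (show BoundedContinuousFunction ℕ ℝ from g) n
      map_add' := fun _ _ => rfl
      map_smul' := fun _ _ => rfl } 1
    (fun g => by
      rw [one_mul]
      exact BoundedContinuousFunction.norm_coe_le_norm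
        (show BoundedContinuousFunction ℕ ℝ from g) n)

lemma ev_mul (f g : BSeq) (n : ℕ) : ev n (f * g) = ev n f * ev n g := rfl

lemma ev_one (n : ℕ) : ev n 1 = 1 := rfl

lemma ext {f g : BSeq} (h : ∀ n, ev n f = ev n g) : f = g :=
  BoundedContinuousFunction.ext h

lemma abs_ev_le (f : BSeq) (n : ℕ) : |ev n f| ≤ ‖f‖ :=
  BoundedContinuousFunction.norm_coe_le_norm (show BoundedContinuousFunction ℕ ℝ from f) n

lemma norm_le {f : BSeq} {C : ℝ} (hC : 0 ≤ C) (h : ∀ n, |ev n f| ≤ C) : ‖f‖ ≤ C :=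
  (BoundedContinuousFunction.norm_le hC).2 h

/-- The bounded sequence with prescribed terms. -/
noncomputable def mk (s : ℕ → ℝ) (C : ℝ) (h : ∀ n, |s n| ≤ C) : BSeq :=
  BoundedContinuousFunction.ofNormedAddCommGroupDiscrete s C h

lemma ev_mk {s : ℕ → ℝ} {C : ℝ} (h : ∀ n, |s n| ≤ C) (n : ℕ) : ev n (mk s C h) = s n := rfl

/-- The right shift on bounded sequences. -/
noncomputable def shiftRight : BSeq →L[ℝ] BSeq :=
  LinearMap.mkContinuous
    { toFun := fun g => mk (fun n => Nat.casesOn n 0 fun k => ev k g) ‖g‖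
        (fun n => by cases n with
          | zero => simp
          | succ k => exact abs_ev_le g k)
      map_add' := fun f g => ext fun n => by cases n <;> simp [ev_mk]
      map_smul' := fun r g => ext fun n => by cases n <;> simp [ev_mk] } 1
    (fun g => by
      rw [one_mul]
      refine norm_le (norm_nonneg g) fun n => ?_
      cases n with
      | zero => simp [ev_mk]
      | succ k => exact abs_ev_le g k)

lemma ev_shiftRight_zero (g : BSeq) : ev 0 (shiftRight g) = 0 := rfl

lemma norm_shiftRight_le : ‖shiftRight‖ ≤ 1 := LinearMap.mkContinuous_norm_le _ zero_le_one _

/-- The left shift on bounded sequences. -/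
noncomputable def shiftLeft : BSeq →L[ℝ] BSeq :=
  LinearMap.mkContinuous
    { toFun := fun g => mk (fun n => ev (n + 1) g) ‖g‖ (fun n => abs_ev_le g _)
      map_add' := fun f g => ext fun n => by simp [ev_mk]
      map_smul' := fun r g => ext fun n => by simp [ev_mk] } 1
    (fun g => by
      rw [one_mul]
      exact norm_le (norm_nonneg g) fun n => abs_ev_le g _)

lemma norm_shiftLeft_le : ‖shiftLeft‖ ≤ 1 := LinearMap.mkContinuous_norm_le _ zero_le_one _

lemma exists_of_tendsto {s : ℕ → ℝ} {L : ℝ} (h : Tendsto s atTop (𝓝 L)) :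
    ∃ g : BSeq, ∀ n, ev n g = s n := by
  obtain ⟨C, hC⟩ := h.norm.bddAbove_range
  exact ⟨mk s C fun n => hC ⟨n, rfl⟩, fun n => rfl⟩

lemma isUnit_of_tendsto (g : BSeq) (h : Tendsto (fun n => ev n g) atTop (𝓝 1))
    (h0 : ∀ n, ev n g ≠ 0) : IsUnit g := by
  obtain ⟨k, hk⟩ := exists_of_tendsto (h.inv₀ one_ne_zero)
  exact IsUnit.of_mul_eq_one k (ext fun n => by simp [ev_mul, ev_one, hk, h0])

lemma ev_inverse {g : BSeq} (h : IsUnit g) (n : ℕ) : ev n (Ring.inverse g) = (ev n g)⁻¹ := by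
  have := congrArg (ev n) (Ring.mul_inverse_cancel g h)
  rw [ev_mul, ev_one] at this
  exact eq_inv_of_mul_eq_one_right this

lemma ev_inverse_one_sub {A : BSeq →L[ℝ] BSeq} (hA : ‖A‖ < 1) (h : BSeq) (n : ℕ) :
    ev n (Ring.inverse (1 - A) h) = ev n h + ev n (A (Ring.inverse (1 - A) h)) := by
  have := congrArg (fun T : BSeq →L[ℝ] BSeq => ev n (T h))
    (Ring.mul_inverse_cancel (1 - A) (isUnit_one_sub_of_norm_lt_one hA))
  simp only [mul_apply_eq_comp, sub_apply, one_apply_eq_self, map_sub] at this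
  linarith

/-- The generating function of a bounded sequence is given by a resolvent of the left shift. -/
lemma tsum_eq_resolvent (h : BSeq) {τ : ℝ} (hτ : |τ| < 1) :
    ∑' n, ev n h * τ ^ n = ev 0 (Ring.inverse (1 - τ • shiftLeft) h) := by
  have hA : ‖τ • shiftLeft‖ < 1 := by
    rw [norm_smul]
    exact (mul_le_of_le_one_right (norm_nonneg _) norm_shiftLeft_le).trans_lt hτ
  set k := Ring.inverse (1 - τ • shiftLeft) h
  -- The resolvent equation says that k is h plus τ times the left shift of k. Iterated N times, it
  -- gives the N-th partial sum with remainder τ^N k_N.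
  have hk : ∀ n, ev n k = ev n h + τ * ev (n + 1) k := fun n => by
    rw [ev_inverse_one_sub hA h n]; rfl
  have hsum : ∀ N, ∑ n ∈ Finset.range N, ev n h * τ ^ n = ev 0 k - τ ^ N * ev N k := by
    intro N
    induction N with
    | zero => simp
    | succ N ih =>
      rw [Finset.sum_range_succ, ih, hk N]
      ring
  have h1 : Tendsto (fun N => τ ^ N * ev N k) atTop (𝓝 0) := by
    have h2 : Tendsto (fun N => |τ| ^ N * ‖k‖) atTop (𝓝 0) := by
      simpa using (tendsto_pow_atTop_nhds_zero_of_lt_one (abs_nonneg τ) hτ).mul_const ‖k‖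
    refine squeeze_zero_norm (fun N => ?_) h2
    rw [norm_mul, norm_pow, Real.norm_eq_abs τ]
    exact mul_le_mul_of_nonneg_left (abs_ev_le k N) (by positivity)
  have hs : Summable fun n => ev n h * τ ^ n := by
    refine Summable.of_norm_bounded (g := fun n => ‖h‖ * |τ| ^ n)
      ((summable_geometric_of_lt_one (abs_nonneg τ) hτ).mul_left _) fun n => ?_
    rw [norm_mul, norm_pow, Real.norm_eq_abs τ]
    exact mul_le_mul_of_nonneg_right (abs_ev_le h n) (by positivity)
  refine tendsto_nhds_unique hs.hasSum.tendsto_sum_nat ?_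
  simpa [hsum] using (tendsto_const_nhds (x := ev 0 k)).sub h1

end BSeq

open BSeq

/-- The parameters `(a, b, κ)` for which all coefficients of `Zf a b κ` are positive. -/
def paramSet : Set (ℝ × ℝ × ℝ) := {p | -1 < p.1 ∧ -1 < p.2.1 ∧ 0 < p.2.2}

lemma isOpen_paramSet : IsOpen paramSet :=
  (isOpen_lt continuous_const continuous_fst).inter
    ((isOpen_lt continuous_const continuous_snd.fst).inter
      (isOpen_lt continuous_const continuous_snd.snd))

/-- The sequence of coefficient ratios is a smooth function of the parameters with values in the
algebra of bounded sequences. -/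
lemma exists_coefRatio_smooth : ∃ m : ℝ × ℝ × ℝ → BSeq,
    (∀ p ∈ paramSet, ContDiffAt ℝ ∞ m p) ∧
    ∀ p ∈ paramSet, ∀ n, ev n (m p) = coefRatio p.1 p.2.1 p.2.2 n := by
  obtain ⟨u, hu⟩ := exists_of_tendsto tendsto_nat_div_add_one
  obtain ⟨v, hv⟩ := exists_of_tendsto tendsto_inv_nat_add_one
  have hunit : ∀ a : ℝ, -1 < a → IsUnit (1 + a • v) := by
    intro a ha
    refine isUnit_of_tendsto _ ?_ fun n => ?_
    · have := (tendsto_inv_nat_add_one.const_mul a).const_add 1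
      simpa [hv, ev_one] using this
    · have h1 : (0 : ℝ) < n + 1 := by positivity
      have h2 : (n : ℝ) + 1 + a ≠ 0 := by
        have : (0 : ℝ) ≤ n := n.cast_nonneg
        linarith
      have : ev n (1 + a • v) = (n + 1 + a) / (n + 1) := by
        simp [hv, ev_one]; field_simp
      rw [this]
      positivity
  refine ⟨fun p => (u * u + (1 + p.1 + p.2.1) • (u * v) + p.2.2 • (v * v)) *
    Ring.inverse (1 + p.1 • v), fun p hp => ?_, fun p hp n => ?_⟩
  · obtain ⟨w, hw⟩ := hunit p.1 hp.1
    have h1 : ContDiffAt ℝ ∞ (Ring.inverse : BSeq → _) (1 + p.1 • v) := by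
      rw [← hw]; exact contDiffAt_ringInverse ℝ w
    have h2 : ContDiffAt ℝ ∞ (fun p : ℝ × ℝ × ℝ => 1 + p.1 • v) p := by fun_prop
    have h3 : ContDiffAt ℝ ∞ (fun p : ℝ × ℝ × ℝ => Ring.inverse (1 + p.1 • v)) p :=
      ContDiffAt.comp (f := fun p : ℝ × ℝ × ℝ => 1 + p.1 • v) (g := Ring.inverse) p h1 h2
    exact ContDiffAt.mul (by fun_prop) h3
  · rw [coefRatio_eq hp.1, ev_mul, ev_inverse (hunit _ hp.1)]
    simp [hu, hv, ev_mul, ev_one]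

/-- Dividing the coefficients at p by those at p₀ and rescaling by θ^n turns their recursion into g
= e + A(p) g in `BSeq`, with A smooth near p₀ and ‖A p₀‖ < 1. Hence g = (1 - A)⁻¹ e is smooth,
because inversion is. Summation against powers of t is a second resolvent, smooth in t. -/
lemma contDiffAt_Zf {p₀ : ℝ × ℝ × ℝ} (hp : p₀ ∈ paramSet) {t₀ : ℝ} (ht : |t₀| < 1) :
    ContDiffAt ℝ ∞ (fun q : (ℝ × ℝ × ℝ) × ℝ => Zf q.1.1 q.1.2.1 q.1.2.2 q.2) (p₀, t₀) := by
  obtain ⟨m, hm, hmr⟩ := exists_coefRatio_smooth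
  -- One factor θ makes A p₀ a contraction, the other makes the sequence coef(p₀) n * θ^n bounded.
  -- What remains of t^n is (t/θ²)^n, so |t₀| < θ² is required.
  obtain ⟨θ, hθ0, hθ1, hθ⟩ : ∃ θ : ℝ, 0 < θ ∧ θ < 1 ∧ |t₀| < θ * θ := by
    refine ⟨√((1 + |t₀|) / 2), by positivity, ?_, ?_⟩
    · rw [Real.sqrt_lt' one_pos]; linarith
    · rw [Real.mul_self_sqrt (by positivity)]; linarith
  have hr0 := fun n => (coefRatio_pos hp.1 hp.2.1 hp.2.2 n).ne'
  -- Q cancels the coefficient ratios at p₀, so that A p₀ is exactly θ times the right shift.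
  obtain ⟨Q, hQ⟩ := exists_of_tendsto ((tendsto_coefRatio (b := p₀.2.1) (κ := p₀.2.2)
    hp.1).inv₀ one_ne_zero)
  obtain ⟨e, he⟩ := exists_of_tendsto (s := fun n => if n = 0 then 1 else 0) (L := 0)
    (tendsto_const_nhds.congr' ((eventually_ge_atTop 1).mono fun n hn => by
      simp [show n ≠ 0 by omega]))
  obtain ⟨q, hq⟩ := exists_of_tendsto
    ((summable_coef hp.1 hp.2.1 hp.2.2).summable
      (by rwa [abs_of_pos hθ0])).tendsto_atTop_zero
  set A : ℝ × ℝ × ℝ → BSeq →L[ℝ] BSeq := fun p =>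
    (θ • shiftRight).comp (ContinuousLinearMap.mul ℝ BSeq (m p * Q)) with hA
  have hAs : ContDiffAt ℝ ∞ A p₀ := by
    have := hm p₀ hp
    fun_prop
  have hA0 : ‖A p₀‖ < 1 := by
    have h1 : m p₀ * Q = 1 := by
      refine BSeq.ext fun n => ?_
      simp [ev_mul, ev_one, hmr p₀ hp, hQ, hr0]
    have h2 : A p₀ = θ • shiftRight := by
      ext f; simp [hA, h1]
    rw [h2, norm_smul, Real.norm_of_nonneg hθ0.le]
    exact (mul_le_of_le_one_right hθ0.le norm_shiftRight_le).trans_lt hθ1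
  have hAe : ∀ᶠ p in 𝓝 p₀, ‖A p‖ < 1 :=
    hAs.continuousAt.norm.eventually_lt continuousAt_const hA0
  set g : ℝ × ℝ × ℝ → BSeq := fun p => Ring.inverse (1 - A p) e with hg
  have hgs : ContDiffAt ℝ ∞ g p₀ := by
    have h1 : ContDiffAt ℝ ∞ (Ring.inverse : (BSeq →L[ℝ] BSeq) → _) (1 - A p₀) :=
      contDiffAt_ringInverse ℝ (Units.oneSub _ hA0)
    have h2 : ContDiffAt ℝ ∞ (fun p => 1 - A p) p₀ := contDiffAt_const.sub hAs
    exact (ContDiffAt.comp p₀ h1 h2).clm_apply contDiffAt_const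
  have hcoef : ∀ p ∈ paramSet, ‖A p‖ < 1 → ∀ n,
      coef p.1 p.2.1 p.2.2 n * θ ^ n = coef p₀.1 p₀.2.1 p₀.2.2 n * ev n (g p) := by
    intro p hpp hpA n
    induction n with
    | zero =>
      have : ev 0 (g p) = ev 0 e + ev 0 (A p (g p)) := ev_inverse_one_sub hpA e 0
      rw [this, he]
      simp [hA, ev_shiftRight_zero, coef]
    | succ n ih =>
      have h1 : ev (n + 1) (g p) = ev (n + 1) e + ev (n + 1) (A p (g p)) :=
        ev_inverse_one_sub hpA e (n + 1)
      have h2 : ev (n + 1) (A p (g p)) = θ * (ev n (m p) * ev n Q * ev n (g p)) := rfl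
      rw [h1, h2, he, hmr p hpp, hQ, coef, coef, if_neg (by omega), zero_add, pow_succ]
      have h3 := hr0 n
      field_simp
      linear_combination coefRatio p.1 p.2.1 p.2.2 n * ih
  have hts : ContDiffAt ℝ ∞ (fun s : ℝ => Ring.inverse
      (1 - (s / (θ * θ)) • shiftLeft)) t₀ := by
    have hτ : ‖(t₀ / (θ * θ)) • shiftLeft‖ < 1 := by
      rw [norm_smul]
      refine (mul_le_of_le_one_right (norm_nonneg _) norm_shiftLeft_le).trans_lt ?_
      rwa [Real.norm_eq_abs, abs_div, abs_of_pos (by positivity : 0 < θ * θ),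
        div_lt_one (by positivity)]
    have h1 : ContDiffAt ℝ ∞ (Ring.inverse : (BSeq →L[ℝ] BSeq) → _)
        (1 - (t₀ / (θ * θ)) • shiftLeft) := contDiffAt_ringInverse ℝ (Units.oneSub _ hτ)
    have h2 : ContDiffAt ℝ ∞ (fun s : ℝ => 1 - (s / (θ * θ)) • shiftLeft) t₀ := by fun_prop
    exact ContDiffAt.comp t₀ h1 h2
  have hfin : ContDiffAt ℝ ∞ (fun r : (ℝ × ℝ × ℝ) × ℝ => ev 0
      (Ring.inverse (1 - (r.2 / (θ * θ)) • shiftLeft) (q * g r.1))) (p₀, t₀) := by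
    refine (ev 0).contDiff.contDiffAt.comp (p₀, t₀) ?_
    refine (ContDiffAt.comp (p₀, t₀) (f := Prod.snd) hts contDiffAt_snd).clm_apply ?_
    exact contDiffAt_const.mul (ContDiffAt.comp (p₀, t₀) (f := Prod.fst) hgs contDiffAt_fst)
  refine hfin.congr_of_eventuallyEq ?_
  have hev1 : ∀ᶠ p in 𝓝 p₀, p ∈ paramSet ∧ ‖A p‖ < 1 :=
    (isOpen_paramSet.eventually_mem hp).and hAe
  have hev2 : ∀ᶠ t in 𝓝 t₀, |t| < θ * θ := continuousAt_id.abs.eventually_lt continuousAt_const hθ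
  filter_upwards [hev1.prod_nhds hev2] with r hr
  have hτ : |r.2 / (θ * θ)| < 1 := by
    rw [abs_div, abs_of_pos (by positivity : 0 < θ * θ), div_lt_one (by positivity)]
    exact hr.2
  rw [← tsum_eq_resolvent _ hτ, Zf]
  refine tsum_congr fun n => ?_
  have := hcoef r.1 hr.1.1 hr.1.2 n
  rw [ev_mul, hq, div_pow, mul_pow]
  field_simp
  linear_combination r.2 ^ n * this

lemma contDiffOn_Zf : ContDiffOn ℝ ∞
    (fun q : (ℝ × ℝ × ℝ) × ℝ => Zf q.1.1 q.1.2.1 q.1.2.2 q.2) (paramSet ×ˢ Ioo (-1) 1) :=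
  fun _ hq => (contDiffAt_Zf hq.1 (abs_lt.2 hq.2)).contDiffWithinAt

lemma contDiffOn_Zf' : ContDiffOn ℝ ∞
    (fun q : (ℝ × ℝ × ℝ) × ℝ => Zf' q.1.1 q.1.2.1 q.1.2.2 q.2) (paramSet ×ˢ Ioo (-1) 1) := by
  have ho : IsOpen (paramSet ×ˢ Ioo (-1 : ℝ) 1) := isOpen_paramSet.prod isOpen_Ioo
  refine (((contDiffOn_infty_iff_fderiv_of_isOpen ho).1 contDiffOn_Zf).2.clm_apply
    (contDiffOn_const (c := ((0 : ℝ × ℝ × ℝ), (1 : ℝ))))).congr fun q hq => ?_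
  have h1 := ((contDiffOn_Zf.contDiffAt (ho.mem_nhds hq)).differentiableAt
    (by simp)).hasFDerivAt.comp_hasDerivAt q.2
      ((hasDerivAt_const q.2 q.1).prodMk (hasDerivAt_id q.2))
  exact (hasDerivAt_Zf hq.1.1 hq.1.2.1 hq.1.2.2 (abs_lt.2 hq.2)).unique h1

end JointSmoothness

end HomNS

namespace HomNS

open Filter Topology MeasureTheory

/-! ### The Riccati equation and its extremal and intermediate solutions. -/

section Riccati

variable {a b κ t s : ℝ} {y y₁ y₂ : ℝ → ℝ}

/-- `y` solves `t(1-t) y' = κ t(1-t) - y² - (a(1-t) - bt) y` in `(0,1)`. -/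
def IsRiccati (a b κ : ℝ) (y : ℝ → ℝ) : Prop :=
  ∀ t ∈ Ioo (0 : ℝ) 1,
    HasDerivAt y (κ - (y t ^ 2 + (a * (1 - t) - b * t) * y t) / (t * (1 - t))) t

lemma IsRiccati.continuousOn (h : IsRiccati a b κ y) : ContinuousOn y (Ioo 0 1) :=
  fun t ht => (h t ht).continuousAt.continuousWithinAt

/-- Reflection exchanges the two singular points and reverses the order of solutions, so results at
t = 1 follow from those at t = 0. -/
lemma IsRiccati.mirror (h : IsRiccati a b κ y) : IsRiccati b a κ fun t => -y (1 - t) := by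
  intro t ht
  have h1 := (h (1 - t) ⟨by linarith [ht.2], by linarith [ht.1]⟩).comp t
    ((hasDerivAt_id t).const_sub 1)
  refine h1.neg.congr_deriv ?_
  have : t ≠ 0 := ht.1.ne'
  have : 1 - t ≠ 0 := (sub_pos.2 ht.2).ne'
  simp only [sub_sub_cancel]
  field_simp
  ring

/-- The product of e with exp(∫A) is constant. Only the positivity of the resulting factor is used
later. -/
lemma linear_ode_apply {A e : ℝ → ℝ} (hA : ContinuousOn A (Ioo 0 1))
    (he : ∀ t ∈ Ioo (0 : ℝ) 1, HasDerivAt e (-(A t * e t)) t) (hs : s ∈ Ioo (0 : ℝ) 1)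
    (ht : t ∈ Ioo (0 : ℝ) 1) : ∃ c > 0, e t = c * e s := by
  have hint : ∀ r ∈ Ioo (0 : ℝ) 1, HasDerivAt (fun r => ∫ u in s..r, A u) (A r) r := fun r hr =>
    intervalIntegral.integral_hasDerivAt_right
      ((hA.mono ((ordConnected_Ioo.uIcc_subset hs hr))).intervalIntegrable)
      (hA.stronglyMeasurableAtFilter isOpen_Ioo r hr) (hA.continuousAt (isOpen_Ioo.mem_nhds hr))
  set B := fun r => ∫ u in s..r, A u
  have hder : ∀ r ∈ Ioo (0 : ℝ) 1, HasDerivAt (fun r => e r * Real.exp (B r)) 0 r := fun r hr =>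
    ((he r hr).mul (hint r hr).exp).congr_deriv (by ring)
  have hconst := isOpen_Ioo.is_const_of_deriv_eq_zero isPreconnected_Ioo
    (fun r hr => (hder r hr).differentiableAt.differentiableWithinAt)
    (fun r hr => (hder r hr).deriv) ht hs
  refine ⟨Real.exp (B s) / Real.exp (B t), by positivity, ?_⟩
  have := (Real.exp_pos (B t)).ne'
  field_simp
  linarith

/-- The difference of squares factors, so the difference solves a linear homogeneous equation. It
therefore keeps its sign, and solutions that agree at one point agree throughout. -/
lemma IsRiccati.sub_eq (h₁ : IsRiccati a b κ y₁) (h₂ : IsRiccati a b κ y₂)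
    (hs : s ∈ Ioo (0 : ℝ) 1) (ht : t ∈ Ioo (0 : ℝ) 1) :
    ∃ c > 0, y₁ t - y₂ t = c * (y₁ s - y₂ s) := by
  refine linear_ode_apply (e := fun t => y₁ t - y₂ t)
    (A := fun t => (y₁ t + y₂ t + (a * (1 - t) - b * t)) / (t * (1 - t))) ?_ (fun t ht => ?_) hs ht
  · refine ((h₁.continuousOn.add h₂.continuousOn).add (by fun_prop)).div (by fun_prop)
      fun t ht => (mul_pos ht.1 (sub_pos.2 ht.2)).ne'
  · refine ((h₁ t ht).sub (h₂ t ht)).congr_deriv ?_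
    have : t ≠ 0 := ht.1.ne'
    have : 1 - t ≠ 0 := (sub_pos.2 ht.2).ne'
    field_simp
    ring

lemma IsRiccati.eq_of_eq (h₁ : IsRiccati a b κ y₁) (h₂ : IsRiccati a b κ y₂)
    (hs : s ∈ Ioo (0 : ℝ) 1) (h : y₁ s = y₂ s) (ht : t ∈ Ioo (0 : ℝ) 1) : y₁ t = y₂ t := by
  obtain ⟨c, -, hc⟩ := h₁.sub_eq h₂ hs ht
  rw [h, sub_self, mul_zero] at hc
  linarith

/-- The Riccati solution that is regular at `t = 0`. -/
noncomputable def Ym (a b κ t : ℝ) : ℝ := t * (1 - t) * Zf' a b κ t / Zf a b κ t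

/-- The Riccati solution that is regular at `t = 1`. -/
noncomputable def Yp (a b κ t : ℝ) : ℝ := -Ym b a κ (1 - t)

lemma Yp_mirror (a b κ t : ℝ) : -Yp b a κ (1 - t) = Ym a b κ t := by simp [Yp]

lemma Ym_pos (ha : -1 < a) (hb : -1 < b) (hκ : 0 < κ) (ht : t ∈ Ioo (0 : ℝ) 1) :
    0 < Ym a b κ t :=
  div_pos (mul_pos (mul_pos ht.1 (sub_pos.2 ht.2)) (Zf'_pos ha hb hκ ht.1.le ht.2))
    (Zf_pos ha hb hκ ht.1.le ht.2)

lemma one_sub_mem {t : ℝ} (ht : t ∈ Ioo (0 : ℝ) 1) : 1 - t ∈ Ioo (0 : ℝ) 1 :=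
  ⟨sub_pos.2 ht.2, by linarith [ht.1]⟩

lemma half_mem : (1 / 2 : ℝ) ∈ Ioo (0 : ℝ) 1 := by norm_num

lemma Yp_neg (ha : -1 < a) (hb : -1 < b) (hκ : 0 < κ) (ht : t ∈ Ioo (0 : ℝ) 1) :
    Yp a b κ t < 0 := neg_neg_of_pos (Ym_pos hb ha hκ (one_sub_mem ht))

lemma abs_lt_of_mem {t : ℝ} (ht : t ∈ Ioo (0 : ℝ) 1) : |t| < 1 := by
  rw [abs_of_pos ht.1]; exact ht.2

lemma hasDerivAt_Zf_Ym (ha : -1 < a) (hb : -1 < b) (hκ : 0 < κ) (ht : t ∈ Ioo (0 : ℝ) 1) :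
    HasDerivAt (Zf a b κ) (Zf a b κ t * Ym a b κ t / (t * (1 - t))) t := by
  refine (hasDerivAt_Zf ha hb hκ (abs_lt_of_mem ht)).congr_deriv ?_
  have := (Zf_pos ha hb hκ ht.1.le ht.2).ne'
  have : t ≠ 0 := ht.1.ne'
  have : 1 - t ≠ 0 := (sub_pos.2 ht.2).ne'
  rw [Ym]
  field_simp

lemma isRiccati_Ym (ha : -1 < a) (hb : -1 < b) (hκ : 0 < κ) : IsRiccati a b κ (Ym a b κ) := by
  intro t ht
  have hZ := (Zf_pos ha hb hκ ht.1.le ht.2).ne'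
  refine ((hasDerivAt_Zf' ha hb hκ (abs_lt_of_mem ht)).div
    (hasDerivAt_Zf ha hb hκ (abs_lt_of_mem ht)) hZ).congr_deriv ?_
  have : t ≠ 0 := ht.1.ne'
  have : 1 - t ≠ 0 := (sub_pos.2 ht.2).ne'
  rw [Ym]
  field_simp
  ring

lemma isRiccati_Yp (ha : -1 < a) (hb : -1 < b) (hκ : 0 < κ) : IsRiccati a b κ (Yp a b κ) :=
  (isRiccati_Ym hb ha hκ).mirror

lemma hasDerivAt_Zf_Yp (ha : -1 < a) (hb : -1 < b) (hκ : 0 < κ) (ht : t ∈ Ioo (0 : ℝ) 1) :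
    HasDerivAt (fun t => Zf b a κ (1 - t))
      (Zf b a κ (1 - t) * Yp a b κ t / (t * (1 - t))) t := by
  refine ((hasDerivAt_Zf_Ym hb ha hκ (one_sub_mem ht)).comp t
    ((hasDerivAt_id t).const_sub 1)).congr_deriv ?_
  rw [Yp, sub_sub_cancel]
  ring

/-- The denominator of `Ymix`. -/
noncomputable def Zmix (a b κ η t : ℝ) : ℝ :=
  (η - Yp a b κ (1 / 2)) / Zf a b κ (1 / 2) * Zf a b κ t +
    (Ym a b κ (1 / 2) - η) / Zf b a κ (1 / 2) * Zf b a κ (1 - t)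

/-- The Riccati solution with value `η` at `1/2`. -/
noncomputable def Ymix (a b κ η t : ℝ) : ℝ :=
  ((η - Yp a b κ (1 / 2)) / Zf a b κ (1 / 2) * (Zf a b κ t * Ym a b κ t) +
    (Ym a b κ (1 / 2) - η) / Zf b a κ (1 / 2) * (Zf b a κ (1 - t) * Yp a b κ t)) / Zmix a b κ η t

variable {η : ℝ}

lemma Yp_lt_Ym (ha : -1 < a) (hb : -1 < b) (hκ : 0 < κ) (ht : t ∈ Ioo (0 : ℝ) 1) :
    Yp a b κ t < Ym a b κ t :=
  (Yp_neg ha hb hκ ht).trans (Ym_pos ha hb hκ ht)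

/-- Both coefficients are nonnegative, and they cannot vanish together because `Yp` lies strictly
below `Ym` at 1/2. -/
lemma Zmix_pos (ha : -1 < a) (hb : -1 < b) (hκ : 0 < κ) (h₁ : Yp a b κ (1 / 2) ≤ η)
    (h₂ : η ≤ Ym a b κ (1 / 2)) (ht : t ∈ Ioo (0 : ℝ) 1) : 0 < Zmix a b κ η t := by
  have z1 := Zf_pos ha hb hκ ht.1.le ht.2
  have z2 := Zf_pos hb ha hκ (one_sub_mem ht).1.le (one_sub_mem ht).2
  have z3 := Zf_pos ha hb hκ half_mem.1.le half_mem.2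
  have z4 := Zf_pos hb ha hκ half_mem.1.le half_mem.2
  rcases h₁.eq_or_lt with h | h
  · have := Yp_lt_Ym ha hb hκ half_mem
    rw [Zmix, h, sub_self, zero_div, zero_mul, zero_add]
    exact mul_pos (div_pos (by linarith) z4) z2
  · exact add_pos_of_pos_of_nonneg (mul_pos (div_pos (by linarith) z3) z1)
      (mul_nonneg (div_nonneg (by linarith) z4.le) z2.le)

lemma Ymix_half (ha : -1 < a) (hb : -1 < b) (hκ : 0 < κ) : Ymix a b κ η (1 / 2) = η := by
  have z3 := (Zf_pos ha hb hκ half_mem.1.le half_mem.2).ne'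
  have z4 := (Zf_pos hb ha hκ half_mem.1.le half_mem.2).ne'
  have h := (sub_pos.2 (Yp_lt_Ym ha hb hκ half_mem)).ne'
  have e : (1 : ℝ) - 1 / 2 = 1 / 2 := by norm_num
  have e1 : Zmix a b κ η (1 / 2) = Ym a b κ (1 / 2) - Yp a b κ (1 / 2) := by
    rw [Zmix, e, div_mul_cancel₀ _ z3, div_mul_cancel₀ _ z4]; ring
  rw [Ymix, e1, e, ← mul_assoc, ← mul_assoc, div_mul_cancel₀ _ z3, div_mul_cancel₀ _ z4,
    div_eq_iff h]
  ring

/-- `Ymix` is t(1-t) times the logarithmic derivative of `Zmix`, which is a combination of the two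
solutions of the linear equation. -/
lemma isRiccati_Ymix (ha : -1 < a) (hb : -1 < b) (hκ : 0 < κ) (h₁ : Yp a b κ (1 / 2) ≤ η)
    (h₂ : η ≤ Ym a b κ (1 / 2)) : IsRiccati a b κ (Ymix a b κ η) := by
  intro t ht
  have hD := (Zmix_pos ha hb hκ h₁ h₂ ht).ne'
  have d1 := hasDerivAt_Zf_Ym ha hb hκ ht
  have d2 := hasDerivAt_Zf_Yp ha hb hκ ht
  have r1 := isRiccati_Ym ha hb hκ t ht
  have r2 := isRiccati_Yp ha hb hκ t ht
  have h1 : t ≠ 0 := ht.1.ne'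
  have h2 : 1 - t ≠ 0 := (sub_pos.2 ht.2).ne'
  refine ((((d1.mul r1).const_mul _).add ((d2.mul r2).const_mul _)).div
    ((d1.const_mul _).add (d2.const_mul _)) hD).congr_deriv ?_
  unfold Ymix
  unfold Zmix at hD ⊢
  generalize (η - Yp a b κ (1 / 2)) / Zf a b κ (1 / 2) = α at *
  generalize (Ym a b κ (1 / 2) - η) / Zf b a κ (1 / 2) = β at *
  simp only [Pi.add_apply, Pi.mul_apply]
  generalize Zf a b κ t = z at *
  generalize Zf b a κ (1 - t) = w at *
  generalize Ym a b κ t = u at *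
  generalize Yp a b κ t = v at *
  field_simp
  ring

end Riccati

end HomNS

namespace HomNS

open Filter Topology MeasureTheory

/-! ### Explicit integration against the extremal solution, and extremality. -/

section Comparison

variable {a b κ t s : ℝ} {y : ℝ → ℝ}

/-- The integrating factor `t^a (1-t)^b Z²`. -/
noncomputable def mu (a b κ t : ℝ) : ℝ := t ^ a * (1 - t) ^ b * Zf a b κ t ^ 2

/-- The regular factor of `kern`. -/
noncomputable def Gf (a b κ t : ℝ) : ℝ := ((1 - t) ^ (1 + b) * Zf a b κ t ^ 2)⁻¹

/-- The function `1 / (t (1-t) mu(t))`. -/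
noncomputable def kern (a b κ t : ℝ) : ℝ := (t ^ (1 + a))⁻¹ * Gf a b κ t

lemma mu_pos (ha : -1 < a) (hb : -1 < b) (hκ : 0 < κ) (ht : t ∈ Ioo (0 : ℝ) 1) :
    0 < mu a b κ t :=
  mul_pos (mul_pos (Real.rpow_pos_of_pos ht.1 _) (Real.rpow_pos_of_pos (sub_pos.2 ht.2) _))
    (pow_pos (Zf_pos ha hb hκ ht.1.le ht.2) 2)

lemma Gf_pos (ha : -1 < a) (hb : -1 < b) (hκ : 0 < κ) (h0 : 0 ≤ t) (h1 : t < 1) :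
    0 < Gf a b κ t :=
  inv_pos.2 (mul_pos (Real.rpow_pos_of_pos (sub_pos.2 h1) _) (pow_pos (Zf_pos ha hb hκ h0 h1) 2))

lemma Gf_zero : Gf a b κ 0 = 1 := by simp [Gf, Zf_zero]

lemma kern_eq (ht : t ∈ Ioo (0 : ℝ) 1) : kern a b κ t = (mu a b κ t * (t * (1 - t)))⁻¹ := by
  rw [kern, Gf, mu, Real.rpow_add ht.1, Real.rpow_add (sub_pos.2 ht.2), Real.rpow_one,
    Real.rpow_one, ← mul_inv]
  congr 1
  ring

lemma inv_mu_eq (ht : t ∈ Ioo (0 : ℝ) 1) :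
    (mu a b κ t)⁻¹ = (t ^ a)⁻¹ * ((1 - t) * Gf a b κ t) := by
  have h1 : 1 - t ≠ 0 := (sub_pos.2 ht.2).ne'
  rw [Gf, mu, Real.rpow_add (sub_pos.2 ht.2), Real.rpow_one, mul_inv, mul_inv, mul_inv, mul_inv]
  field_simp

lemma hasDerivAt_mu (ha : -1 < a) (hb : -1 < b) (hκ : 0 < κ) (ht : t ∈ Ioo (0 : ℝ) 1) :
    HasDerivAt (mu a b κ)
      (mu a b κ t * ((a * (1 - t) - b * t) + 2 * Ym a b κ t) / (t * (1 - t))) t := by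
  have h0 : t ≠ 0 := ht.1.ne'
  have h1 : 1 - t ≠ 0 := (sub_pos.2 ht.2).ne'
  have d1 := Real.hasDerivAt_rpow_const (p := a) (Or.inl h0)
  have d2 := ((hasDerivAt_id t).const_sub 1).rpow_const (p := b) (Or.inl h1)
  refine ((d1.mul d2).mul ((hasDerivAt_Zf_Ym ha hb hκ ht).pow 2)).congr_deriv ?_
  simp only [id, Real.rpow_sub_one h0, Real.rpow_sub_one h1, mu, Pi.mul_apply, Pi.pow_apply]
  field_simp
  ring

lemma continuousOn_Zf (ha : -1 < a) (hb : -1 < b) (hκ : 0 < κ) :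
    ContinuousOn (Zf a b κ) (Ioo (-1) 1) := fun _ ht =>
  (hasDerivAt_Zf ha hb hκ (abs_lt.2 ht)).continuousAt.continuousWithinAt

lemma continuousOn_Gf (ha : -1 < a) (hb : -1 < b) (hκ : 0 < κ) :
    ContinuousOn (Gf a b κ) (Ico 0 1) := by
  refine ContinuousOn.inv₀ (ContinuousOn.mul ?_ (((continuousOn_Zf ha hb hκ).mono
    fun t ht => ⟨by linarith [ht.1], ht.2⟩).pow 2)) fun t ht => ?_
  · exact ContinuousOn.rpow_const (by fun_prop) fun t ht => Or.inl (sub_pos.2 ht.2).ne'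
  · exact (mul_pos (Real.rpow_pos_of_pos (sub_pos.2 ht.2) _)
      (pow_pos (Zf_pos ha hb hκ ht.1 ht.2) 2)).ne'

lemma continuousOn_kern (ha : -1 < a) (hb : -1 < b) (hκ : 0 < κ) :
    ContinuousOn (kern a b κ) (Ioo 0 1) := by
  refine ContinuousOn.mul (ContinuousOn.inv₀ (ContinuousOn.rpow_const (by fun_prop)
    fun t ht => Or.inl ht.1.ne') fun t ht => (Real.rpow_pos_of_pos ht.1 _).ne')
    ((continuousOn_Gf ha hb hκ).mono Ioo_subset_Ico_self)

/-- With u = Ym - y, the Bernoulli equation t(1-t)u' = u² - (2 Ym + a(1-t) - bt) u holds. The factor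
`mu` removes the linear term, so 1/(mu u) has derivative -1/(t(1-t) mu), which is minus `kern`. -/
lemma IsRiccati.inv_formula (ha : -1 < a) (hb : -1 < b) (hκ : 0 < κ) (hy : IsRiccati a b κ y)
    (hne : y (1 / 2) ≠ Ym a b κ (1 / 2)) (ht : t ∈ Ioc (0 : ℝ) (1 / 2)) :
    (mu a b κ t * (Ym a b κ t - y t))⁻¹ =
      (mu a b κ (1 / 2) * (Ym a b κ (1 / 2) - y (1 / 2)))⁻¹ +
        ∫ s in t..1 / 2, kern a b κ s := by
  have hR := isRiccati_Ym ha hb hκ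
  have hsub : uIcc t (1 / 2) ⊆ Ioo (0 : ℝ) 1 := by
    rw [uIcc_of_le ht.2]
    exact fun s hs => ⟨ht.1.trans_le hs.1, hs.2.trans_lt (by norm_num)⟩
  have hder : ∀ s ∈ uIcc t (1 / 2), HasDerivAt (fun s => (mu a b κ s * (Ym a b κ s - y s))⁻¹)
      (-kern a b κ s) s := by
    intro s hs
    have hs := hsub hs
    have h1 : Ym a b κ s - y s ≠ 0 := fun h => hne
      (hy.eq_of_eq hR hs (by linarith) half_mem)
    have h2 := (mu_pos ha hb hκ hs).ne'
    refine (((hasDerivAt_mu ha hb hκ hs).mul ((hR s hs).sub (hy s hs))).inv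
      (mul_ne_zero h2 h1)).congr_deriv ?_
    rw [kern_eq hs]
    have : s ≠ 0 := hs.1.ne'
    have : 1 - s ≠ 0 := (sub_pos.2 hs.2).ne'
    simp only [Pi.mul_apply, Pi.sub_apply]
    generalize Ym a b κ s = u at *
    generalize mu a b κ s = m at *
    generalize y s = v at *
    field_simp
    ring
  have hint : IntervalIntegrable (fun s => -kern a b κ s) volume t (1 / 2) :=
    ((continuousOn_kern ha hb hκ).mono hsub).neg.intervalIntegrable
  have := intervalIntegral.integral_eq_sub_of_hasDerivAt hder hint
  rw [intervalIntegral.integral_neg] at this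
  linarith

lemma exists_Gf_lower (ha : -1 < a) (hb : -1 < b) (hκ : 0 < κ) :
    ∃ c > 0, ∀ s ∈ Icc (0 : ℝ) (1 / 2), c ≤ Gf a b κ s := by
  obtain ⟨s₀, hs₀, hmin⟩ := (isCompact_Icc (a := (0 : ℝ)) (b := 1 / 2)).exists_isMinOn
    ⟨0, by norm_num⟩ ((continuousOn_Gf ha hb hκ).mono fun s hs => ⟨hs.1, by linarith [hs.2]⟩)
  exact ⟨_, Gf_pos ha hb hκ hs₀.1 (by linarith [hs₀.2]), fun s hs => hmin hs⟩

lemma intervalIntegrable_kern (ha : -1 < a) (hb : -1 < b) (hκ : 0 < κ)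
    (ht : t ∈ Ioc (0 : ℝ) (1 / 2)) : IntervalIntegrable (kern a b κ) volume t (1 / 2) :=
  ((continuousOn_kern ha hb hκ).mono (by
    rw [uIcc_of_le ht.2]
    exact fun s hs => ⟨ht.1.trans_le hs.1, hs.2.trans_lt (by norm_num)⟩)).intervalIntegrable

/-- Since a ≥ 0 and `Gf` ≥ c > 0, the kernel dominates c/s on (0, 1/2], which is not integrable at
0. -/
lemma tendsto_integral_kern (ha : 0 ≤ a) (hb : -1 < b) (hκ : 0 < κ) :
    Tendsto (fun t => ∫ s in t..1 / 2, kern a b κ s) (𝓝[>] 0) atTop := by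
  have ha' : -1 < a := by linarith
  obtain ⟨c, hc, hG⟩ := exists_Gf_lower ha' hb hκ
  have h1 : Tendsto (fun t : ℝ => c * Real.log ((1 / 2) / t)) (𝓝[>] 0) atTop := by
    refine Tendsto.const_mul_atTop hc (Real.tendsto_log_atTop.comp ?_)
    exact (tendsto_inv_nhdsGT_zero.const_mul_atTop (by norm_num : (0 : ℝ) < 1 / 2)).congr
      fun t => (div_eq_mul_inv _ _).symm
  refine tendsto_atTop_mono' _ ?_ h1
  filter_upwards [Ioc_mem_nhdsGT (by norm_num : (0 : ℝ) < 1 / 2)] with t ht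
  rw [← integral_inv_of_pos ht.1 (by norm_num), ← intervalIntegral.integral_const_mul]
  refine intervalIntegral.integral_mono_on ht.2 ?_ (intervalIntegrable_kern ha' hb hκ ht)
    fun s hs => ?_
  · refine (intervalIntegral.intervalIntegrable_inv (fun s hs => ?_) continuousOn_id).const_mul _
    rw [uIcc_of_le ht.2] at hs
    exact (ht.1.trans_le hs.1).ne'
  · have hs0 : 0 < s := ht.1.trans_le hs.1
    rw [kern, mul_comm c]
    refine mul_le_mul (inv_anti₀ (Real.rpow_pos_of_pos hs0 _) ?_) (hG s ⟨hs0.le, hs.2⟩) hc.le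
      (by positivity)
    calc s ^ (1 + a) ≤ s ^ (1 : ℝ) :=
          Real.rpow_le_rpow_of_exponent_ge hs0 (by linarith [hs.2]) (by linarith)
      _ = s := Real.rpow_one s

/-- `Ym` is the largest Riccati solution. -/
lemma IsRiccati.le_Ym (ha : 0 ≤ a) (hb : -1 < b) (hκ : 0 < κ) (hy : IsRiccati a b κ y)
    (ht : t ∈ Ioo (0 : ℝ) 1) : y t ≤ Ym a b κ t := by
  have ha' : -1 < a := by linarith
  -- A solution above `Ym` at one point is above it everywhere, so the left side of `inv_formula` is
  -- always negative; but its right side tends to +∞ at 0.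
  by_contra! hlt
  have hR := isRiccati_Ym ha' hb hκ
  have hall : ∀ s ∈ Ioo (0 : ℝ) 1, Ym a b κ s < y s := fun s hs => by
    obtain ⟨c, hc, h⟩ := hy.sub_eq hR ht hs
    have := mul_pos hc (sub_pos.2 hlt)
    linarith
  have h1 := (tendsto_integral_kern ha hb hκ).eventually_ge_atTop
    (-(mu a b κ (1 / 2) * (Ym a b κ (1 / 2) - y (1 / 2)))⁻¹)
  obtain ⟨s, hs1, hs⟩ := (h1.and (Ioc_mem_nhdsGT (by norm_num : (0 : ℝ) < 1 / 2))).exists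
  have hs' : s ∈ Ioo (0 : ℝ) 1 := ⟨hs.1, by linarith [hs.2]⟩
  have h2 := hy.inv_formula ha' hb hκ (hall _ half_mem).ne' hs
  have h3 : (mu a b κ s * (Ym a b κ s - y s))⁻¹ < 0 :=
    inv_lt_zero.2 (mul_neg_of_pos_of_neg (mu_pos ha' hb hκ hs') (sub_neg.2 (hall s hs')))
  linarith

lemma IsRiccati.Yp_le (ha : -1 < a) (hb : 0 ≤ b) (hκ : 0 < κ) (hy : IsRiccati a b κ y)
    (ht : t ∈ Ioo (0 : ℝ) 1) : Yp a b κ t ≤ y t := by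
  have := hy.mirror.le_Ym hb ha hκ (one_sub_mem ht)
  rw [sub_sub_cancel] at this
  rw [Yp]
  linarith

/-- Here the singular power t^a is collected in the denominator, whose behaviour at 0 separates the
cases a > 0 and a = 0. -/
lemma IsRiccati.formula (ha : -1 < a) (hb : -1 < b) (hκ : 0 < κ) (hy : IsRiccati a b κ y)
    (hne : y (1 / 2) ≠ Ym a b κ (1 / 2)) (ht : t ∈ Ioc (0 : ℝ) (1 / 2)) :
    Ym a b κ t - y t = (1 - t) * Gf a b κ t * (t ^ a *
      ((mu a b κ (1 / 2) * (Ym a b κ (1 / 2) - y (1 / 2)))⁻¹ +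
        ∫ s in t..1 / 2, kern a b κ s))⁻¹ := by
  have ht' : t ∈ Ioo (0 : ℝ) 1 := ⟨ht.1, by linarith [ht.2]⟩
  have h := hy.inv_formula ha hb hκ hne ht
  rw [← h, mul_inv, inv_inv]
  have h2 := mul_inv_cancel₀ (mu_pos ha hb hκ ht').ne'
  rw [inv_mu_eq ht'] at h2
  linear_combination -(Ym a b κ t - y t) * h2

end Comparison

/-! ### Boundary limits of Riccati solutions. -/

section Limits

variable {a b κ t s : ℝ} {y : ℝ → ℝ}

lemma continuousAt_Ym_zero (ha : -1 < a) (hb : -1 < b) (hκ : 0 < κ) :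
    ContinuousAt (Ym a b κ) 0 := by
  have h0 : |(0 : ℝ)| < 1 := by simp
  exact ((hasDerivAt_Zf' ha hb hκ h0).continuousAt).div (hasDerivAt_Zf ha hb hκ h0).continuousAt
    (by simp [Zf_zero])

lemma differentiableAt_Gf_zero (ha : -1 < a) (hb : -1 < b) (hκ : 0 < κ) :
    DifferentiableAt ℝ (Gf a b κ) 0 := by
  have h0 : |(0 : ℝ)| < 1 := by simp
  have h1 := (hasDerivAt_Zf ha hb hκ h0).differentiableAt
  have h2 : DifferentiableAt ℝ (fun t : ℝ => (1 - t) ^ (1 + b)) 0 :=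
    (((hasDerivAt_id (0 : ℝ)).const_sub 1).rpow_const (p := 1 + b) (by simp)).differentiableAt
  exact (h2.mul (h1.pow 2)).inv (by simp [Zf_zero])

lemma exists_Gf_sub_one_le (ha : -1 < a) (hb : -1 < b) (hκ : 0 < κ) :
    ∃ C ≥ 0, ∀ s ∈ Icc (0 : ℝ) (1 / 2), |Gf a b κ s - 1| ≤ C * s := by
  have hc : ContinuousOn (dslope (Gf a b κ) 0) (Icc 0 (1 / 2)) := by
    intro s hs
    rcases eq_or_ne s 0 with rfl | h
    · exact (continuousAt_dslope_same.2 (differentiableAt_Gf_zero ha hb hκ)).continuousWithinAt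
    · exact (continuousWithinAt_dslope_of_ne h).2 (((continuousOn_Gf ha hb hκ) s
        ⟨hs.1, by linarith [hs.2]⟩).mono fun s hs => ⟨hs.1, by linarith [hs.2]⟩)
  obtain ⟨C, hC⟩ := isCompact_Icc.exists_bound_of_continuousOn hc
  refine ⟨C, (norm_nonneg _).trans (hC 0 (by norm_num)), fun s hs => ?_⟩
  have h1 := sub_smul_dslope (Gf a b κ) 0 s
  rw [sub_zero, smul_eq_mul, Gf_zero] at h1
  rw [← h1, abs_mul, abs_of_nonneg hs.1, mul_comm]
  exact mul_le_mul_of_nonneg_right (hC s hs) hs.1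

lemma integral_rpow_neg {α : ℝ} (hα : α ≠ 0) (ht : t ∈ Ioc (0 : ℝ) (1 / 2)) :
    ∫ s in t..1 / 2, s ^ (-1 - α) = (t ^ (-α) - (1 / 2) ^ (-α)) / α := by
  have h0 : (0 : ℝ) ∉ uIcc t (1 / 2) := by
    rw [uIcc_of_le ht.2]
    exact fun h => absurd h.1 (not_le.2 ht.1)
  rw [integral_rpow (Or.inr ⟨by contrapose! hα; linarith, h0⟩)]
  rw [show -1 - α + 1 = -α by ring, div_neg, ← neg_div, neg_sub]

lemma intervalIntegrable_rpow_of_mem {r : ℝ} (ht : t ∈ Ioc (0 : ℝ) (1 / 2)) :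
    IntervalIntegrable (fun s => s ^ r) volume t (1 / 2) := by
  refine intervalIntegral.intervalIntegrable_rpow (Or.inr ?_)
  rw [uIcc_of_le ht.2]
  exact fun h => absurd h.1 (not_le.2 ht.1)

/-- Replacing `Gf` by its value 1 at 0 gives an elementary integral with limit 1/a. The error is
controlled by |Gf s - 1| ≤ C s and is O(t^α) for a small exponent α > 0. -/
lemma tendsto_rpow_mul_integral_kern (ha : 0 < a) (hb : -1 < b) (hκ : 0 < κ) :
    Tendsto (fun t => t ^ a * ∫ s in t..1 / 2, kern a b κ s) (𝓝[>] 0) (𝓝 a⁻¹) := by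
  have ha' : -1 < a := by linarith
  obtain ⟨C, hC0, hC⟩ := exists_Gf_sub_one_le ha' hb hκ
  -- The bound 1 allows s ≤ s^α on (0, 1/2]; the bound a/2 keeps a - α positive, so that the error
  -- integral is a power and not a logarithm.
  set α := min (a / 2) 1 with hα
  have hα0 : 0 < α := by positivity
  have hα1 : α ≤ 1 := min_le_right _ _
  have hαa : 0 < a - α := by have : α ≤ a / 2 := min_le_left _ _; linarith
  have hrp : ∀ r : ℝ, 0 < r → Tendsto (fun t : ℝ => t ^ r) (𝓝[>] 0) (𝓝 0) := fun r hr =>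
    ((Real.continuousAt_rpow_const 0 r (Or.inr hr.le)).tendsto.mono_left
      nhdsWithin_le_nhds).trans_eq (by rw [Real.zero_rpow hr.ne'])
  have h1 : Tendsto (fun t : ℝ => (1 - t ^ a * (1 / 2) ^ (-a)) / a) (𝓝[>] 0) (𝓝 a⁻¹) := by
    have := (((hrp a ha).mul_const ((1 / 2 : ℝ) ^ (-a))).const_sub 1).div_const a
    simpa using this
  have h2 : Tendsto (fun t : ℝ => C / (a - α) * t ^ α) (𝓝[>] 0) (𝓝 0) := by
    simpa using (hrp α hα0).const_mul (C / (a - α))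
  rw [tendsto_iff_norm_sub_tendsto_zero] at h1 ⊢
  refine squeeze_zero' (Eventually.of_forall fun _ => norm_nonneg _) ?_ ((h2.add h1).trans_eq
    (by rw [add_zero]))
  filter_upwards [Ioc_mem_nhdsGT (by norm_num : (0 : ℝ) < 1 / 2)] with t ht
  have hta : 0 < t ^ a := Real.rpow_pos_of_pos ht.1 _
  have e1 : (1 - t ^ a * (1 / 2) ^ (-a)) / a = t ^ a * ∫ s in t..1 / 2, s ^ (-1 - a) := by
    rw [integral_rpow_neg ha.ne' ht, Real.rpow_neg ht.1.le]
    field_simp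
  have e2 : t ^ a * (∫ s in t..1 / 2, kern a b κ s) - t ^ a * ∫ s in t..1 / 2, s ^ (-1 - a)
      = t ^ a * ∫ s in t..1 / 2, (kern a b κ s - s ^ (-1 - a)) := by
    rw [intervalIntegral.integral_sub (intervalIntegrable_kern ha' hb hκ ht)
      (intervalIntegrable_rpow_of_mem ht), mul_sub]
  have e3 : |∫ s in t..1 / 2, (kern a b κ s - s ^ (-1 - a))|
      ≤ ∫ s in t..1 / 2, C * s ^ (-1 - (a - α)) := by
    refine intervalIntegral.norm_integral_le_of_norm_le (E := ℝ)
        (g := fun s => C * s ^ (-1 - (a - α)))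
      ht.2 (Eventually.of_forall fun s hs => ?_) ((intervalIntegrable_rpow_of_mem ht).const_mul C)
    have hs0 : 0 < s := ht.1.trans hs.1
    have : kern a b κ s - s ^ (-1 - a) = s ^ (-1 - a) * (Gf a b κ s - 1) := by
      rw [kern, ← Real.rpow_neg hs0.le, show -(1 + a) = -1 - a by ring]; ring
    rw [this, norm_mul, Real.norm_of_nonneg (by positivity), Real.norm_eq_abs]
    calc s ^ (-1 - a) * |Gf a b κ s - 1| ≤ s ^ (-1 - a) * (C * s ^ α) := by
          refine mul_le_mul_of_nonneg_left ((hC s ⟨hs0.le, hs.2⟩).trans ?_) (by positivity)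
          refine mul_le_mul_of_nonneg_left ?_ hC0
          calc s = s ^ (1 : ℝ) := (Real.rpow_one s).symm
            _ ≤ s ^ α := Real.rpow_le_rpow_of_exponent_ge hs0 (by linarith [hs.2]) hα1
      _ = C * s ^ (-1 - (a - α)) := by
          rw [show -1 - (a - α) = (-1 - a) + α by ring, Real.rpow_add hs0]; ring
  rw [intervalIntegral.integral_const_mul, integral_rpow_neg hαa.ne' ht] at e3
  calc ‖t ^ a * (∫ s in t..1 / 2, kern a b κ s) - a⁻¹‖
      ≤ ‖t ^ a * ∫ s in t..1 / 2, (kern a b κ s - s ^ (-1 - a))‖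
        + ‖(1 - t ^ a * (1 / 2) ^ (-a)) / a - a⁻¹‖ := by
        rw [← e2, ← e1]
        refine (norm_add_le _ _).trans_eq' ?_
        congr 1; ring
    _ ≤ C / (a - α) * t ^ α + ‖(1 - t ^ a * (1 / 2) ^ (-a)) / a - a⁻¹‖ := by
        refine add_le_add_left ?_ _
        rw [norm_mul, Real.norm_of_nonneg hta.le, Real.norm_eq_abs]
        calc _ ≤ t ^ a * (C * ((t ^ (-(a - α)) - (1 / 2) ^ (-(a - α))) / (a - α))) :=
              mul_le_mul_of_nonneg_left e3 hta.le
          _ ≤ t ^ a * (C * (t ^ (-(a - α)) / (a - α))) := by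
              have : (0 : ℝ) ≤ (1 / 2) ^ (-(a - α)) := by positivity
              gcongr
              linarith
          _ = C / (a - α) * t ^ α := by
              rw [neg_sub, Real.rpow_sub ht.1]
              field_simp

/-- By `formula`, a solution other than `Ym` has a gap to `Ym` that tends to 0 if a = 0 and to a if
a > 0. This gives continuity of U up to the boundary. -/
lemma IsRiccati.exists_tendsto_zero (ha : 0 ≤ a) (hb : -1 < b) (hκ : 0 < κ)
    (hy : IsRiccati a b κ y) : ∃ L, Tendsto y (𝓝[>] 0) (𝓝 L) := by
  have ha' : -1 < a := by linarith
  have hR := isRiccati_Ym ha' hb hκ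
  have hY : Tendsto (Ym a b κ) (𝓝[>] 0) (𝓝 (Ym a b κ 0)) :=
    (continuousAt_Ym_zero ha' hb hκ).tendsto.mono_left nhdsWithin_le_nhds
  have hev : ∀ᶠ t in 𝓝[>] (0 : ℝ), t ∈ Ioc (0 : ℝ) (1 / 2) :=
    Ioc_mem_nhdsGT (by norm_num : (0 : ℝ) < 1 / 2)
  by_cases hne : y (1 / 2) = Ym a b κ (1 / 2)
  · refine ⟨_, hY.congr' ?_⟩
    filter_upwards [hev] with t ht
    exact hR.eq_of_eq hy half_mem hne.symm ⟨ht.1, by linarith [ht.2]⟩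
  set E := (mu a b κ (1 / 2) * (Ym a b κ (1 / 2) - y (1 / 2)))⁻¹ with hE
  have hG : Tendsto (fun t => (1 - t) * Gf a b κ t) (𝓝[>] 0) (𝓝 ((1 - 0) * Gf a b κ 0)) :=
    Tendsto.mono_left (((continuous_const.sub continuous_id).tendsto (0 : ℝ)).mul
      (differentiableAt_Gf_zero ha' hb hκ).continuousAt.tendsto) nhdsWithin_le_nhds
  obtain ⟨D, hD⟩ : ∃ D, Tendsto (fun t => (t ^ a * (E + ∫ s in t..1 / 2, kern a b κ s))⁻¹)
      (𝓝[>] 0) (𝓝 D) := by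
    rcases ha.eq_or_lt with rfl | ha0
    · refine ⟨0, tendsto_inv_atTop_zero.comp ?_⟩
      simpa using tendsto_atTop_add_const_left _ E (tendsto_integral_kern le_rfl hb hκ)
    · have h1 := tendsto_rpow_mul_integral_kern ha0 hb hκ
      have h2 : Tendsto (fun t : ℝ => t ^ a * E) (𝓝[>] 0) (𝓝 (0 ^ a * E)) :=
        ((Real.continuousAt_rpow_const 0 a (Or.inr ha)).tendsto.mono_left
          nhdsWithin_le_nhds).mul_const E
      refine ⟨_, ((h2.add h1).inv₀ ?_).congr fun t => by rw [mul_add]⟩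
      rw [Real.zero_rpow ha0.ne', zero_mul, zero_add]
      exact (inv_pos.2 ha0).ne'
  refine ⟨_, (hY.sub (hG.mul hD)).congr' ?_⟩
  filter_upwards [hev] with t ht
  rw [← hy.formula ha' hb hκ hne ht]
  ring

lemma IsRiccati.exists_tendsto_one (ha : -1 < a) (hb : 0 ≤ b) (hκ : 0 < κ)
    (hy : IsRiccati a b κ y) : ∃ L, Tendsto y (𝓝[<] 1) (𝓝 L) := by
  obtain ⟨L, hL⟩ := hy.mirror.exists_tendsto_zero hb ha hκ
  refine ⟨-L, ?_⟩
  have h1 : Tendsto (fun t : ℝ => 1 - t) (𝓝[<] 1) (𝓝[>] 0) := by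
    refine tendsto_nhdsWithin_iff.2 ⟨?_, ?_⟩
    · have : Tendsto (fun t : ℝ => 1 - t) (𝓝 1) (𝓝 (1 - 1)) :=
        (continuous_const.sub continuous_id).tendsto 1
      rw [sub_self] at this
      exact this.mono_left nhdsWithin_le_nhds
    · filter_upwards [self_mem_nhdsWithin] with t ht using sub_pos.2 (mem_Iio.1 ht)
  refine (hL.comp h1).neg.congr fun t => ?_
  simp

end Limits

end HomNS

namespace HomNS

open Filter Topology MeasureTheory

/-! ### Uniform smoothness of powers in the exponent. -/

section PowerFamily

/-- Each derivative of r^c in c brings a factor log r. With u = -log r ≥ 0 the claim is u^n e^{-c₀u}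
≤ n!/c₀^n, a single term of the exponential series. -/
lemma abs_log_pow_mul_rpow_le {r c c₀ : ℝ} (hr : r ∈ Ioc (0 : ℝ) 1) (hc₀ : 0 < c₀) (hc : c₀ ≤ c)
    (n : ℕ) : |Real.log r| ^ n * r ^ c ≤ n.factorial / c₀ ^ n := by
  have hl : 0 ≤ -Real.log r := neg_nonneg.2 (Real.log_nonpos hr.1.le hr.2)
  have h1 := Real.pow_div_factorial_le_exp (c₀ * -Real.log r) (by positivity) n
  have h2 : r ^ c ≤ Real.exp (-(c₀ * -Real.log r)) := by
    rw [Real.rpow_def_of_pos hr.1]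
    exact Real.exp_le_exp.2 (by nlinarith)
  rw [abs_of_nonpos (by linarith)]
  rw [Real.exp_neg] at h2
  rw [mul_pow, div_le_iff₀ (by positivity)] at h1
  rw [le_div_iff₀ (by positivity)]
  have h3 := Real.exp_pos (c₀ * -Real.log r)
  calc (-Real.log r) ^ n * r ^ c * c₀ ^ n
      ≤ (-Real.log r) ^ n * (Real.exp (c₀ * -Real.log r))⁻¹ * c₀ ^ n := by gcongr
    _ = (c₀ ^ n * (-Real.log r) ^ n) * (Real.exp (c₀ * -Real.log r))⁻¹ := by ring
    _ ≤ (Real.exp (c₀ * -Real.log r) * n.factorial) * (Real.exp (c₀ * -Real.log r))⁻¹ := by gcongr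
    _ = n.factorial := by field_simp

lemma unifSmoothOn_rpow :
    UnifSmoothOn (Ioi (0 : ℝ)) (fun c (r : Ioc (0 : ℝ) 1) => (r : ℝ) ^ c) := by
  have hexp : ∀ r : Ioc (0 : ℝ) 1, (fun c : ℝ => (r : ℝ) ^ c) =
      fun c => Real.exp (Real.log r * c) := fun r => by
    funext c; rw [Real.rpow_def_of_pos r.2.1]
  refine ⟨fun r => by rw [hexp]; fun_prop, fun c₀ hc₀ n => ?_⟩
  refine ⟨n.factorial / (c₀ / 2) ^ n, ?_⟩
  filter_upwards [Ioi_mem_nhds (half_lt_self (mem_Ioi.1 hc₀))] with c hc r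
  rw [norm_iteratedFDeriv_eq_norm_iteratedDeriv, hexp, iteratedDeriv_exp_const_mul]
  simp only [norm_mul, norm_pow, Real.norm_eq_abs]
  rw [← Real.rpow_def_of_pos r.2.1, abs_of_pos (Real.rpow_pos_of_pos r.2.1 c)]
  exact abs_log_pow_mul_rpow_le r.2 (half_pos hc₀) (mem_Ioi.1 hc).le n

lemma UnifSmoothOn.rpow {E X : Type*} [NormedAddCommGroup E] [NormedSpace ℝ E]
    {Ω : Set E} {c : E → ℝ} {r : X → ℝ} (hΩ : IsOpen Ω)
    (hc : ContDiffOn ℝ ∞ c Ω) (hpos : ∀ p ∈ Ω, 0 < c p) (hr : ∀ x, r x ∈ Ioc (0 : ℝ) 1) :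
    UnifSmoothOn Ω (fun p x => r x ^ c p) := by
  refine (unifSmoothOn_of_param (X := X) hΩ hc).comp_index hΩ isOpen_Ioi
    (unifSmoothOn_rpow.reindex fun x => ⟨r x, hr x⟩) (fun p hp _ => hpos p hp) fun p₀ hp => ?_
  have h0 := hpos p₀ hp
  refine ⟨Icc (c p₀ / 2) (c p₀ + 1), fun v hv => (half_pos h0).trans_le hv.1, isCompact_Icc, ?_⟩
  filter_upwards [(hc.continuousOn.continuousAt (hΩ.mem_nhds hp)).eventually
    (Icc_mem_nhds (half_lt_self h0) (lt_add_one _))] with p h x using h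

end PowerFamily

/-! ### Smooth parameter families and the regular factors. -/

section Parameters

variable {E : Type} [NormedAddCommGroup E] [NormedSpace ℝ E]

/-- Smooth parameters `a, b, κ` of the Riccati equation on an open set. -/
structure SmoothParams (Ω : Set E) (a b κ : E → ℝ) : Prop where
  isOpen : IsOpen Ω
  smooth_a : ContDiffOn ℝ ∞ a Ω
  smooth_b : ContDiffOn ℝ ∞ b Ω
  smooth_κ : ContDiffOn ℝ ∞ κ Ω
  a_nonneg : ∀ p ∈ Ω, 0 ≤ a p
  b_nonneg : ∀ p ∈ Ω, 0 ≤ b p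
  κ_pos : ∀ p ∈ Ω, 0 < κ p

variable {Ω : Set E} {a b κ η : E → ℝ}

namespace SmoothParams

lemma symm (h : SmoothParams Ω a b κ) : SmoothParams Ω b a κ :=
  ⟨h.isOpen, h.smooth_b, h.smooth_a, h.smooth_κ, h.b_nonneg, h.a_nonneg, h.κ_pos⟩

lemma a_gt (h : SmoothParams Ω a b κ) {p : E} (hp : p ∈ Ω) : -1 < a p := by
  linarith [h.a_nonneg p hp]

lemma b_gt (h : SmoothParams Ω a b κ) {p : E} (hp : p ∈ Ω) : -1 < b p := h.symm.a_gt hp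

lemma mono (h : SmoothParams Ω a b κ) {Ω₀ : Set E} (ho : IsOpen Ω₀) (hs : Ω₀ ⊆ Ω) :
    SmoothParams Ω₀ a b κ :=
  ⟨ho, h.smooth_a.mono hs, h.smooth_b.mono hs, h.smooth_κ.mono hs, fun p hp => h.a_nonneg p (hs hp),
    fun p hp => h.b_nonneg p (hs hp), fun p hp => h.κ_pos p (hs hp)⟩

lemma contDiffOn_params (h : SmoothParams Ω a b κ) : ContDiffOn ℝ ∞
    (fun q : E × ℝ => ((a q.1, b q.1, κ q.1), q.2)) (Ω ×ˢ Ioo (-1) 1) :=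
  ((h.smooth_a.comp contDiffOn_fst fun _ hq => hq.1).prodMk
    ((h.smooth_b.comp contDiffOn_fst fun _ hq => hq.1).prodMk
      (h.smooth_κ.comp contDiffOn_fst fun _ hq => hq.1))).prodMk contDiffOn_snd

lemma mapsTo_params (h : SmoothParams Ω a b κ) :
    MapsTo (fun q : E × ℝ => ((a q.1, b q.1, κ q.1), q.2)) (Ω ×ˢ Ioo (-1) 1)
      (paramSet ×ˢ Ioo (-1 : ℝ) 1) :=
  fun _ hq => ⟨⟨h.a_gt hq.1, h.b_gt hq.1, h.κ_pos _ hq.1⟩, hq.2⟩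

lemma contDiffOn_Zf (h : SmoothParams Ω a b κ) :
    ContDiffOn ℝ ∞ (fun q : E × ℝ => Zf (a q.1) (b q.1) (κ q.1) q.2) (Ω ×ˢ Ioo (-1) 1) :=
  HomNS.contDiffOn_Zf.comp h.contDiffOn_params h.mapsTo_params

lemma contDiffOn_Zf' (h : SmoothParams Ω a b κ) :
    ContDiffOn ℝ ∞ (fun q : E × ℝ => Zf' (a q.1) (b q.1) (κ q.1) q.2) (Ω ×ˢ Ioo (-1) 1) := by
  have : ContDiffOn ℝ ∞ ((fun q : (ℝ × ℝ × ℝ) × ℝ => Zf' q.1.1 q.1.2.1 q.1.2.2 q.2) ∘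
      fun q : E × ℝ => ((a q.1, b q.1, κ q.1), q.2)) (Ω ×ˢ Ioo (-1) 1) :=
    HomNS.contDiffOn_Zf'.comp h.contDiffOn_params h.mapsTo_params
  exact this

end SmoothParams

/-- An open set of parameters and times on which `Zf` is smooth and positive. -/
def posDomain (Ω : Set E) (a b κ : E → ℝ) : Set (E × ℝ) :=
  {q | q ∈ Ω ×ˢ Ioo (-1 : ℝ) 1 ∧ 0 < Zf (a q.1) (b q.1) (κ q.1) q.2}

namespace SmoothParams

lemma isOpen_posDomain (h : SmoothParams Ω a b κ) : IsOpen (posDomain Ω a b κ) :=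
  h.contDiffOn_Zf.continuousOn.isOpen_inter_preimage (h.isOpen.prod isOpen_Ioo) isOpen_Ioi

lemma mem_posDomain (h : SmoothParams Ω a b κ) {p : E} (hp : p ∈ Ω) {t : ℝ} (h0 : 0 ≤ t)
    (h1 : t < 1) :
    (p, t) ∈ posDomain Ω a b κ :=
  ⟨⟨hp, by linarith, h1⟩, Zf_pos (h.a_gt hp) (h.b_gt hp) (h.κ_pos p hp) h0 h1⟩

/-- Positivity of `Zf` is automatic for t in [0, 1) and imposed for t < 0. The singular time 0 thus
becomes interior to an open set, and compactness of [0, 1/2] gives uniform bounds. -/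
lemma prod_subset_posDomain (h : SmoothParams Ω a b κ) :
    Ω ×ˢ Icc (0 : ℝ) (1 / 2) ⊆ posDomain Ω a b κ :=
  fun q hq => h.mem_posDomain hq.1 hq.2.1 (by linarith [hq.2.2])

lemma contDiffOn_Gf_inv (h : SmoothParams Ω a b κ) : ContDiffOn ℝ ∞
    (fun q : E × ℝ => (1 - q.2) ^ (1 + b q.1) * Zf (a q.1) (b q.1) (κ q.1) q.2 ^ 2)
    (posDomain Ω a b κ) := by
  refine ContDiffOn.mul ?_ ((h.contDiffOn_Zf.mono fun q hq => hq.1).pow 2)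
  exact ContDiffOn.rpow (contDiffOn_const.sub contDiffOn_snd)
    (contDiffOn_const.add (h.smooth_b.comp contDiffOn_fst fun _ hq => hq.1.1))
    fun _ hq => (sub_pos.2 hq.1.2.2).ne'

lemma contDiffOn_Gf (h : SmoothParams Ω a b κ) : ContDiffOn ℝ ∞
    (fun q : E × ℝ => Gf (a q.1) (b q.1) (κ q.1) q.2)
    (posDomain Ω a b κ) :=
  h.contDiffOn_Gf_inv.inv fun _ hq =>
    (mul_pos (Real.rpow_pos_of_pos (sub_pos.2 hq.1.2.2) _) (pow_pos hq.2 2)).ne'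

lemma contDiffOn_Ym_div (h : SmoothParams Ω a b κ) : ContDiffOn ℝ ∞ (fun q : E × ℝ =>
    (1 - q.2) * Zf' (a q.1) (b q.1) (κ q.1) q.2 / Zf (a q.1) (b q.1) (κ q.1) q.2)
    (posDomain Ω a b κ) :=
  ((contDiffOn_const.sub contDiffOn_snd).mul (h.contDiffOn_Zf'.mono fun _ hq => hq.1)).div
    (h.contDiffOn_Zf.mono fun _ hq => hq.1) fun _ hq => hq.2.ne'

lemma contDiffOn_Ym (h : SmoothParams Ω a b κ) : ContDiffOn ℝ ∞
    (fun q : E × ℝ => Ym (a q.1) (b q.1) (κ q.1) q.2)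
    (posDomain Ω a b κ) :=
  (contDiffOn_snd.mul h.contDiffOn_Ym_div).congr fun _ _ => by rw [Ym]; ring

lemma unifSmoothOn_of_posDomain [ProperSpace E] (h : SmoothParams Ω a b κ) {X : Type*}
    {Φ : E × ℝ → ℝ}
    (hΦ : ContDiffOn ℝ ∞ Φ (posDomain Ω a b κ)) {s : X → ℝ} (hs : ∀ x, s x ∈ Icc (0 : ℝ) (1 / 2)) :
    UnifSmoothOn Ω (fun p x => Φ (p, s x)) :=
  unifSmoothOn_of_joint h.isOpen h.isOpen_posDomain hΦ isCompact_Icc hs h.prod_subset_posDomain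

lemma contDiffOn_section (h : SmoothParams Ω a b κ) {Φ : E × ℝ → ℝ}
    (hΦ : ContDiffOn ℝ ∞ Φ (posDomain Ω a b κ)) {t : ℝ}
    (h0 : 0 ≤ t) (h1 : t < 1) : ContDiffOn ℝ ∞ (fun p => Φ (p, t)) Ω :=
  hΦ.comp (contDiffOn_id.prodMk contDiffOn_const) fun _ hp => h.mem_posDomain hp h0 h1

lemma contDiffOn_Ym_half (h : SmoothParams Ω a b κ) :
    ContDiffOn ℝ ∞ (fun p => Ym (a p) (b p) (κ p) (1 / 2)) Ω :=
  h.contDiffOn_section h.contDiffOn_Ym half_mem.1.le half_mem.2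

/-- The constant of integration in `IsRiccati.formula` depends smoothly on the parameters. -/
lemma contDiffOn_inv_mu_half (h : SmoothParams Ω a b κ) (hη : ContDiffOn ℝ ∞ η Ω)
    (hlt : ∀ p ∈ Ω, η p < Ym (a p) (b p) (κ p) (1 / 2)) : ContDiffOn ℝ ∞
    (fun p => (mu (a p) (b p) (κ p) (1 / 2) * (Ym (a p) (b p) (κ p) (1 / 2) - η p))⁻¹) Ω := by
  refine ContDiffOn.inv (ContDiffOn.mul ?_ (h.contDiffOn_Ym_half.sub hη)) fun p hp =>
    (mul_pos (mu_pos (h.a_gt hp) (h.b_gt hp) (h.κ_pos p hp) half_mem) (sub_pos.2 (hlt p hp))).ne'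
  have hZ : ContDiffOn ℝ ∞ (fun p => Zf (a p) (b p) (κ p) (1 / 2)) Ω :=
    h.contDiffOn_section (h.contDiffOn_Zf.mono fun q hq => hq.1) half_mem.1.le half_mem.2
  exact ((contDiffOn_const.rpow h.smooth_a fun _ _ => by norm_num).mul
    (contDiffOn_const.rpow h.smooth_b fun _ _ => by norm_num)).mul (hZ.pow 2)

lemma exists_Gf_lower_unif [ProperSpace E] (h : SmoothParams Ω a b κ) {p₀ : E} (hp : p₀ ∈ Ω) :
    ∃ c > 0, ∀ᶠ p in 𝓝 p₀,
    ∀ s ∈ Icc (0 : ℝ) (1 / 2), c ≤ Gf (a p) (b p) (κ p) s := by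
  obtain ⟨C, hC⟩ := (h.unifSmoothOn_of_posDomain (X := Icc (0 : ℝ) (1 / 2)) h.contDiffOn_Gf_inv
    fun x => x.2).eventually_bound hp
  refine ⟨(max C 1)⁻¹, by positivity, ?_⟩
  filter_upwards [hC, h.isOpen.mem_nhds hp] with p h1 h2 s hs
  refine inv_anti₀ (mul_pos (Real.rpow_pos_of_pos (by linarith [hs.2]) _) (pow_pos
    (Zf_pos (h.a_gt h2) (h.b_gt h2) (h.κ_pos p h2) hs.1 (by linarith [hs.2])) 2)) ?_
  exact (le_abs_self _).trans ((h1 ⟨s, hs⟩).trans (le_max_left _ _))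

end SmoothParams

end Parameters

end HomNS

namespace HomNS

open Filter Topology MeasureTheory

/-! ### Uniform smoothness at the singular point for a positive exponent. -/

section HalfInterval

variable {E : Type} [NormedAddCommGroup E] [NormedSpace ℝ E]
  {Ω : Set E} {a b κ η : E → ℝ} {y : E → ℝ → ℝ}

/-- The interval on which the behaviour of solutions at the singular point `0` is studied. -/
abbrev HalfInterval : Type := Ioc (0 : ℝ) (1 / 2)

lemma HalfInterval.mem_Icc (t : HalfInterval) : (t : ℝ) ∈ Icc (0 : ℝ) (1 / 2) :=
  ⟨t.2.1.le, t.2.2⟩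

namespace SmoothParams

lemma isOpen_posDomain_inter (h : SmoothParams Ω a b κ) :
    IsOpen (posDomain Ω a b κ ∩ {q | 0 < q.2}) :=
  h.isOpen_posDomain.inter (isOpen_lt continuous_const continuous_snd)

lemma prod_subset_posDomain_inter (h : SmoothParams Ω a b κ) (t : HalfInterval) :
    Ω ×ˢ Icc (t : ℝ) (1 / 2) ⊆ posDomain Ω a b κ ∩ {q | 0 < q.2} :=
  fun _ hq => ⟨h.prod_subset_posDomain ⟨hq.1, t.2.1.le.trans hq.2.1, hq.2.2⟩,
    t.2.1.trans_le hq.2.1⟩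

variable [ProperSpace E]

/-- The integrand is split as t^α s^{-1-α} · (t/s)^{a-α} · Gf(s). The first factor is a
parameter-free weight of mass at most 1/α; the second is uniformly smooth because t/s ≤ 1 and a - α
> 0. -/
lemma unifSmoothOn_rpow_mul_integral_kern (h : SmoothParams Ω a b κ) (ha : ∀ p ∈ Ω, 0 < a p) :
    UnifSmoothOn Ω fun p (t : HalfInterval) =>
      (t : ℝ) ^ a p * ∫ s in (t : ℝ)..1 / 2, kern (a p) (b p) (κ p) s := by
  refine UnifSmoothOn.of_local fun p₀ hp₀ => ?_
  -- A fixed α below a is needed, which is possible only near a given p₀; hence the localisation.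
  set α := a p₀ / 2 with hα
  have hα0 : 0 < α := half_pos (ha p₀ hp₀)
  have ho : IsOpen (Ω ∩ a ⁻¹' Ioi α) := h.smooth_a.continuousOn.isOpen_inter_preimage h.isOpen
    isOpen_Ioi
  refine ⟨_, ho, ⟨hp₀, half_lt_self (ha p₀ hp₀)⟩, ?_⟩
  have h0 := h.mono ho inter_subset_left
  have hpos : ∀ (i : {i : HalfInterval × ℝ // i.2 ∈ Icc (i.1 : ℝ) (1 / 2)}), 0 < i.1.2 :=
    fun i => i.1.1.2.1.trans_le i.2.1
  have hF : UnifSmoothOn (Ω ∩ a ⁻¹' Ioi α)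
      (fun p (i : {i : HalfInterval × ℝ // i.2 ∈ Icc (i.1 : ℝ) (1 / 2)}) =>
        ((i.1.1 : ℝ) / i.1.2) ^ (a p - α) * Gf (a p) (b p) (κ p) i.1.2) :=
    (UnifSmoothOn.rpow ho (h0.smooth_a.sub contDiffOn_const) (fun p hp => sub_pos.2 hp.2)
      fun i => ⟨div_pos i.1.1.2.1 (hpos i), (div_le_one (hpos i)).2 i.2.1⟩).mul ho
      (h0.unifSmoothOn_of_posDomain h0.contDiffOn_Gf fun i => ⟨(hpos i).le, i.2.2⟩)
  have key := UnifSmoothOn.integral (X := HalfInterval) (α := fun t => t) (β := fun _ => 1 / 2)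
    (F := fun p t s => ((t : ℝ) / s) ^ (a p - α) * Gf (a p) (b p) (κ p) s)
    (wt := fun t s => (t : ℝ) ^ α * s ^ (-1 - α)) (C := α⁻¹) ho
    (fun _ => h0.isOpen_posDomain_inter) (fun t => t.2.2)
    (fun t => h0.prod_subset_posDomain_inter t) hF ?_ ?_ ?_ ?_
  · refine key.congr ho fun p hp t => ?_
    rw [← intervalIntegral.integral_const_mul]
    refine intervalIntegral.integral_congr fun s hs => ?_
    rw [uIcc_of_le t.2.2] at hs
    have hs0 : 0 < s := t.2.1.trans_le hs.1
    have e1 : ((t : ℝ) / s) ^ (a p - α) = (t : ℝ) ^ (a p - α) * (s ^ (a p - α))⁻¹ := by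
      rw [Real.div_rpow t.2.1.le hs0.le, div_eq_mul_inv]
    simp only [kern]
    rw [e1, show a p = α + (a p - α) by ring, Real.rpow_add t.2.1,
      show 1 + (α + (a p - α)) = -(-1 - α) + (a p - α) by ring, Real.rpow_add hs0,
      Real.rpow_neg hs0.le, mul_inv, inv_inv]
    simp only [add_sub_cancel]
    ring
  · intro t
    have hs0 : ∀ q ∈ posDomain (Ω ∩ a ⁻¹' Ioi α) a b κ ∩ {q | 0 < q.2}, q.2 ≠ 0 :=
      fun q hq => (show 0 < q.2 from hq.2).ne'
    refine (contDiffOn_const.mul (contDiffOn_snd.rpow_const_of_ne hs0)).mul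
      (ContDiffOn.mul ?_ (h0.contDiffOn_Gf.mono inter_subset_left))
    exact (contDiffOn_const.div contDiffOn_snd hs0).rpow
      ((h0.smooth_a.comp contDiffOn_fst fun q hq => hq.1.1.1).sub contDiffOn_const)
      fun q hq => (div_pos t.2.1 hq.2).ne'
  · intro t s hs
    have hs0 : 0 < s := t.2.1.trans_le hs.1
    have := t.2.1
    positivity
  · exact fun t => (intervalIntegrable_rpow_of_mem t.2).const_mul _
  · intro t
    rw [intervalIntegral.integral_const_mul, integral_rpow_neg hα0.ne' t.2]
    have h1 : (t : ℝ) ^ α * (t : ℝ) ^ (-α) = 1 := by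
      rw [← Real.rpow_add t.2.1]; simp
    have h2 : 0 ≤ (t : ℝ) ^ α * (1 / 2) ^ (-α) :=
      mul_nonneg (Real.rpow_nonneg t.2.1.le _) (by positivity)
    rw [← mul_div_assoc, mul_sub, h1, inv_eq_one_div]
    gcongr
    linarith

/-- Uniform smoothness up to the singular point `0`, for a positive exponent `a`. -/
lemma unifSmoothOn_of_pos (h : SmoothParams Ω a b κ) (ha : ∀ p ∈ Ω, 0 < a p)
    (hη : ContDiffOn ℝ ∞ η Ω) (hlt : ∀ p ∈ Ω, η p < Ym (a p) (b p) (κ p) (1 / 2))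
    (hy : ∀ p ∈ Ω, IsRiccati (a p) (b p) (κ p) (y p)) (hyη : ∀ p ∈ Ω, y p (1 / 2) = η p) :
    UnifSmoothOn Ω fun p (t : HalfInterval) => y p t := by
  have ho := h.isOpen
  set e : E → ℝ := fun p =>
    (mu (a p) (b p) (κ p) (1 / 2) * (Ym (a p) (b p) (κ p) (1 / 2) - η p))⁻¹ with he
  have hes : ContDiffOn ℝ ∞ e Ω := h.contDiffOn_inv_mu_half hη hlt
  have hepos : ∀ p ∈ Ω, 0 < e p := fun p hp => inv_pos.2 (mul_pos
    (mu_pos (h.a_gt hp) (h.b_gt hp) (h.κ_pos p hp) half_mem) (sub_pos.2 (hlt p hp)))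
  have hD : UnifSmoothOn Ω fun p (t : HalfInterval) =>
      (t : ℝ) ^ a p * e p + (t : ℝ) ^ a p * ∫ s in (t : ℝ)..1 / 2, kern (a p) (b p) (κ p) s :=
    ((UnifSmoothOn.rpow ho h.smooth_a ha fun t => ⟨t.2.1, by linarith [t.2.2]⟩).mul ho
      (unifSmoothOn_of_param ho hes)).add ho (h.unifSmoothOn_rpow_mul_integral_kern ha)
  have hJ : ∀ p ∈ Ω, ∀ c ≥ 0, (∀ s ∈ Icc (0 : ℝ) (1 / 2), c ≤ Gf (a p) (b p) (κ p) s) →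
      ∀ t : HalfInterval, c / a p * (1 - (t : ℝ) ^ a p * (1 / 2) ^ (-a p)) ≤
        (t : ℝ) ^ a p * ∫ s in (t : ℝ)..1 / 2, kern (a p) (b p) (κ p) s := by
    intro p hp c hc hG t
    have hta : 0 < (t : ℝ) ^ a p := Real.rpow_pos_of_pos t.2.1 _
    have h1 : ∫ s in (t : ℝ)..1 / 2, c * s ^ (-1 - a p) ≤
        ∫ s in (t : ℝ)..1 / 2, kern (a p) (b p) (κ p) s := by
      refine intervalIntegral.integral_mono_on t.2.2
        ((intervalIntegrable_rpow_of_mem t.2).const_mul c)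
        (intervalIntegrable_kern (h.a_gt hp) (h.b_gt hp) (h.κ_pos p hp) t.2) fun s hs => ?_
      have hs0 : 0 < s := t.2.1.trans_le hs.1
      rw [kern, ← Real.rpow_neg hs0.le, show -(1 + a p) = -1 - a p by ring, mul_comm c]
      exact mul_le_mul_of_nonneg_left (hG s ⟨hs0.le, hs.2⟩) (by positivity)
    rw [intervalIntegral.integral_const_mul, integral_rpow_neg (ha p hp).ne' t.2] at h1
    refine (mul_le_mul_of_nonneg_left h1 hta.le).trans_eq' ?_
    have := (ha p hp).ne'
    rw [Real.rpow_neg t.2.1.le]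
    field_simp
  -- The denominator must stay away from zero uniformly in t: the integral term does this near t =
  -- 0, the term with e near t = 1/2.
  have hDc : ∀ p₀ ∈ Ω, ∃ c > 0, ∀ᶠ p in 𝓝 p₀, ∀ t : HalfInterval, c ≤
      (t : ℝ) ^ a p * e p + (t : ℝ) ^ a p * ∫ s in (t : ℝ)..1 / 2, kern (a p) (b p) (κ p) s := by
    intro p₀ hp₀
    obtain ⟨c, hc, hce⟩ := h.exists_Gf_lower_unif hp₀
    have hca := h.smooth_a.continuousOn.continuousAt (ho.mem_nhds hp₀)
    have hcE : ContinuousAt (fun p => (1 / 2 : ℝ) ^ a p * e p) p₀ :=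
      (continuousAt_const.rpow hca (Or.inl (by norm_num))).mul
          (hes.continuousOn.continuousAt (ho.mem_nhds hp₀))
    have hE0 : 0 < (1 / 2 : ℝ) ^ a p₀ * e p₀ := mul_pos (by positivity) (hepos p₀ hp₀)
    refine ⟨min (c / (a p₀ + 1)) ((1 / 2 : ℝ) ^ a p₀ * e p₀ / 2),
      lt_min (div_pos hc (by linarith [ha p₀ hp₀])) (half_pos hE0), ?_⟩
    filter_upwards [hce, ho.mem_nhds hp₀, hca.eventually_lt_const (lt_add_one _),
      hcE.eventually_const_lt (half_lt_self hE0)] with p h1 h2 h3 h4 t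
    have h5 := hJ p h2 c hc.le h1 t
    set m := min (c / (a p₀ + 1)) ((1 / 2 : ℝ) ^ a p₀ * e p₀ / 2) with hm
    have hm1 : m ≤ c / a p := (min_le_left _ _).trans
      (div_le_div_of_nonneg_left hc.le (ha p h2) h3.le)
    have hm2 : m ≤ (1 / 2 : ℝ) ^ a p * e p := (min_le_right _ _).trans h4.le
    -- With x = (2t)^a in [0, 1], the denominator is at least the convex combination x · (1/2)^a e +
    -- (1 - x) · c/a, both entries of which are at least m.
    set x := (t : ℝ) ^ a p * (1 / 2) ^ (-a p) with hx
    have hx0 : 0 ≤ x := mul_nonneg (Real.rpow_nonneg t.2.1.le _) (by positivity)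
    have hx1 : x ≤ 1 := by
      rw [hx, Real.rpow_neg (by norm_num), ← div_eq_mul_inv, div_le_one (by positivity)]
      exact Real.rpow_le_rpow t.2.1.le t.2.2 (ha p h2).le
    have hx2 : (t : ℝ) ^ a p * e p = x * ((1 / 2 : ℝ) ^ a p * e p) := by
      have : ((1 : ℝ) / 2) ^ (-a p) * (1 / 2) ^ a p = 1 := by
        rw [← Real.rpow_add (by norm_num)]; simp
      rw [hx]
      linear_combination -((t : ℝ) ^ a p * e p) * this
    rw [hx2]
    nlinarith [mul_le_mul_of_nonneg_left hm2 hx0,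
      mul_le_mul_of_nonneg_right hm1 (sub_nonneg.2 hx1)]
  have hDpos : ∀ p ∈ Ω, ∀ t : HalfInterval, 0 <
      (t : ℝ) ^ a p * e p + (t : ℝ) ^ a p * ∫ s in (t : ℝ)..1 / 2, kern (a p) (b p) (κ p) s :=
    fun p hp t => by
      obtain ⟨c, hc, hce⟩ := hDc p hp
      exact hc.trans_le (hce.self_of_nhds t)
  have hY := h.unifSmoothOn_of_posDomain (X := HalfInterval) h.contDiffOn_Ym fun t => t.mem_Icc
  have hG : UnifSmoothOn Ω (fun p (t : HalfInterval) => (1 - t : ℝ) * Gf (a p) (b p) (κ p) t) :=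
    h.unifSmoothOn_of_posDomain (Φ := fun q => (1 - q.2) * Gf (a q.1) (b q.1) (κ q.1) q.2)
      ((contDiffOn_const.sub contDiffOn_snd).mul h.contDiffOn_Gf) fun t => t.mem_Icc
  refine (hY.sub ho (hG.mul ho (hD.inv ho hDpos hDc))).congr ho fun p hp t => ?_
  have hf := (hy p hp).formula (h.a_gt hp) (h.b_gt hp) (h.κ_pos p hp)
    (by rw [hyη p hp]; exact (hlt p hp).ne) t.2
  rw [hyη p hp, mul_add] at hf
  linarith

end SmoothParams

end HalfInterval

end HomNS

namespace HomNS

open Filter Topology MeasureTheory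

/-! ### The logarithmic behaviour at the singular point for exponent zero. -/

section LogarithmicCase

variable {E : Type} [NormedAddCommGroup E] [NormedSpace ℝ E]
  {Ω : Set E} {a b κ η : E → ℝ} {y : E → ℝ → ℝ}

/-- The logarithmic weight `1 + log (1 / (2t))`. -/
noncomputable def logWt (t : ℝ) : ℝ := 1 + Real.log (1 / 2 / t)

lemma one_le_logWt (t : HalfInterval) : 1 ≤ logWt t := by
  have : 0 ≤ Real.log (1 / 2 / (t : ℝ)) :=
    Real.log_nonneg ((one_le_div t.2.1).2 t.2.2)
  rw [logWt]; linarith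

/-- From w²/2 ≤ e^w = e/(2t). It allows any factor t to be absorbed as w⁻² times a bounded function.
-/
lemma mul_logWt_sq_le (t : HalfInterval) : (t : ℝ) * logWt t ^ 2 ≤ Real.exp 1 := by
  have ht := t.2.1
  have h0 := one_le_logWt t
  have h1 := Real.pow_div_factorial_le_exp (logWt t) (by linarith) 2
  have h2 : Real.exp (logWt t) = Real.exp 1 * (1 / 2 / t) := by
    rw [logWt, Real.exp_add, Real.exp_log (by positivity)]
  rw [h2] at h1
  have h3 : (t : ℝ) * (logWt t ^ 2 / 2) ≤ t * (Real.exp 1 * (1 / 2 / t)) := by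
    refine mul_le_mul_of_nonneg_left ?_ ht.le
    simpa [Nat.factorial] using h1
  have h4 : (t : ℝ) * (Real.exp 1 * (1 / 2 / t)) = Real.exp 1 / 2 := by field_simp
  linarith

namespace SmoothParams

lemma contDiffOn_sub_one_div (h : SmoothParams Ω a b κ) : ContDiffOn ℝ ∞
    (fun q : E × ℝ => (Gf (a q.1) (b q.1) (κ q.1) q.2 - 1) / q.2)
    (posDomain Ω a b κ ∩ {q | 0 < q.2}) :=
  ((h.contDiffOn_Gf.mono inter_subset_left).sub contDiffOn_const).div contDiffOn_snd
    fun q hq => (show 0 < q.2 from hq.2).ne'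

variable [ProperSpace E]

/-- As `Gf` equals 1 at 0, the quotient is the mean over [0, t] of its time derivative, an integral
against a weight of mass 1. -/
lemma unifSmoothOn_sub_one_div (h : SmoothParams Ω a b κ) :
    UnifSmoothOn Ω fun p (t : HalfInterval) => (Gf (a p) (b p) (κ p) t - 1) / t := by
  set Φ : E × ℝ → ℝ := fun q => Gf (a q.1) (b q.1) (κ q.1) q.2 with hΦ
  have hD : ContDiffOn ℝ ∞ (fun q => fderiv ℝ Φ q (0, 1)) (posDomain Ω a b κ) :=
    ((contDiffOn_infty_iff_fderiv_of_isOpen h.isOpen_posDomain).1 h.contDiffOn_Gf).2.clm_apply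
      contDiffOn_const
  have hder : ∀ p ∈ Ω, ∀ s ∈ Icc (0 : ℝ) (1 / 2),
      HasDerivAt (fun s => Gf (a p) (b p) (κ p) s) (fderiv ℝ Φ (p, s) (0, 1)) s := by
    intro p hp s hs
    have hm : (p, s) ∈ posDomain Ω a b κ := h.prod_subset_posDomain ⟨hp, hs⟩
    have h1 := ((h.contDiffOn_Gf.contDiffAt (h.isOpen_posDomain.mem_nhds hm)).differentiableAt
      (by simp)).hasFDerivAt
    exact h1.comp_hasDerivAt s ((hasDerivAt_const s p).prodMk (hasDerivAt_id s))
  have hsub : ∀ t : HalfInterval, Icc (0 : ℝ) t ⊆ Icc 0 (1 / 2) := fun t =>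
    Icc_subset_Icc_right t.2.2
  have key := UnifSmoothOn.integral (X := HalfInterval) (α := fun _ => 0) (β := fun t => t)
    (F := fun p t s => fderiv ℝ Φ (p, s) (0, 1)) (wt := fun t _ => (t : ℝ)⁻¹) (C := 1) h.isOpen
    (fun _ => h.isOpen_posDomain) (fun t => t.2.1.le)
    (fun t => (prod_mono le_rfl (hsub t)).trans h.prod_subset_posDomain)
    (h.unifSmoothOn_of_posDomain hD fun i => hsub i.1.1 i.2)
    (fun t => contDiffOn_const.mul hD) (fun t _ _ => inv_nonneg.2 t.2.1.le) (fun t => by simp)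
    (fun t => by simp [t.2.1.ne'])
  refine key.congr h.isOpen fun p hp t => ?_
  rw [intervalIntegral.integral_const_mul, intervalIntegral.integral_eq_sub_of_hasDerivAt
    (f := fun s => Gf (a p) (b p) (κ p) s), Gf_zero]
  · ring
  · intro s hs
    rw [uIcc_of_le t.2.1.le] at hs
    exact hder p hp s (hsub t hs)
  · refine ContinuousOn.intervalIntegrable ?_
    rw [uIcc_of_le t.2.1.le]
    exact continuousOn_section hD.continuousOn
      ((prod_mono le_rfl (hsub t)).trans h.prod_subset_posDomain) hp

lemma unifSmoothOn_integral_sub_one_div (h : SmoothParams Ω a b κ) :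
    UnifSmoothOn Ω fun p (t : HalfInterval) =>
      ∫ s in (t : ℝ)..1 / 2, (Gf (a p) (b p) (κ p) s - 1) / s := by
  have key := UnifSmoothOn.integral (X := HalfInterval) (α := fun t => t) (β := fun _ => 1 / 2)
    (F := fun p t s => (Gf (a p) (b p) (κ p) s - 1) / s) (wt := fun _ _ => 1) (C := 1 / 2) h.isOpen
    (fun _ => h.isOpen_posDomain_inter) (fun t => t.2.2) (fun t => h.prod_subset_posDomain_inter t)
    (h.unifSmoothOn_sub_one_div.reindex fun
      i : {i : HalfInterval × ℝ // i.2 ∈ Icc (i.1 : ℝ) (1 / 2)} =>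
          ⟨i.1.2, i.1.1.2.1.trans_le i.2.1, i.2.2⟩)
    (fun t => contDiffOn_const.mul h.contDiffOn_sub_one_div) (fun _ _ _ => zero_le_one)
    (fun t => by simp) (fun t => by simpa using t.2.1.le)
  simpa using key

lemma kern_zero (b κ s : ℝ) : kern 0 b κ s = (Gf 0 b κ s - 1) / s + s⁻¹ := by
  rw [kern, add_zero, Real.rpow_one]; ring

/-- Behaviour near the singular point `0` in the logarithmic case `a = 0`: up to a fixed function,
the solution is `logWt⁻²` times a uniformly smooth family. -/
lemma exists_unifSmoothOn_of_zero (h : SmoothParams Ω a b κ) (ha : ∀ p ∈ Ω, a p = 0)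
    (hη : ContDiffOn ℝ ∞ η Ω) (hlt : ∀ p ∈ Ω, η p < Ym (a p) (b p) (κ p) (1 / 2))
    (hy : ∀ p ∈ Ω, IsRiccati (a p) (b p) (κ p) (y p)) (hyη : ∀ p ∈ Ω, y p (1 / 2) = η p) :
    ∃ F : E → HalfInterval → ℝ, UnifSmoothOn Ω F ∧
      ∀ p ∈ Ω, ∀ t : HalfInterval, y p t = -(logWt t)⁻¹ + (logWt t ^ 2)⁻¹ * F p t := by
  have ho := h.isOpen
  set e : E → ℝ := fun p =>
    (mu (a p) (b p) (κ p) (1 / 2) * (Ym (a p) (b p) (κ p) (1 / 2) - η p))⁻¹ with he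
  have hes : ContDiffOn ℝ ∞ e Ω := h.contDiffOn_inv_mu_half hη hlt
  have hepos : ∀ p ∈ Ω, 0 < e p := fun p hp => inv_pos.2 (mul_pos
    (mu_pos (h.a_gt hp) (h.b_gt hp) (h.κ_pos p hp) half_mem) (sub_pos.2 (hlt p hp)))
  set H : E → HalfInterval → ℝ := fun p t => (Gf (a p) (b p) (κ p) t - 1) / t with hH
  -- q is chosen so that the denominator e + ∫kern equals w + q = w(1 + q/w); the -1 compensates the
  -- 1 in `logWt`.
  set q : E → HalfInterval → ℝ := fun p t =>
    (e p - 1) + ∫ s in (t : ℝ)..1 / 2, (Gf (a p) (b p) (κ p) s - 1) / s with hq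
  have hHs : UnifSmoothOn Ω H := h.unifSmoothOn_sub_one_div
  have hqs : UnifSmoothOn Ω q :=
    (unifSmoothOn_of_param ho (hes.sub contDiffOn_const)).add ho h.unifSmoothOn_integral_sub_one_div
  have hG : UnifSmoothOn Ω (fun p (t : HalfInterval) => Gf (a p) (b p) (κ p) t) :=
    h.unifSmoothOn_of_posDomain h.contDiffOn_Gf fun t => t.mem_Icc
  have hK := h.unifSmoothOn_of_posDomain (X := HalfInterval) h.contDiffOn_Ym_div fun t => t.mem_Icc
  have hwt0 : ∀ t : HalfInterval, 0 < logWt t := fun t => by linarith [one_le_logWt t]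
  have hi1 : UnifSmoothOn Ω (fun (_ : E) (t : HalfInterval) => (logWt t)⁻¹) :=
    unifSmoothOn_of_index (C := 1) fun t => by
      rw [Real.norm_of_nonneg (inv_pos.2 (hwt0 t)).le]
      exact inv_le_one_of_one_le₀ (one_le_logWt t)
  have hi3 : UnifSmoothOn Ω (fun (_ : E) (t : HalfInterval) => (t : ℝ) * logWt t ^ 2) :=
    unifSmoothOn_of_index (C := Real.exp 1) fun t => by
      rw [Real.norm_of_nonneg (mul_nonneg t.2.1.le (sq_nonneg _))]
      exact mul_logWt_sq_le t
  have hi2 : UnifSmoothOn Ω (fun (_ : E) (t : HalfInterval) => (t : ℝ) * logWt t) :=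
    unifSmoothOn_of_index (C := Real.exp 1) fun t => by
      rw [Real.norm_of_nonneg (mul_nonneg t.2.1.le (hwt0 t).le)]
      refine (mul_le_mul_of_nonneg_left ?_ t.2.1.le).trans (mul_logWt_sq_le t)
      exact le_self_pow₀ (one_le_logWt t) two_ne_zero
  have hint : ∀ p ∈ Ω, ∀ t : HalfInterval, ∫ s in (t : ℝ)..1 / 2, kern (a p) (b p) (κ p) s =
      (∫ s in (t : ℝ)..1 / 2, (Gf (a p) (b p) (κ p) s - 1) / s) + Real.log (1 / 2 / t) := by
    intro p hp t
    rw [← integral_inv_of_pos t.2.1 (by norm_num), ← intervalIntegral.integral_add]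
    · exact intervalIntegral.integral_congr fun s _ => by simp only [ha p hp, kern_zero]
    · refine ContinuousOn.intervalIntegrable ?_
      rw [uIcc_of_le t.2.2]
      exact continuousOn_section h.contDiffOn_sub_one_div.continuousOn
        (h.prod_subset_posDomain_inter t) hp
    · refine intervalIntegral.intervalIntegrable_inv (fun s hs => ?_) continuousOn_id
      rw [uIcc_of_le t.2.2] at hs
      exact (t.2.1.trans_le hs.1).ne'
  have hden : ∀ p (t : HalfInterval), 1 + (logWt t)⁻¹ * q p t = (logWt t)⁻¹ * (e p +
      ((∫ s in (t : ℝ)..1 / 2, (Gf (a p) (b p) (κ p) s - 1) / s) + Real.log (1 / 2 / t))) := by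
    intro p t
    have h1 := mul_inv_cancel₀ (hwt0 t).ne'
    have h2 : Real.log (1 / 2 / (t : ℝ)) = logWt t - 1 := by rw [logWt]; ring
    rw [h2, hq]
    linear_combination -h1
  -- Since e ≥ e(p₀)/2 near p₀ and ∫kern ≥ c log(1/(2t)), the sum is at least min(e(p₀)/2, c) times
  -- w.
  have hlow : ∀ p₀ ∈ Ω, ∃ c > 0, ∀ᶠ p in 𝓝 p₀, ∀ t : HalfInterval,
      c ≤ 1 + (logWt t)⁻¹ * q p t := by
    intro p₀ hp₀
    obtain ⟨c, hc, hce⟩ := h.exists_Gf_lower_unif hp₀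
    refine ⟨min (e p₀ / 2) c, lt_min (half_pos (hepos p₀ hp₀)) hc, ?_⟩
    filter_upwards [hce, ho.mem_nhds hp₀, (hes.continuousOn.continuousAt
      (ho.mem_nhds hp₀)).eventually_const_lt (half_lt_self (hepos p₀ hp₀))] with p h1 h2 h3 t
    rw [hden, ← hint p h2 t, ← div_eq_inv_mul, le_div_iff₀ (hwt0 t)]
    have h4 : c * Real.log (1 / 2 / t) ≤ ∫ s in (t : ℝ)..1 / 2, kern (a p) (b p) (κ p) s := by
      rw [← integral_inv_of_pos t.2.1 (by norm_num), ← intervalIntegral.integral_const_mul]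
      refine intervalIntegral.integral_mono_on t.2.2 ?_
        (intervalIntegrable_kern (h.a_gt h2) (h.b_gt h2) (h.κ_pos p h2) t.2) fun s hs => ?_
      · refine (intervalIntegral.intervalIntegrable_inv (fun s hs => ?_) continuousOn_id).const_mul
          _
        rw [uIcc_of_le t.2.2] at hs
        exact (t.2.1.trans_le hs.1).ne'
      · have hs0 : 0 < s := t.2.1.trans_le hs.1
        rw [kern, ha p h2, add_zero, Real.rpow_one, mul_comm c]
        have := h1 s ⟨hs0.le, hs.2⟩
        rw [ha p h2] at this
        exact mul_le_mul_of_nonneg_left this (by positivity)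
    have h5 : 0 ≤ Real.log (1 / 2 / (t : ℝ)) := by
      have := one_le_logWt t
      rw [logWt] at this; linarith
    rw [logWt]
    nlinarith [min_le_left (e p₀ / 2) c, mul_le_mul_of_nonneg_right (min_le_right (e p₀ / 2) c) h5]
  have hpos : ∀ p ∈ Ω, ∀ t : HalfInterval, 0 < 1 + (logWt t)⁻¹ * q p t := fun p hp t => by
    obtain ⟨c, hc, hce⟩ := hlow p hp
    exact hc.trans_le (hce.self_of_nhds t)
  have h1s : UnifSmoothOn Ω (fun p (t : HalfInterval) => 1 + (logWt t)⁻¹ * q p t) :=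
    (unifSmoothOn_of_index (C := 1) fun _ => by simp).add ho (hi1.mul ho hqs)
  -- With K = Ym/t and (1-t)Gf = 1 + t(H - Gf), the expansion 1/(w+q) = 1/w - q/(w²(1+q/w)) gives F
  -- = t w² K - (t w (H - Gf) - q)/(1 + q/w).
  refine ⟨_, (hi3.mul ho hK).sub ho (((hi2.mul ho (hHs.sub ho hG)).sub ho hqs).mul ho
    (h1s.inv ho hpos hlow)), fun p hp t => ?_⟩
  have hf := (hy p hp).formula (h.a_gt hp) (h.b_gt hp) (h.κ_pos p hp)
    (by rw [hyη p hp]; exact (hlt p hp).ne) t.2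
  rw [hyη p hp, hint p hp t] at hf
  have hw := (hwt0 t).ne'
  have ht0 := t.2.1.ne'
  have hp0 := (hpos p hp t).ne'
  have e1 : e p + ((∫ s in (t : ℝ)..1 / 2, (Gf (a p) (b p) (κ p) s - 1) / s) +
      Real.log (1 / 2 / t)) = logWt t * (1 + (logWt t)⁻¹ * q p t) := by
    rw [hden p t]; field_simp
  change _ = _ * ((t : ℝ) ^ a p * (e p + _))⁻¹ at hf
  rw [e1, show (t : ℝ) ^ a p = 1 by rw [ha p hp, Real.rpow_zero], one_mul, Ym] at hf
  have e3 : Gf (a p) (b p) (κ p) t = 1 + t * H p t := by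
    simp only [hH]; field_simp; ring
  have e2 : y p t = t * (1 - t) * Zf' (a p) (b p) (κ p) t / Zf (a p) (b p) (κ p) t -
      (1 - t) * (1 + t * H p t) * (logWt t * (1 + (logWt t)⁻¹ * q p t))⁻¹ := by
    rw [← e3]; linarith
  rw [e2]
  simp only [e3]
  clear hf e2 e3 e1
  generalize H p t = hh at *
  generalize q p t = qq at *
  generalize logWt t = w at *
  have hp1 : w + qq ≠ 0 := by
    intro h0
    apply hp0
    field_simp
    rw [mul_zero]
    exact h0
  field_simp
  ring

end SmoothParams

end LogarithmicCase

end HomNS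

namespace HomNS

open Filter Topology

/-! ### Translation between the original equation and the Riccati equation. -/

section Link

variable {a b κ : ℝ} {c : Fin 3 → ℝ} {y f g : ℝ → ℝ} {x : ℝ}

lemma IsRiccati.contDiffOn (h : IsRiccati a b κ y) : ContDiffOn ℝ ∞ y (Ioo 0 1) := by
  refine contDiffOn_infty.2 fun n => ?_
  induction n with
  | zero => exact contDiffOn_zero.2 h.continuousOn
  | succ n ih =>
    rw [Nat.cast_succ, contDiffOn_succ_iff_deriv_of_isOpen isOpen_Ioo]
    refine ⟨fun t ht => (h t ht).differentiableAt.differentiableWithinAt, by simp, ?_⟩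
    refine ContDiffOn.congr (f := fun t =>
      κ - (y t ^ 2 + (a * (1 - t) - b * t) * y t) / (t * (1 - t))) ?_ fun t ht => (h t ht).deriv
    refine contDiffOn_const.sub (((ih.pow 2).add (ContDiffOn.mul (by fun_prop) ih)).div
      (by fun_prop) fun t ht => (mul_pos ht.1 (sub_pos.2 ht.2)).ne')

/-- The solution of the homogeneous Navier-Stokes equation at the critical value of `c₃`, in the
variable `t = (1+x)/2`. -/
def Ustar (a b t : ℝ) : ℝ := 2 * (1 + a) * (1 - t) - 2 * (1 + b) * t

/-- The solution of the original equation given by a Riccati solution. -/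
noncomputable def toU (a b : ℝ) (y : ℝ → ℝ) (x : ℝ) : ℝ :=
  Ustar a b ((1 + x) / 2) + 4 * y ((1 + x) / 2)

lemma half_add_mem (hx : x ∈ Ioo (-1 : ℝ) 1) : (1 + x) / 2 ∈ Ioo (0 : ℝ) 1 :=
  ⟨by linarith [hx.1], by linarith [hx.2]⟩

lemma zero_mem_Ioo : (0 : ℝ) ∈ Ioo (-1 : ℝ) 1 := by norm_num

lemma toU_zero : toU a b y 0 = a - b + 4 * y (1 / 2) := by
  simp only [toU, Ustar, add_zero]
  ring

/-- The relation between `c` and the parameters `a, b, κ`. -/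
structure ParamsOf (c : Fin 3 → ℝ) (a b κ : ℝ) : Prop where
  a_nonneg : 0 ≤ a
  b_nonneg : 0 ≤ b
  κ_pos : 0 < κ
  c0 : c 0 = a ^ 2 - 1
  c1 : c 1 = b ^ 2 - 1
  c2 : c 2 = 2 * κ - 1 / 2 * (a + b) * (a + b + 2)

namespace ParamsOf

lemma a_gt (h : ParamsOf c a b κ) : -1 < a := by linarith [h.a_nonneg]

lemma b_gt (h : ParamsOf c a b κ) : -1 < b := by linarith [h.b_nonneg]

lemma isRiccati (h : ParamsOf c a b κ) (hf : IsSolution c f) :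
    IsRiccati a b κ fun t => (f (2 * t - 1) - Ustar a b t) / 4 := by
  intro t ht
  have hx : 2 * t - 1 ∈ Ioo (-1 : ℝ) 1 := ⟨by linarith [ht.1], by linarith [ht.2]⟩
  have hd := (hf.1.differentiableAt (isOpen_Ioo.mem_nhds hx)).hasDerivAt
  have he := hf.2 _ hx
  have h1 : HasDerivAt (fun t : ℝ => 2 * t - 1) 2 t := by
    simpa using ((hasDerivAt_id t).const_mul 2).sub_const 1
  have h2 : HasDerivAt (Ustar a b) (-2 * (1 + a) - 2 * (1 + b)) t := by
    refine ((((hasDerivAt_id t).const_sub 1).const_mul (2 * (1 + a))).sub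
      ((hasDerivAt_id t).const_mul (2 * (1 + b)))).congr_deriv ?_
    ring
  refine (((hd.comp t h1).sub h2).div_const 4).congr_deriv ?_
  have h3 : t ≠ 0 := ht.1.ne'
  have h4 : 1 - t ≠ 0 := (sub_pos.2 ht.2).ne'
  rw [P, h.c0, h.c1, h.c2] at he
  simp only [Ustar]
  field_simp
  linear_combination 2 * he

lemma isSolution (h : ParamsOf c a b κ) (hy : IsRiccati a b κ y) : IsSolution c (toU a b y) := by
  have hder : ∀ x ∈ Ioo (-1 : ℝ) 1, HasDerivAt (toU a b y) (-(2 + a + b) + 2 *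
      (κ - (y ((1 + x) / 2) ^ 2 + (a * (1 - (1 + x) / 2) - b * ((1 + x) / 2)) * y ((1 + x) / 2)) /
        ((1 + x) / 2 * (1 - (1 + x) / 2)))) x := by
    intro x hx
    have h1 : HasDerivAt (fun x : ℝ => (1 + x) / 2) (1 / 2) x :=
      ((hasDerivAt_id x).const_add 1).div_const 2
    have h2 := (hy _ (half_add_mem hx)).comp x h1
    refine ((((h1.const_sub 1).const_mul (2 * (1 + a))).sub (h1.const_mul (2 * (1 + b)))).add
      (h2.const_mul 4)).congr_deriv ?_
    ring
  refine ⟨fun x hx => (hder x hx).differentiableAt.differentiableWithinAt, fun x hx => ?_⟩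
  rw [(hder x hx).deriv, P, h.c0, h.c1, h.c2, toU, Ustar]
  have h3 : 1 + x ≠ 0 := by linarith [hx.1]
  have h4 : 1 - x ≠ 0 := by linarith [hx.2]
  have h5 : (1 + x) / 2 * (1 - (1 + x) / 2) = (1 + x) * (1 - x) / 4 := by ring
  rw [h5]
  generalize y ((1 + x) / 2) = v
  field_simp
  ring

/-- The formula for `toU` need not have the right values at ±1, so the solution is extended by its
limits there. -/
lemma exists_regular (h : ParamsOf c a b κ) (hy : IsRiccati a b κ y) :
    ∃ f, IsRegularSolution c f ∧ EqOn f (toU a b y) (Ioo (-1) 1) := by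
  have hcd : ContDiffOn ℝ ∞ (toU a b y) (Ioo (-1) 1) := by
    have h1 : ContDiffOn ℝ ∞ (fun x => y ((1 + x) / 2)) (Ioo (-1) 1) :=
      hy.contDiffOn.comp (f := fun x : ℝ => (1 + x) / 2) (by fun_prop) fun x hx => half_add_mem hx
    have h2 : ContDiffOn ℝ ∞ (fun x : ℝ => Ustar a b ((1 + x) / 2)) (Ioo (-1) 1) := by
      unfold Ustar
      fun_prop
    exact h2.add (contDiffOn_const.mul h1)
  have hU : Continuous (Ustar a b) := by unfold Ustar; fun_prop
  have hlin : Continuous fun x : ℝ => (1 + x) / 2 := by fun_prop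
  obtain ⟨L, hL⟩ := hy.exists_tendsto_zero h.a_nonneg h.b_gt h.κ_pos
  obtain ⟨R, hR⟩ := hy.exists_tendsto_one h.a_gt h.b_nonneg h.κ_pos
  have hl : Tendsto (fun x : ℝ => (1 + x) / 2) (𝓝[>] (-1)) (𝓝[>] 0) := by
    refine tendsto_nhdsWithin_iff.2 ⟨?_, ?_⟩
    · simpa using (hlin.tendsto (-1)).mono_left nhdsWithin_le_nhds
    · filter_upwards [self_mem_nhdsWithin] with x hx
      have := mem_Ioi.1 hx
      rw [mem_Ioi]; linarith
  have hr : Tendsto (fun x : ℝ => (1 + x) / 2) (𝓝[<] 1) (𝓝[<] 1) := by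
    refine tendsto_nhdsWithin_iff.2 ⟨?_, ?_⟩
    · have := (hlin.tendsto 1).mono_left (nhdsWithin_le_nhds (s := Iio 1))
      norm_num at this
      exact this
    · filter_upwards [self_mem_nhdsWithin] with x hx
      have := mem_Iio.1 hx
      rw [mem_Iio]; linarith
  have hext : EqOn (extendFrom (Ioo (-1) 1) (toU a b y)) (toU a b y) (Ioo (-1) 1) := fun x hx =>
    extendFrom_eq (subset_closure hx) (hcd.continuousOn x hx).tendsto
  refine ⟨extendFrom (Ioo (-1) 1) (toU a b y), ⟨?_, hcd.congr hext, ?_⟩, hext⟩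
  · obtain ⟨h1, h2⟩ := h.isSolution hy
    refine ⟨h1.congr hext, fun x hx => ?_⟩
    have h3 : extendFrom (Ioo (-1) 1) (toU a b y) =ᶠ[𝓝 x] toU a b y := by
      filter_upwards [isOpen_Ioo.mem_nhds hx] with z hz using hext hz
    rw [h3.deriv_eq, hext hx]
    exact h2 x hx
  · have hl' : Tendsto (toU a b y) (𝓝[>] (-1)) (𝓝 (Ustar a b ((1 + -1) / 2) + 4 * L)) :=
      (((hU.comp hlin).tendsto (-1)).mono_left nhdsWithin_le_nhds).add
        ((hL.comp hl).const_mul 4)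
    have hr' : Tendsto (toU a b y) (𝓝[<] 1) (𝓝 (Ustar a b ((1 + 1) / 2) + 4 * R)) :=
      (((hU.comp hlin).tendsto 1).mono_left nhdsWithin_le_nhds).add ((hR.comp hr).const_mul 4)
    exact continuousOn_Icc_extendFrom_Ioo hcd.continuousOn hl' hr'

lemma eq_toU (a b : ℝ) (f : ℝ → ℝ) (x : ℝ) :
    f x = toU a b (fun t => (f (2 * t - 1) - Ustar a b t) / 4) x := by
  rw [toU, show 2 * ((1 + x) / 2) - 1 = x by ring]
  ring

lemma Uplus_eq (h : ParamsOf c a b κ) (hx : x ∈ Ioo (-1 : ℝ) 1) :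
    Uplus c x = toU a b (Ym a b κ) x := by
  obtain ⟨f, hf, hfe⟩ := h.exists_regular (isRiccati_Ym h.a_gt h.b_gt h.κ_pos)
  have hmax : IsMaximalSolution c f := ⟨hf, fun g hg z hz => by
    rw [hfe hz, eq_toU a b g z, toU, toU]
    have := (h.isRiccati hg).le_Ym h.a_nonneg h.b_gt h.κ_pos (half_add_mem hz)
    linarith⟩
  have hex : ∃ f, IsMaximalSolution c f := ⟨f, hmax⟩
  rw [Uplus, dif_pos hex, ← hfe hx]
  exact le_antisymm (hmax.2 _ hex.choose_spec.1.1 x hx) (hex.choose_spec.2 _ hf.1 x hx)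

lemma Uminus_eq (h : ParamsOf c a b κ) (hx : x ∈ Ioo (-1 : ℝ) 1) :
    Uminus c x = toU a b (Yp a b κ) x := by
  obtain ⟨f, hf, hfe⟩ := h.exists_regular (isRiccati_Yp h.a_gt h.b_gt h.κ_pos)
  have hmin : IsMinimalSolution c f := ⟨hf, fun g hg z hz => by
    rw [hfe hz, eq_toU a b g z, toU, toU]
    have := (h.isRiccati hg).Yp_le h.a_gt h.b_nonneg h.κ_pos (half_add_mem hz)
    linarith⟩
  have hex : ∃ f, IsMinimalSolution c f := ⟨f, hmin⟩
  rw [Uminus, dif_pos hex, ← hfe hx]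
  exact le_antisymm (hex.choose_spec.2 _ hf.1 x hx) (hmin.2 _ hex.choose_spec.1.1 x hx)

lemma gammaPlus_eq (h : ParamsOf c a b κ) : gammaPlus c = a - b + 4 * Ym a b κ (1 / 2) := by
  rw [gammaPlus, h.Uplus_eq zero_mem_Ioo, toU_zero]

lemma gammaMinus_eq (h : ParamsOf c a b κ) : gammaMinus c = a - b + 4 * Yp a b κ (1 / 2) := by
  rw [gammaMinus, h.Uminus_eq zero_mem_Ioo, toU_zero]

/-- Uniqueness for the Riccati equation from its value at t = 1/2 makes the choice in the definition
of `U` immaterial inside the interval. -/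
lemma U_eq (h : ParamsOf c a b κ) (hy : IsRiccati a b κ y) {γ : ℝ}
    (hγ : γ = a - b + 4 * y (1 / 2)) (hx : x ∈ Ioo (-1 : ℝ) 1) : U c γ x = toU a b y x := by
  obtain ⟨f, hf, hfe⟩ := h.exists_regular hy
  have hex : ∃ f, IsRegularSolution c f ∧ f 0 = γ :=
    ⟨f, hf, by rw [hfe zero_mem_Ioo, toU_zero, hγ]⟩
  rw [U, dif_pos hex]
  obtain ⟨h1, h2⟩ := hex.choose_spec
  set g := hex.choose
  rw [eq_toU a b g x, toU, toU]
  have h3 : (g (2 * (1 / 2) - 1) - Ustar a b (1 / 2)) / 4 = y (1 / 2) := by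
    rw [show (2 * (1 / 2) - 1 : ℝ) = 0 by norm_num, h2, hγ, Ustar]
    ring
  rw [(h.isRiccati h1.1).eq_of_eq hy half_mem h3 (half_add_mem hx)]

end ParamsOf

end Link

end HomNS

namespace HomNS

open Filter Topology

/-! ### Weighted derivative bounds near one endpoint. -/

section HalfBounds

variable {E : Type} [NormedAddCommGroup E] [NormedSpace ℝ E]
  {Ω : Set E} {a b κ η : E → ℝ} {y : E → ℝ → ℝ} {f : E → HalfInterval → ℝ}

/-- The derivatives of order at least `n₀` are bounded by multiples of the weight `w`, locally
uniformly in the parameters. -/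
def HalfBound (Ω : Set E) (f : E → HalfInterval → ℝ) (n₀ : ℕ) (w : HalfInterval → ℝ) : Prop :=
  ∀ K, IsCompact K → K ⊆ Ω → ∀ n ≥ n₀, ∃ C, ∀ p ∈ K, ∀ t,
    ‖iteratedFDeriv ℝ n (fun p => f p t) p‖ ≤ C * w t

lemma UnifSmoothOn.halfBound (hf : UnifSmoothOn Ω f) (n₀ : ℕ) :
    HalfBound Ω f n₀ fun _ => 1 := fun K hK hKΩ n _ => by
  simpa using hf.exists_bound_on_compact hK hKΩ n

/-- The parameter-free term e disappears after one differentiation; this is why the bound starts at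
order 1. -/
lemma halfBound_log (hΩ : IsOpen Ω) {F : E → HalfInterval → ℝ} {e : HalfInterval → ℝ}
    (hF : UnifSmoothOn Ω F) (hf : ∀ p ∈ Ω, ∀ t, f p t = e t + (logWt t ^ 2)⁻¹ * F p t) :
    HalfBound Ω f 1 fun t => (logWt t ^ 2)⁻¹ := by
  intro K hK hKΩ n hn
  obtain ⟨C, hC⟩ := hF.exists_bound_on_compact hK hKΩ n
  refine ⟨C, fun p hp t => ?_⟩
  have hFp : ContDiffAt ℝ n (fun p => F p t) p :=
    ((hF.smooth t).contDiffAt (hΩ.mem_nhds (hKΩ hp))).of_le (by exact_mod_cast le_top)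
  have h1 : (fun p => e t + (logWt t ^ 2)⁻¹ * F p t) =
      (fun _ => e t) + (logWt t ^ 2)⁻¹ • fun p => F p t := rfl
  have h2 : ContDiffAt ℝ n ((logWt t ^ 2)⁻¹ • fun p => F p t) p :=
    ContDiffAt.const_smul (logWt (t : ℝ) ^ 2)⁻¹ hFp
  rw [iteratedFDeriv_congr_of_isOpen hΩ (fun p hp => hf p hp t) (hKΩ hp), h1,
    iteratedFDeriv_add_apply contDiffAt_const h2,
    iteratedFDeriv_const_of_ne (by omega), iteratedFDeriv_const_smul_apply hFp, Pi.zero_apply,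
    zero_add, norm_smul, Real.norm_of_nonneg (by positivity), mul_comm]
  exact mul_le_mul_of_nonneg_right (hC p hp t) (by positivity)

lemma HalfBound.neg {n₀ : ℕ} {w : HalfInterval → ℝ} (h : HalfBound Ω f n₀ w) :
    HalfBound Ω (fun p t => -f p t) n₀ w := fun K hK hKΩ n hn => by
  obtain ⟨C, hC⟩ := h K hK hKΩ n hn
  refine ⟨C, fun p hp t => ?_⟩
  have := hC p hp t
  rwa [show (fun p => -f p t) = -fun p => f p t from rfl, iteratedFDeriv_neg_apply, norm_neg]

/-- Here 2t is the distance from x to the endpoint: |log(2t/3)| = log 3 + w - 1 ≤ w + 1 ≤ 2w, using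
log 3 ≤ 2. -/
lemma log_sq_le_logWt_sq (t : HalfInterval) :
    Real.log (2 * t / 3) ^ 2 ≤ 4 * logWt t ^ 2 := by
  have ht := t.2.1
  have h1 : Real.log (2 * t / 3) = -(Real.log 3 + (logWt t - 1)) := by
    rw [logWt, Real.log_div (by positivity) (by norm_num), Real.log_div (by norm_num) ht.ne',
      Real.log_mul (by norm_num) ht.ne', Real.log_div (by norm_num) (by norm_num), Real.log_one]
    ring
  have h2 : Real.log 3 ≤ 2 := by
    have := Real.log_le_sub_one_of_pos (by norm_num : (0 : ℝ) < 3)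
    linarith
  have h3 : 0 ≤ Real.log 3 := Real.log_nonneg (by norm_num)
  have h4 := one_le_logWt t
  rw [h1]
  nlinarith

lemma log_sq_le_four {u : ℝ} (h1 : 1 ≤ u) (h3 : u ≤ 3) : Real.log (u / 3) ^ 2 ≤ 4 := by
  have h2 : Real.log 3 ≤ 2 := by
    have := Real.log_le_sub_one_of_pos (by norm_num : (0 : ℝ) < 3)
    linarith
  have h4 : Real.log (u / 3) ≤ 0 := Real.log_nonpos (by linarith) (by linarith)
  have h5 : -Real.log 3 ≤ Real.log (u / 3) := by
    rw [Real.log_div (by linarith) (by norm_num)]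
    linarith [Real.log_nonneg h1]
  nlinarith

namespace SmoothParams

lemma contDiffOn_Ustar (h : SmoothParams Ω a b κ) : ContDiffOn ℝ ∞
    (fun q : E × ℝ => Ustar (a q.1) (b q.1) q.2) (posDomain Ω a b κ) := by
  have ha : ContDiffOn ℝ ∞ (fun q : E × ℝ => a q.1) (posDomain Ω a b κ) :=
    h.smooth_a.comp contDiffOn_fst fun _ hq => hq.1.1
  have hb : ContDiffOn ℝ ∞ (fun q : E × ℝ => b q.1) (posDomain Ω a b κ) :=
    h.smooth_b.comp contDiffOn_fst fun _ hq => hq.1.1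
  exact ((contDiffOn_const.mul (contDiffOn_const.add ha)).mul
    (contDiffOn_const.sub contDiffOn_snd)).sub
      ((contDiffOn_const.mul (contDiffOn_const.add hb)).mul contDiffOn_snd)

variable [ProperSpace E]

lemma unifSmoothOn_Ustar_add (h : SmoothParams Ω a b κ)
    (hy : UnifSmoothOn Ω fun p (t : HalfInterval) => y p t) :
    UnifSmoothOn Ω fun p (t : HalfInterval) => Ustar (a p) (b p) t + 4 * y p t :=
  (h.unifSmoothOn_of_posDomain h.contDiffOn_Ustar fun t => t.mem_Icc).add h.isOpen
    ((unifSmoothOn_of_index (C := 4) fun _ => by simp).mul h.isOpen hy)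

lemma unifSmoothOn_Ym (h : SmoothParams Ω a b κ) :
    UnifSmoothOn Ω fun p (t : HalfInterval) => Ym (a p) (b p) (κ p) t :=
  h.unifSmoothOn_of_posDomain h.contDiffOn_Ym fun t => t.mem_Icc

/-- For a = 0 the only part of `Ustar` depending on parameters is -2bt, and t = w⁻² · (t w²) moves
it into the weighted family. -/
lemma halfBound_of_zero (h : SmoothParams Ω a b κ) (ha : ∀ p ∈ Ω, a p = 0)
    (hη : ContDiffOn ℝ ∞ η Ω) (hlt : ∀ p ∈ Ω, η p < Ym (a p) (b p) (κ p) (1 / 2))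
    (hy : ∀ p ∈ Ω, IsRiccati (a p) (b p) (κ p) (y p)) (hyη : ∀ p ∈ Ω, y p (1 / 2) = η p) :
    HalfBound Ω (fun p t => Ustar (a p) (b p) t + 4 * y p t) 1 fun t => (logWt t ^ 2)⁻¹ := by
  obtain ⟨F, hF, hFe⟩ := h.exists_unifSmoothOn_of_zero ha hη hlt hy hyη
  have hi : UnifSmoothOn Ω (fun (_ : E) (t : HalfInterval) => (t : ℝ) * logWt t ^ 2) :=
    unifSmoothOn_of_index (C := Real.exp 1) fun t => by
      rw [Real.norm_of_nonneg (mul_nonneg t.2.1.le (sq_nonneg _))]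
      exact mul_logWt_sq_le t
  have hb : UnifSmoothOn Ω (fun p (_ : HalfInterval) => -2 * b p) :=
    unifSmoothOn_of_param h.isOpen (contDiffOn_const.mul h.smooth_b)
  have h4 : UnifSmoothOn Ω (fun (_ : E) (_ : HalfInterval) => (4 : ℝ)) :=
    unifSmoothOn_of_index (C := 4) fun _ => by simp
  refine halfBound_log (e := fun t => 2 - 4 * (t : ℝ) - 4 * (logWt t)⁻¹) h.isOpen
    ((hi.mul h.isOpen hb).add h.isOpen (h4.mul h.isOpen hF)) fun p hp t => ?_
  have hw : logWt (t : ℝ) ≠ 0 := by linarith [one_le_logWt t]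
  rw [hFe p hp t, Ustar, ha p hp]
  field_simp
  ring

end SmoothParams

end HalfBounds

/-! ### Iterated directional derivatives of smooth functions. -/

section DirectionalDerivatives

variable {E : Type*} [NormedAddCommGroup E] [NormedSpace ℝ E] {Ω : Set E} {f : E → ℝ} {v p : E}

/-- The derivative in the direction `v`. -/
noncomputable def dirD (v : E) (f : E → ℝ) (p : E) : ℝ := fderiv ℝ f p v

lemma contDiffOn_dirD (hΩ : IsOpen Ω) (hf : ContDiffOn ℝ ∞ f Ω) (v : E) :
    ContDiffOn ℝ ∞ (dirD v f) Ω :=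
  ((contDiffOn_infty_iff_fderiv_of_isOpen hΩ).1 hf).2.clm_apply contDiffOn_const

lemma contDiffOn_iterate_dirD (hΩ : IsOpen Ω) (hf : ContDiffOn ℝ ∞ f Ω) (v : E) (n : ℕ) :
    ContDiffOn ℝ ∞ ((dirD v)^[n] f) Ω := by
  induction n with
  | zero => exact hf
  | succ n ih =>
    rw [Function.iterate_succ_apply']
    exact contDiffOn_dirD hΩ ih v

lemma norm_iteratedFDeriv_dirD_le (hΩ : IsOpen Ω) (hf : ContDiffOn ℝ ∞ f Ω) (hp : p ∈ Ω)
    (hv : ‖v‖ ≤ 1) (m : ℕ) :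
    ‖iteratedFDeriv ℝ m (dirD v f) p‖ ≤ ‖iteratedFDeriv ℝ (m + 1) f p‖ := by
  have hfd : ContDiffAt ℝ m (fderiv ℝ f) p :=
    (((contDiffOn_infty_iff_fderiv_of_isOpen hΩ).1 hf).2.contDiffAt (hΩ.mem_nhds hp)).of_le
      (by exact_mod_cast le_top)
  have h1 := (ContinuousLinearMap.apply ℝ ℝ v).norm_iteratedFDeriv_comp_left hfd le_rfl
  have h2 : ‖ContinuousLinearMap.apply ℝ ℝ v‖ ≤ 1 :=
    ContinuousLinearMap.opNorm_le_bound _ zero_le_one fun A => by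
      rw [one_mul]
      exact (A.le_opNorm v).trans (mul_le_of_le_one_right (norm_nonneg A) hv)
  rw [← norm_iteratedFDeriv_fderiv]
  exact h1.trans (mul_le_of_le_one_left (norm_nonneg _) h2)

lemma norm_iteratedFDeriv_iterate_dirD_le (hΩ : IsOpen Ω) (hf : ContDiffOn ℝ ∞ f Ω) (hp : p ∈ Ω)
    (hv : ‖v‖ ≤ 1) (n m : ℕ) :
    ‖iteratedFDeriv ℝ m ((dirD v)^[n] f) p‖ ≤ ‖iteratedFDeriv ℝ (m + n) f p‖ := by
  induction n generalizing m with
  | zero => exact le_rfl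
  | succ n ih =>
    rw [Function.iterate_succ_apply']
    refine (norm_iteratedFDeriv_dirD_le hΩ (contDiffOn_iterate_dirD hΩ hf v n) hp hv m).trans ?_
    refine (ih (m + 1)).trans_eq ?_
    rw [show m + 1 + n = m + (n + 1) by omega]

end DirectionalDerivatives

/-! ### Partial derivatives along a stratum via a smooth extension. -/

section PartialDerivatives

variable {S Ω : Set ((Fin 3 → ℝ) × ℝ)} {f : (Fin 3 → ℝ) × ℝ → ℝ}

/-- Agreement with f is known on S only, and S need not be open. It suffices that S contains a short
segment in the direction of γ through each of its points, so agreement passes to the next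
derivative. -/
lemma iteratedDeriv_eq_dirD {G : (Fin 3 → ℝ) → ℝ → ℝ} (hΩ : IsOpen Ω) (hS : S ⊆ Ω)
    (hf : ContDiffOn ℝ ∞ f Ω) (hG : ∀ p ∈ S, G p.1 p.2 = f p)
    (hSo : ∀ p ∈ S, ∀ᶠ γ in 𝓝 p.2, (p.1, γ) ∈ S) (j : ℕ) :
    ∀ p ∈ S, iteratedDeriv j (G p.1) p.2 = (dirD (0, 1))^[j] f p := by
  induction j with
  | zero => intro p hp; simpa using hG p hp
  | succ j ih =>
    intro p hp
    rw [iteratedDeriv_succ, Function.iterate_succ_apply']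
    have h1 : iteratedDeriv j (G p.1) =ᶠ[𝓝 p.2] fun γ => (dirD (0, 1))^[j] f (p.1, γ) :=
      (hSo p hp).mono fun γ hγ => ih (p.1, γ) hγ
    rw [h1.deriv_eq]
    have h2 := (((contDiffOn_iterate_dirD hΩ hf (0, 1) j).contDiffAt
      (hΩ.mem_nhds (hS hp))).differentiableAt (by simp)).hasFDerivAt
    exact (h2.comp_hasDerivAt p.2 ((hasDerivAt_const p.2 p.1).prodMk (hasDerivAt_id p.2))).deriv

/-- As for γ, but the segments are demanded only if a derivative is actually taken in direction i;
frozen coordinates enter with n = 0. -/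
lemma iterate_partialC_eq_dirD {g : (Fin 3 → ℝ) → ℝ} {γ : ℝ} (hΩ : IsOpen Ω) (hS : S ⊆ Ω)
    (hf : ContDiffOn ℝ ∞ f Ω) (hg : ∀ c, (c, γ) ∈ S → g c = f (c, γ)) (i : Fin 3) (n : ℕ)
    (hSo : n ≠ 0 → ∀ p ∈ S, ∀ᶠ s : ℝ in 𝓝 0, (p.1 + s • Pi.single i 1, p.2) ∈ S) :
    ∀ c, (c, γ) ∈ S → (partialC i)^[n] g c = (dirD (Pi.single i 1, 0))^[n] f (c, γ) := by
  induction n with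
  | zero => exact hg
  | succ n ih =>
    intro c hc
    have hSo' := hSo (by omega)
    rw [Function.iterate_succ_apply', Function.iterate_succ_apply', partialC, lineDeriv]
    have h1 : (fun s : ℝ => (partialC i)^[n] g (c + s • Pi.single i 1)) =ᶠ[𝓝 0]
        fun s => (dirD (Pi.single i 1, 0))^[n] f (c + s • Pi.single i 1, γ) :=
      (hSo' (c, γ) hc).mono fun s hs => ih (fun _ => hSo') _ hs
    rw [h1.deriv_eq]
    have h2 := (((contDiffOn_iterate_dirD hΩ hf (Pi.single i 1, 0) n).contDiffAt
      (hΩ.mem_nhds (hS hc))).differentiableAt (by simp)).hasFDerivAt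
    have h3 : HasDerivAt (fun s : ℝ => c + s • (Pi.single i 1 : Fin 3 → ℝ)) (Pi.single i 1) 0 := by
      simpa using ((hasDerivAt_id (0 : ℝ)).smul_const (Pi.single i 1 : Fin 3 → ℝ)).const_add c
    exact (h2.comp_hasDerivAt_of_eq (0 : ℝ) (h3.prodMk (hasDerivAt_const 0 γ)) (by simp)).deriv

lemma norm_single_le (i : Fin 3) : ‖((Pi.single i 1, 0) : (Fin 3 → ℝ) × ℝ)‖ ≤ 1 := by
  simp [Prod.norm_def, Pi.norm_single]

/-- The mixed partial derivatives on a stratum are controlled by the derivatives of a smooth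
extension. -/
lemma abs_dU_le {l j : ℕ} {α : Fin 3 → ℕ} {x : ℝ} (hΩ : IsOpen Ω) (hS : S ⊆ Ω)
    (hf : ContDiffOn ℝ ∞ f Ω) (hG : ∀ p ∈ S, Ustratum l p.1 p.2 x = f p)
    (hSγ : ∀ p ∈ S, ∀ᶠ γ in 𝓝 p.2, (p.1, γ) ∈ S)
    (hSc : ∀ i, α i ≠ 0 → ∀ p ∈ S, ∀ᶠ s : ℝ in 𝓝 0, (p.1 + s • Pi.single i 1, p.2) ∈ S)
    {p : (Fin 3 → ℝ) × ℝ} (hp : p ∈ S) :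
    |dU l α j p.1 p.2 x| ≤ ‖iteratedFDeriv ℝ (α 0 + α 1 + α 2 + j) f p‖ := by
  have hs0 := contDiffOn_iterate_dirD hΩ hf (0, 1) j
  have hs2 := contDiffOn_iterate_dirD hΩ hs0 (Pi.single 2 1, 0) (α 2)
  have hs1 := contDiffOn_iterate_dirD hΩ hs2 (Pi.single 1 1, 0) (α 1)
  have e0 := iteratedDeriv_eq_dirD (G := fun c γ => Ustratum l c γ x) hΩ hS hf hG hSγ j
  have e2 := iterate_partialC_eq_dirD
    (g := fun c => iteratedDeriv j (fun γ => Ustratum l c γ x) p.2) hΩ hS hs0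
    (fun c hc => e0 (c, p.2) hc) 2 (α 2) (hSc 2)
  have e1 := iterate_partialC_eq_dirD hΩ hS hs2 e2 1 (α 1) (hSc 1)
  have e := iterate_partialC_eq_dirD hΩ hS hs1 e1 0 (α 0) (hSc 0) p.1 hp
  rw [dU, partialCMulti, e, ← Real.norm_eq_abs, ← norm_iteratedFDeriv_zero (𝕜 := ℝ)]
  have hpΩ := hS hp
  refine (norm_iteratedFDeriv_iterate_dirD_le hΩ hs1 hpΩ (norm_single_le 0) _ _).trans ?_
  refine (norm_iteratedFDeriv_iterate_dirD_le hΩ hs2 hpΩ (norm_single_le 1) _ _).trans ?_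
  refine (norm_iteratedFDeriv_iterate_dirD_le hΩ hs0 hpΩ (norm_single_le 2) _ _).trans ?_
  refine (norm_iteratedFDeriv_iterate_dirD_le hΩ hf hpΩ (by simp [Prod.norm_def]) _ _).trans_eq ?_
  rw [zero_add]

end PartialDerivatives

end HomNS

namespace HomNS

open Filter Topology

/-! ### Bounds for the distinguished solution families at both endpoints. -/

lemma toU_left (a b : ℝ) (y : ℝ → ℝ) (t : ℝ) :
    toU a b y (2 * t - 1) = Ustar a b t + 4 * y t := by
  rw [toU, show (1 + (2 * t - 1)) / 2 = t by ring]

lemma toU_right (a b : ℝ) (y : ℝ → ℝ) (t : ℝ) :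
    toU a b y (1 - 2 * t) = -(Ustar b a t + 4 * -y (1 - t)) := by
  rw [toU, show (1 + (1 - 2 * t)) / 2 = 1 - t by ring]
  simp only [Ustar]
  ring

section Families

variable {E : Type} [NormedAddCommGroup E] [NormedSpace ℝ E]
  {Ω : Set E} {a b κ η : E → ℝ} {y : E → ℝ → ℝ}

/-- The distinguished Riccati solutions: the largest one for `l = 2`, the smallest one for `l = 3`,
and otherwise the one with value `η` at `1/2`. -/
noncomputable def sol (l : ℕ) (a b κ η : ℝ) : ℝ → ℝ :=
  if l = 2 then Ym a b κ else if l = 3 then Yp a b κ else Ymix a b κ η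

lemma sol_two (a b κ η : ℝ) : sol 2 a b κ η = Ym a b κ := rfl

lemma sol_three (a b κ η : ℝ) : sol 3 a b κ η = Yp a b κ := rfl

lemma sol_of_ne {l : ℕ} (h2 : l ≠ 2) (h3 : l ≠ 3) (a b κ η : ℝ) : sol l a b κ η = Ymix a b κ η := by
  rw [sol, if_neg h2, if_neg h3]

/-- Smooth parameters together with initial values strictly between the extremal ones, unless
`l = 2` or `l = 3`. -/
structure SolParams (l : ℕ) (Ω : Set E) (a b κ η : E → ℝ) : Prop extends
    SmoothParams Ω a b κ where
  smooth_η : ContDiffOn ℝ ∞ η Ω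
  Yp_lt : l ≠ 2 → l ≠ 3 → ∀ p ∈ Ω, Yp (a p) (b p) (κ p) (1 / 2) < η p
  lt_Ym : l ≠ 2 → l ≠ 3 → ∀ p ∈ Ω, η p < Ym (a p) (b p) (κ p) (1 / 2)

namespace SolParams

variable {l : ℕ} {p : E}

lemma isRiccati (h : SolParams l Ω a b κ η) (hp : p ∈ Ω) :
    IsRiccati (a p) (b p) (κ p) (sol l (a p) (b p) (κ p) (η p)) := by
  have ha := h.a_gt hp
  have hb := h.b_gt hp
  have hκ := h.κ_pos p hp
  by_cases h2 : l = 2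
  · rw [h2, sol_two]; exact isRiccati_Ym ha hb hκ
  by_cases h3 : l = 3
  · rw [h3, sol_three]; exact isRiccati_Yp ha hb hκ
  · rw [sol_of_ne h2 h3]
    exact isRiccati_Ymix ha hb hκ (h.Yp_lt h2 h3 p hp).le (h.lt_Ym h2 h3 p hp).le

lemma contDiffOn_Yp (h : SmoothParams Ω a b κ) : ContDiffOn ℝ ∞
    (fun q : E × ℝ => Yp (a q.1) (b q.1) (κ q.1) q.2) (Ω ×ˢ Ioo 0 1) :=
  (h.symm.contDiffOn_Ym.comp (f := fun q : E × ℝ => (q.1, 1 - q.2)) (by fun_prop)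
    fun q hq => h.symm.mem_posDomain hq.1 (one_sub_mem hq.2).1.le (one_sub_mem hq.2).2).neg

lemma contDiffOn_half {Φ : E × ℝ → ℝ}
    (hΦ : ContDiffOn ℝ ∞ Φ (Ω ×ˢ Ioo 0 1)) : ContDiffOn ℝ ∞ (fun p => Φ (p, 1 / 2)) Ω :=
  hΦ.comp (contDiffOn_id.prodMk contDiffOn_const) fun _ hp => ⟨hp, half_mem⟩

lemma contDiffOn_sol (h : SolParams l Ω a b κ η) : ContDiffOn ℝ ∞
    (fun q : E × ℝ => sol l (a q.1) (b q.1) (κ q.1) (η q.1) q.2) (Ω ×ˢ Ioo 0 1) := by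
  have hs := h.toSmoothParams
  have hsub : Ω ×ˢ Ioo (0 : ℝ) 1 ⊆ posDomain Ω a b κ :=
    fun q hq => hs.mem_posDomain hq.1 hq.2.1.le hq.2.2
  have hYm := hs.contDiffOn_Ym.mono hsub
  have hYp := contDiffOn_Yp hs
  by_cases h2 : l = 2
  · simpa only [h2, sol_two] using hYm
  by_cases h3 : l = 3
  · simpa only [h3, sol_three] using hYp
  simp only [sol_of_ne h2 h3]
  have hZ : ContDiffOn ℝ ∞ (fun q : E × ℝ => Zf (a q.1) (b q.1) (κ q.1) q.2) (Ω ×ˢ Ioo 0 1) :=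
    hs.contDiffOn_Zf.mono fun q hq => (hsub hq).1
  have hZ' : ContDiffOn ℝ ∞ (fun q : E × ℝ => Zf (b q.1) (a q.1) (κ q.1) (1 - q.2))
      (Ω ×ˢ Ioo 0 1) :=
    hs.symm.contDiffOn_Zf.comp (f := fun q : E × ℝ => (q.1, 1 - q.2)) (by fun_prop)
      fun q hq => (hs.symm.mem_posDomain hq.1 (one_sub_mem hq.2).1.le (one_sub_mem hq.2).2).1
  have hpar : ∀ {g : E → ℝ}, ContDiffOn ℝ ∞ g Ω →
      ContDiffOn ℝ ∞ (fun q : E × ℝ => g q.1) (Ω ×ˢ Ioo (0 : ℝ) 1) :=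
    fun hg => hg.comp contDiffOn_fst fun q hq => hq.1
  have h0 : ContDiffOn ℝ ∞ (fun p => (η p - Yp (a p) (b p) (κ p) (1 / 2)) /
      Zf (a p) (b p) (κ p) (1 / 2)) Ω :=
    (h.smooth_η.sub (contDiffOn_half hYp)).div (contDiffOn_half hZ)
      fun p hp => (Zf_pos (h.a_gt hp) (h.b_gt hp) (h.κ_pos p hp) half_mem.1.le half_mem.2).ne'
  have h1 : ContDiffOn ℝ ∞ (fun p => (Ym (a p) (b p) (κ p) (1 / 2) - η p) /
      Zf (b p) (a p) (κ p) (1 / 2)) Ω := by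
    have := (contDiffOn_half hZ')
    norm_num only at this
    exact ((contDiffOn_half hYm).sub h.smooth_η).div this
      fun p hp => (Zf_pos (h.b_gt hp) (h.a_gt hp) (h.κ_pos p hp) half_mem.1.le half_mem.2).ne'
  exact (((hpar h0).mul (hZ.mul hYm)).add ((hpar h1).mul (hZ'.mul hYp))).div
    (((hpar h0).mul hZ).add ((hpar h1).mul hZ')) fun q hq => (Zmix_pos (h.a_gt hq.1) (h.b_gt hq.1)
      (h.κ_pos _ hq.1) (h.Yp_lt h2 h3 _ hq.1).le (h.lt_Ym h2 h3 _ hq.1).le hq.2).ne'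

lemma contDiffOn_toU (h : SolParams l Ω a b κ η) : ContDiffOn ℝ ∞
    (fun q : E × ℝ => toU (a q.1) (b q.1) (sol l (a q.1) (b q.1) (κ q.1) (η q.1)) q.2)
    (Ω ×ˢ Ioo (-1) 1) := by
  have hm : ContDiffOn ℝ ∞ (fun q : E × ℝ => (q.1, (1 + q.2) / 2)) (Ω ×ˢ Ioo (-1) 1) := by
    fun_prop
  refine (h.contDiffOn_Ustar.comp hm fun q hq => ?_).add
    (contDiffOn_const.mul (h.contDiffOn_sol.comp hm fun q hq => ⟨hq.1, half_add_mem hq.2⟩))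
  exact h.mem_posDomain hq.1 (half_add_mem hq.2).1.le (half_add_mem hq.2).2

lemma contDiffOn_toU_section (h : SolParams l Ω a b κ η) {x : ℝ} (hx : x ∈ Ioo (-1 : ℝ) 1) :
    ContDiffOn ℝ ∞ (fun p => toU (a p) (b p) (sol l (a p) (b p) (κ p) (η p)) x) Ω :=
  h.contDiffOn_toU.comp (contDiffOn_id.prodMk contDiffOn_const) fun _ hp => ⟨hp, hx⟩

/-- The strict gap is what makes the integration constant E finite and positive; it fails exactly
for the maximal solution. -/
lemma sol_half_lt_Ym (h : SolParams l Ω a b κ η) (h2 : l ≠ 2) (hp : p ∈ Ω) :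
    sol l (a p) (b p) (κ p) (η p) (1 / 2) < Ym (a p) (b p) (κ p) (1 / 2) := by
  have ha := h.a_gt hp
  have hb := h.b_gt hp
  have hκ := h.κ_pos p hp
  by_cases h3 : l = 3
  · rw [h3, sol_three]; exact Yp_lt_Ym ha hb hκ half_mem
  · rw [sol_of_ne h2 h3, Ymix_half ha hb hκ]; exact h.lt_Ym h2 h3 p hp

lemma Yp_half_lt_sol (h : SolParams l Ω a b κ η) (h3 : l ≠ 3) (hp : p ∈ Ω) :
    Yp (a p) (b p) (κ p) (1 / 2) < sol l (a p) (b p) (κ p) (η p) (1 / 2) := by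
  have ha := h.a_gt hp
  have hb := h.b_gt hp
  have hκ := h.κ_pos p hp
  by_cases h2 : l = 2
  · rw [h2, sol_two]; exact Yp_lt_Ym ha hb hκ half_mem
  · rw [sol_of_ne h2 h3, Ymix_half ha hb hκ]; exact h.Yp_lt h2 h3 p hp

lemma mirror_half_lt_Ym (h : SolParams l Ω a b κ η) (h3 : l ≠ 3) (hp : p ∈ Ω) :
    -sol l (a p) (b p) (κ p) (η p) (1 - 1 / 2) < Ym (b p) (a p) (κ p) (1 / 2) := by
  have := h.Yp_half_lt_sol h3 hp
  rw [Yp] at this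
  norm_num only at this ⊢
  linarith

lemma contDiffOn_mirror_half (h : SolParams l Ω a b κ η) :
    ContDiffOn ℝ ∞ (fun p => -sol l (a p) (b p) (κ p) (η p) (1 - 1 / 2)) Ω := by
  have := (contDiffOn_half h.contDiffOn_sol).neg
  norm_num only at this ⊢
  exact this

variable [ProperSpace E]

/-- The maximal solution is smooth through t = 0 for every a ≥ 0; any other one needs a > 0. -/
lemma halfBound_left_regular (h : SolParams l Ω a b κ η) (hr : (∀ p ∈ Ω, 0 < a p) ∨ l = 2)
    (n₀ : ℕ) : HalfBound Ω (fun p t => toU (a p) (b p) (sol l (a p) (b p) (κ p) (η p))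
      (2 * t - 1)) n₀ fun _ => 1 := by
  simp only [toU_left]
  refine (h.unifSmoothOn_Ustar_add ?_).halfBound n₀
  by_cases h2 : l = 2
  · simp only [h2, sol_two]
    exact h.unifSmoothOn_Ym
  · exact h.unifSmoothOn_of_pos (hr.resolve_right h2) (contDiffOn_half
      h.contDiffOn_sol) (fun p hp => h.sol_half_lt_Ym h2 hp) (fun p hp => h.isRiccati hp)
      fun _ _ => rfl

lemma halfBound_left_log (h : SolParams l Ω a b κ η) (ha : ∀ p ∈ Ω, a p = 0) (h2 : l ≠ 2) :
    HalfBound Ω (fun p t => toU (a p) (b p) (sol l (a p) (b p) (κ p) (η p)) (2 * t - 1)) 1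
      fun t => (logWt t ^ 2)⁻¹ := by
  simp only [toU_left]
  exact h.halfBound_of_zero ha (contDiffOn_half h.contDiffOn_sol)
    (fun p hp => h.sol_half_lt_Ym h2 hp) (fun p hp => h.isRiccati hp) fun _ _ => rfl

/-- The reflected solution is studied at 0. Under reflection the minimal solution becomes the
maximal one, so l = 3 takes over the role of l = 2. -/
lemma halfBound_right_regular (h : SolParams l Ω a b κ η) (hr : (∀ p ∈ Ω, 0 < b p) ∨ l = 3)
    (n₀ : ℕ) : HalfBound Ω (fun p t => toU (a p) (b p) (sol l (a p) (b p) (κ p) (η p))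
      (1 - 2 * t)) n₀ fun _ => 1 := by
  simp only [toU_right]
  refine (HalfBound.neg ((h.symm.unifSmoothOn_Ustar_add
    (y := fun p t => -sol l (a p) (b p) (κ p) (η p) (1 - t)) ?_).halfBound n₀))
  by_cases h3 : l = 3
  · simp only [h3, sol_three, Yp_mirror]
    exact h.symm.unifSmoothOn_Ym
  · exact h.symm.unifSmoothOn_of_pos (hr.resolve_right h3) h.contDiffOn_mirror_half
      (fun p hp => h.mirror_half_lt_Ym h3 hp) (fun p hp => (h.isRiccati hp).mirror) fun _ _ => rfl

lemma halfBound_right_log (h : SolParams l Ω a b κ η) (hb : ∀ p ∈ Ω, b p = 0) (h3 : l ≠ 3) :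
    HalfBound Ω (fun p t => toU (a p) (b p) (sol l (a p) (b p) (κ p) (η p)) (1 - 2 * t)) 1
      fun t => (logWt t ^ 2)⁻¹ := by
  simp only [toU_right]
  exact (h.symm.halfBound_of_zero hb h.contDiffOn_mirror_half
    (fun p hp => h.mirror_half_lt_Ym h3 hp) (fun p hp => (h.isRiccati hp).mirror)
    fun _ _ => rfl).neg

end SolParams

/-- Bounds on the two halves of the interval, with weights compensated by `W`. -/
lemma exists_weighted_bound {f : E → ℝ → ℝ} {n₀ : ℕ} {wl wr : HalfInterval → ℝ} {W : ℝ → ℝ} {B : ℝ}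
    (hL : HalfBound Ω (fun p t => f p (2 * t - 1)) n₀ wl)
    (hR : HalfBound Ω (fun p t => f p (1 - 2 * t)) n₀ wr)
    (hW : ∀ x, 0 ≤ W x) (hwl : ∀ t, 0 ≤ wl t) (hwr : ∀ t, 0 ≤ wr t)
    (hWl : ∀ t : HalfInterval, W (2 * t - 1) * wl t ≤ B)
    (hWr : ∀ t : HalfInterval, W (1 - 2 * t) * wr t ≤ B)
    {K : Set E} (hK : IsCompact K) (hKΩ : K ⊆ Ω) (m : ℕ) :
    ∃ C, ∀ n, n₀ ≤ n → n ≤ m → ∀ p ∈ K, ∀ x ∈ Ioo (-1 : ℝ) 1,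
      W x * ‖iteratedFDeriv ℝ n (fun p => f p x) p‖ ≤ C := by
  have key : ∀ {u w z C : ℝ}, 0 ≤ u → 0 ≤ w → z ≤ C * w → u * w ≤ B → u * z ≤ |C| * B := by
    intro u w z C hu hw hz hB
    calc u * z ≤ u * (C * w) := mul_le_mul_of_nonneg_left hz hu
      _ = C * (u * w) := by ring
      _ ≤ |C| * (u * w) := mul_le_mul_of_nonneg_right (le_abs_self C) (mul_nonneg hu hw)
      _ ≤ |C| * B := mul_le_mul_of_nonneg_left hB (abs_nonneg C)
  have h1 : ∀ n, ∃ C, n₀ ≤ n → ∀ p ∈ K, ∀ x ∈ Ioo (-1 : ℝ) 1,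
      W x * ‖iteratedFDeriv ℝ n (fun p => f p x) p‖ ≤ C := by
    intro n
    by_cases hn : n₀ ≤ n
    · obtain ⟨C₁, h₁⟩ := hL K hK hKΩ n hn
      obtain ⟨C₂, h₂⟩ := hR K hK hKΩ n hn
      refine ⟨max (|C₁| * B) (|C₂| * B), fun _ p hp x hx => ?_⟩
      -- Each half of (-1, 1) is parametrised by half the distance t to its own endpoint.
      rcases le_or_gt x 0 with h0 | h0
      · refine le_max_of_le_left ?_
        let t : HalfInterval := ⟨(1 + x) / 2, by linarith [hx.1], by linarith⟩
        have hx' : x = 2 * (t : ℝ) - 1 := by simp only [t]; ring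
        rw [hx']
        exact key (hW _) (hwl t) (h₁ p hp t) (hWl t)
      · refine le_max_of_le_right ?_
        let t : HalfInterval := ⟨(1 - x) / 2, by linarith [hx.2], by linarith⟩
        have hx' : x = 1 - 2 * (t : ℝ) := by simp only [t]; ring
        rw [hx']
        exact key (hW _) (hwr t) (h₂ p hp t) (hWr t)
    · exact ⟨0, fun h => absurd h hn⟩
  choose C hC using h1
  obtain ⟨M, hM⟩ := ((Finset.range (m + 1)).image C).exists_le
  exact ⟨M, fun n hn hnm p hp x hx => (hC n hn p hp x hx).trans
    (hM _ (Finset.mem_image_of_mem C (Finset.mem_range.2 (by omega))))⟩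

end Families

end HomNS

namespace HomNS

open Filter Topology

/-! ### Smooth extension from the strata to open sets. -/

section Strata

variable {za zb : Bool} {l k : ℕ} {c : Fin 3 → ℝ} {p : (Fin 3 → ℝ) × ℝ}

/-- The exponent `√(1+s)`, replaced by its value `0` if `s` is frozen to `-1`. -/
noncomputable def expo (z : Bool) (s : ℝ) : ℝ := if z then 0 else √(1 + s)

/-- The parameter `κ` in terms of `c`. -/
noncomputable def kap (za zb : Bool) (c : Fin 3 → ℝ) : ℝ :=
  (c 2 + 1 / 2 * (expo za (c 0) + expo zb (c 1)) * (expo za (c 0) + expo zb (c 1) + 2)) / 2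

/-- The value at `1/2` of the Riccati solution, in terms of `c` and `γ`. -/
noncomputable def etaOf (za zb : Bool) (p : (Fin 3 → ℝ) × ℝ) : ℝ :=
  (p.2 - (expo za (p.1 0) - expo zb (p.1 1))) / 4

/-- An open neighbourhood of a stratum of `J`. -/
def nbhd (za zb : Bool) : Set (Fin 3 → ℝ) :=
  {c | (za = false → -1 < c 0) ∧ (zb = false → -1 < c 1) ∧ 0 < kap za zb c}

/-- The condition that the coordinates marked by `za, zb` have the value `-1`. -/
def Frozen (za zb : Bool) (c : Fin 3 → ℝ) : Prop := (za = true → c 0 = -1) ∧ (zb = true → c 1 = -1)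

/-- An open neighbourhood of a stratum of `I`. -/
def domL (l : ℕ) (za zb : Bool) : Set ((Fin 3 → ℝ) × ℝ) :=
  {p | p.1 ∈ nbhd za zb ∧ (l = 1 →
    Yp (expo za (p.1 0)) (expo zb (p.1 1)) (kap za zb p.1) (1 / 2) < etaOf za zb p ∧
    etaOf za zb p < Ym (expo za (p.1 0)) (expo zb (p.1 1)) (kap za zb p.1) (1 / 2))}

/-- A smooth extension of `Ustratum` to a neighbourhood of the stratum. -/
noncomputable def Uext (l : ℕ) (za zb : Bool) (p : (Fin 3 → ℝ) × ℝ) (x : ℝ) : ℝ :=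
  toU (expo za (p.1 0)) (expo zb (p.1 1))
    (sol l (expo za (p.1 0)) (expo zb (p.1 1)) (kap za zb p.1) (etaOf za zb p)) x

lemma expo_nonneg (z : Bool) (s : ℝ) : 0 ≤ expo z s := by
  unfold expo
  split_ifs
  exacts [le_rfl, Real.sqrt_nonneg _]

lemma expo_eq {z : Bool} {s : ℝ} (h : z = true → s = -1) : expo z s = √(1 + s) := by
  cases z
  · rfl
  · simp [expo, h rfl]

lemma contDiffOn_expo (z : Bool) : ContDiffOn ℝ ∞ (expo z) {s | z = false → -1 < s} := by
  cases z
  · exact ContDiffOn.sqrt (by fun_prop) fun s hs => by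
      have : -1 < s := hs rfl
      linarith
  · exact contDiffOn_const

lemma contDiffOn_expo_comp (z : Bool) (i : Fin 3) : ContDiffOn ℝ ∞
    (fun p : (Fin 3 → ℝ) × ℝ => expo z (p.1 i)) {p | z = false → -1 < p.1 i} :=
  (contDiffOn_expo z).comp (by fun_prop) fun _ hp => hp

lemma isOpen_imp (z : Bool) (i : Fin 3) :
    IsOpen {p : (Fin 3 → ℝ) × ℝ | z = false → -1 < p.1 i} := by
  cases z
  · simpa using isOpen_lt continuous_const (by fun_prop)
  · simp

lemma contDiffOn_kap (za zb : Bool) : ContDiffOn ℝ ∞ (fun p : (Fin 3 → ℝ) × ℝ => kap za zb p.1)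
    ({p | za = false → -1 < p.1 0} ∩ {p | zb = false → -1 < p.1 1}) := by
  have ha := (contDiffOn_expo_comp za 0).mono
    (inter_subset_left (t := {p : (Fin 3 → ℝ) × ℝ | zb = false → -1 < p.1 1}))
  have hb := (contDiffOn_expo_comp zb 1).mono
    (inter_subset_right (s := {p : (Fin 3 → ℝ) × ℝ | za = false → -1 < p.1 0}))
  have h2 : ContDiff ℝ ∞ fun p : (Fin 3 → ℝ) × ℝ => p.1 2 := by fun_prop
  exact (h2.contDiffOn.add ((contDiffOn_const.mul (ha.add hb)).mul
    ((ha.add hb).add contDiffOn_const))).div_const 2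

lemma smoothParams_nbhd (za zb : Bool) : SmoothParams {p : (Fin 3 → ℝ) × ℝ | p.1 ∈ nbhd za zb}
    (fun p => expo za (p.1 0)) (fun p => expo zb (p.1 1)) fun p => kap za zb p.1 where
  isOpen := by
    have h := (contDiffOn_kap za zb).continuousOn.isOpen_inter_preimage
      ((isOpen_imp za 0).inter (isOpen_imp zb 1)) (isOpen_Ioi (a := 0))
    convert h using 1
    ext p
    simp [nbhd, and_assoc]
  smooth_a := (contDiffOn_expo_comp za 0).mono fun _ hp => hp.1
  smooth_b := (contDiffOn_expo_comp zb 1).mono fun _ hp => hp.2.1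
  smooth_κ := (contDiffOn_kap za zb).mono fun _ hp => ⟨hp.1, hp.2.1⟩
  a_nonneg _ _ := expo_nonneg _ _
  b_nonneg _ _ := expo_nonneg _ _
  κ_pos _ hp := hp.2.2

lemma contDiffOn_etaOf (za zb : Bool) :
    ContDiffOn ℝ ∞ (etaOf za zb) {p : (Fin 3 → ℝ) × ℝ | p.1 ∈ nbhd za zb} :=
  (contDiffOn_snd.sub ((smoothParams_nbhd za zb).smooth_a.sub
    (smoothParams_nbhd za zb).smooth_b)).div_const 4

lemma isOpen_domL (l : ℕ) (za zb : Bool) : IsOpen (domL l za zb) := by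
  have h := smoothParams_nbhd za zb
  by_cases hl : l = 1
  · have hYm := h.contDiffOn_Ym_half
    have hYp := SolParams.contDiffOn_half (SolParams.contDiffOn_Yp h)
    have hη := contDiffOn_etaOf za zb
    have h1 := (hη.sub hYp).continuousOn.isOpen_inter_preimage h.isOpen (isOpen_Ioi (a := 0))
    have h2 := (hYm.sub hη).continuousOn.isOpen_inter_preimage h.isOpen (isOpen_Ioi (a := 0))
    refine isOpen_iff_mem_nhds.2 fun p hp => mem_of_superset ((h1.inter h2).mem_nhds
      ⟨⟨hp.1, sub_pos.2 (hp.2 hl).1⟩, hp.1, sub_pos.2 (hp.2 hl).2⟩) fun p hp => ?_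
    exact ⟨hp.1.1, fun _ => ⟨sub_pos.1 hp.1.2, sub_pos.1 hp.2.2⟩⟩
  · simpa [domL, hl] using h.isOpen

lemma solParams_domL (hl : 1 ≤ l ∧ l ≤ 3) : SolParams l (domL l za zb)
    (fun p => expo za (p.1 0)) (fun p => expo zb (p.1 1)) (fun p => kap za zb p.1)
    (etaOf za zb) where
  toSmoothParams := (smoothParams_nbhd za zb).mono (isOpen_domL l za zb) fun _ hp => hp.1
  smooth_η := (contDiffOn_etaOf za zb).mono fun _ hp => hp.1
  Yp_lt h2 h3 _ hp := (hp.2 (by omega)).1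
  lt_Ym h2 h3 _ hp := (hp.2 (by omega)).2

lemma paramsOf_nbhd (hc : c ∈ nbhd za zb) (hf : Frozen za zb c) :
    ParamsOf c (expo za (c 0)) (expo zb (c 1)) (kap za zb c) := by
  have key : ∀ {z : Bool} {s : ℝ}, (z = false → -1 < s) → (z = true → s = -1) →
      s = expo z s ^ 2 - 1 := by
    intro z s h1 h2
    have h3 : 0 ≤ 1 + s := by
      cases z
      · linarith [h1 rfl]
      · linarith [h2 rfl]
    rw [expo_eq h2, Real.sq_sqrt h3]
    ring
  exact ⟨expo_nonneg _ _, expo_nonneg _ _, hc.2.2, key hc.1 hf.1, key hc.2.1 hf.2, by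
    rw [kap]; ring⟩

/-- `expo` is the true root when the marked coordinates equal -1; elsewhere `Uext` serves only as a
smooth extension. For l = 2, 3 it does not involve γ. -/
lemma Ustratum_eq_Uext (hl : 1 ≤ l ∧ l ≤ 3) (hp : p ∈ domL l za zb) (hf : Frozen za zb p.1) {x : ℝ}
    (hx : x ∈ Ioo (-1 : ℝ) 1) : Ustratum l p.1 p.2 x = Uext l za zb p x := by
  have h := paramsOf_nbhd hp.1 hf
  have hr := (solParams_domL hl).isRiccati hp
  rw [Ustratum, Uext]
  by_cases h2 : l = 2
  · subst h2
    exact h.U_eq hr h.gammaPlus_eq hx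
  by_cases h3 : l = 3
  · subst h3
    exact h.U_eq hr h.gammaMinus_eq hx
  rw [if_neg h2, if_neg h3]
  refine h.U_eq hr ?_ hx
  rw [sol_of_ne h2 h3, Ymix_half h.a_gt h.b_gt h.κ_pos, etaOf]
  ring

/-- The two flags record whether c₁ and c₂ are frozen on the stratum, so that all four strata are
treated at once. -/
lemma Jk_subset (hk : 1 ≤ k ∧ k ≤ 4) : ∃ za zb, (za = true ↔ k = 2 ∨ k = 4) ∧
    (zb = true ↔ k = 3 ∨ k = 4) ∧ ∀ c ∈ Jk k, c ∈ nbhd za zb ∧ Frozen za zb c := by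
  have key : ∀ {za zb : Bool} {c : Fin 3 → ℝ}, (za = false → -1 < c 0) → (zb = false → -1 < c 1) →
      Frozen za zb c → cbar (c 0) (c 1) < c 2 → c ∈ nbhd za zb ∧ Frozen za zb c := by
    intro za zb c h0 h1 hf h2
    refine ⟨⟨h0, h1, ?_⟩, hf⟩
    rw [cbar] at h2
    rw [kap, expo_eq hf.1, expo_eq hf.2]
    linarith
  obtain rfl | rfl | rfl | rfl : k = 1 ∨ k = 2 ∨ k = 3 ∨ k = 4 := by omega
  · exact ⟨false, false, by simp, by simp, fun c hc =>
      key (fun _ => hc.2.1) (fun _ => hc.2.2.1) ⟨by simp, by simp⟩ hc.2.2.2⟩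
  · exact ⟨true, false, by simp, by simp, fun c hc =>
      key (by simp) (fun _ => hc.2.2.1) ⟨fun _ => hc.2.1, by simp⟩ hc.2.2.2⟩
  · exact ⟨false, true, by simp, by simp, fun c hc =>
      key (fun _ => hc.2.1) (by simp) ⟨by simp, fun _ => hc.2.2.1⟩ hc.2.2.2⟩
  · exact ⟨true, true, by simp, by simp, fun c hc =>
      key (by simp) (by simp) ⟨fun _ => hc.2.1, fun _ => hc.2.2.1⟩ hc.2.2.2⟩

lemma Ikl_subset (hl : 1 ≤ l ∧ l ≤ 3) (hJ : ∀ c ∈ Jk k, c ∈ nbhd za zb ∧ Frozen za zb c) :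
    Ikl k l ⊆ {p | p ∈ domL l za zb ∧ Frozen za zb p.1} := by
  intro p hp
  obtain rfl | rfl | rfl : l = 1 ∨ l = 2 ∨ l = 3 := by omega
  · obtain ⟨h1, h2⟩ := hJ p.1 hp.2.1
    have h := paramsOf_nbhd h1 h2
    refine ⟨⟨h1, fun _ => ?_⟩, h2⟩
    have h3 := hp.2.2.1
    have h4 := hp.2.2.2
    rw [h.gammaMinus_eq] at h3
    rw [h.gammaPlus_eq] at h4
    rw [etaOf]
    constructor <;> linarith
  all_goals
    obtain ⟨h1, h2⟩ := hJ p.1 hp.2.1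
    exact ⟨⟨h1, by simp⟩, h2⟩

lemma abs_dU_le_Uext (hl : 1 ≤ l ∧ l ≤ 3) (hp : p ∈ domL l za zb) (hf : Frozen za zb p.1) {x : ℝ}
    (hx : x ∈ Ioo (-1 : ℝ) 1) {α : Fin 3 → ℕ} {j : ℕ} (h0 : za = true → α 0 = 0)
    (h1 : zb = true → α 1 = 0) : |dU l α j p.1 p.2 x| ≤
      ‖iteratedFDeriv ℝ (α 0 + α 1 + α 2 + j) (fun p => Uext l za zb p x) p‖ := by
  have ho := isOpen_domL l za zb
  refine abs_dU_le (S := {p | p ∈ domL l za zb ∧ Frozen za zb p.1}) ho (fun _ hp => hp.1)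
    ((solParams_domL hl).contDiffOn_toU_section hx)
    (fun p hp => Ustratum_eq_Uext hl hp.1 hp.2 hx) ?_ ?_ ⟨hp, hf⟩
  · intro p hp
    have hc : ContinuousAt (fun γ : ℝ => (p.1, γ)) p.2 := by fun_prop
    exact (hc.eventually (ho.mem_nhds hp.1)).mono fun γ hγ => ⟨hγ, hp.2⟩
  · intro i hi p hp
    have hc : ContinuousAt (fun s : ℝ => (p.1 + s • (Pi.single i 1 : Fin 3 → ℝ), p.2)) 0 := by
      fun_prop
    have hm : domL l za zb ∈ 𝓝 (p.1 + (0 : ℝ) • (Pi.single i 1 : Fin 3 → ℝ), p.2) := by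
      simpa using ho.mem_nhds hp.1
    -- Moving along a free coordinate leaves the frozen ones at -1.
    refine (hc.eventually hm).mono fun s hs => ⟨hs, fun hz => ?_, fun hz => ?_⟩
    · have : (0 : Fin 3) ≠ i := by rintro rfl; exact hi (h0 hz)
      simpa [Pi.single_eq_of_ne this] using hp.2.1 hz
    · have : (1 : Fin 3) ≠ i := by rintro rfl; exact hi (h1 hz)
      simpa [Pi.single_eq_of_ne this] using hp.2.2 hz

lemma exists_weighted_bound_dU (hl : 1 ≤ l ∧ l ≤ 3) {n₀ : ℕ} {wl wr : HalfInterval → ℝ} {W : ℝ → ℝ}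
    {B : ℝ} (hL : HalfBound (domL l za zb) (fun p t => Uext l za zb p (2 * t - 1)) n₀ wl)
    (hR : HalfBound (domL l za zb) (fun p t => Uext l za zb p (1 - 2 * t)) n₀ wr)
    (hW : ∀ x, 0 ≤ W x) (hwl : ∀ t, 0 ≤ wl t) (hwr : ∀ t, 0 ≤ wr t)
    (hWl : ∀ t : HalfInterval, W (2 * t - 1) * wl t ≤ B)
    (hWr : ∀ t : HalfInterval, W (1 - 2 * t) * wr t ≤ B)
    {K : Set ((Fin 3 → ℝ) × ℝ)} (hK : IsCompact K)
    (hKS : K ⊆ {p | p ∈ domL l za zb ∧ Frozen za zb p.1}) (m : ℕ) :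
    ∃ C, ∀ (α : Fin 3 → ℕ) (j : ℕ), n₀ ≤ α 0 + α 1 + α 2 + j → α 0 + α 1 + α 2 + j ≤ m →
      (za = true → α 0 = 0) → (zb = true → α 1 = 0) → ∀ p ∈ K, ∀ x ∈ Ioo (-1 : ℝ) 1,
        W x * |dU l α j p.1 p.2 x| ≤ C := by
  obtain ⟨C, hC⟩ := exists_weighted_bound hL hR hW hwl hwr hWl hWr hK (fun p hp => (hKS hp).1) m
  exact ⟨C, fun α j h1 h2 h3 h4 p hp x hx =>
    (mul_le_mul_of_nonneg_left (abs_dU_le_Uext hl (hKS hp).1 (hKS hp).2 hx h3 h4) (hW x)).trans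
      (hC _ h1 h2 p hp x hx)⟩

lemma left_regular (hl : 1 ≤ l ∧ l ≤ 3) (h : za = false ∨ l = 2) (n₀ : ℕ) :
    HalfBound (domL l za zb) (fun p t => Uext l za zb p (2 * t - 1)) n₀ fun _ => 1 :=
  (solParams_domL hl).halfBound_left_regular (h.imp_left fun h p hp => by
    subst h
    exact Real.sqrt_pos.2 (by linarith [hp.1.1 rfl])) n₀

lemma right_regular (hl : 1 ≤ l ∧ l ≤ 3) (h : zb = false ∨ l = 3) (n₀ : ℕ) :
    HalfBound (domL l za zb) (fun p t => Uext l za zb p (1 - 2 * t)) n₀ fun _ => 1 :=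
  (solParams_domL hl).halfBound_right_regular (h.imp_left fun h p hp => by
    subst h
    exact Real.sqrt_pos.2 (by linarith [hp.1.2.1 rfl])) n₀

lemma left_log (hl : 1 ≤ l ∧ l ≤ 3) (h : za = true) (h2 : l ≠ 2) :
    HalfBound (domL l za zb) (fun p t => Uext l za zb p (2 * t - 1)) 1
      fun t => (logWt t ^ 2)⁻¹ :=
  (solParams_domL hl).halfBound_left_log (fun p _ => by simp [expo, h]) h2

lemma right_log (hl : 1 ≤ l ∧ l ≤ 3) (h : zb = true) (h3 : l ≠ 3) :
    HalfBound (domL l za zb) (fun p t => Uext l za zb p (1 - 2 * t)) 1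
      fun t => (logWt t ^ 2)⁻¹ :=
  (solParams_domL hl).halfBound_right_log (fun p _ => by simp [expo, h]) h3

lemma contDiffOn_Uext (hl : 1 ≤ l ∧ l ≤ 3) : ContDiffOn ℝ ∞
    (fun q : ((Fin 3 → ℝ) × ℝ) × ℝ => Uext l za zb q.1 q.2) (domL l za zb ×ˢ Ioo (-1) 1) :=
  (solParams_domL hl).contDiffOn_toU

/-- For the extremal solutions γ is a dummy variable and is set to 0. -/
lemma contDiffOn_Uext_const (hl : l = 2 ∨ l = 3) : ContDiffOn ℝ ∞
    (fun q : (Fin 3 → ℝ) × ℝ => Uext l za zb (q.1, 0) q.2) (nbhd za zb ×ˢ Ioo (-1) 1) :=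
  (contDiffOn_Uext (by omega)).comp (f := fun q : (Fin 3 → ℝ) × ℝ => ((q.1, (0 : ℝ)), q.2))
    (by fun_prop) fun _ hq => ⟨⟨hq.1, by omega⟩, hq.2⟩

end Strata

/-! ### Comparison of the logarithmic weights. -/

section Weights

variable (t : HalfInterval)

lemma log_near_le : Real.log ((1 + (2 * t - 1)) / 3) ^ 2 ≤ 4 * logWt t ^ 2 := by
  rw [show (1 + (2 * (t : ℝ) - 1)) / 3 = 2 * t / 3 by ring]
  exact log_sq_le_logWt_sq t

lemma log_far_le : Real.log ((1 + (1 - 2 * t)) / 3) ^ 2 ≤ 4 :=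
  log_sq_le_four (by linarith [t.2.2]) (by linarith [t.2.1])

lemma logWt_sq_pos : 0 < logWt t ^ 2 := by
  have := one_le_logWt t
  positivity

/-- For the product weight: the logarithm of the near endpoint contributes 4w², that of the far one
at most 4. -/
lemma mul_inv_logWt_le {u v : ℝ} (h1 : u ≤ 4 * logWt t ^ 2) (h2 : v ≤ 4) (hu : 0 ≤ u) :
    u * v * (logWt t ^ 2)⁻¹ ≤ 16 := by
  rw [← div_eq_mul_inv, div_le_iff₀ (logWt_sq_pos t)]
  nlinarith

lemma mul_inv_logWt_le' {u : ℝ} (h1 : u ≤ 4 * logWt t ^ 2) : u * (logWt t ^ 2)⁻¹ ≤ 4 := by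
  rw [← div_eq_mul_inv, div_le_iff₀ (logWt_sq_pos t)]
  exact h1

end Weights

end HomNS

/-! ### Assembly of the main theorem. -/

theorem theorem1p5 (k l : ℕ) (hk : 1 ≤ k ∧ k ≤ 4) (hl : 1 ≤ l ∧ l ≤ 3) :
    -- smoothness jointly in the free parameters of the stratum and `x`
    (l = 1 → ContDiffOn ℝ ∞
      (fun q : ((Fin 3 → ℝ) × ℝ) × ℝ => HomNS.U q.1.1 q.1.2 q.2)
      (HomNS.Ikl k 1 ×ˢ Ioo (-1 : ℝ) 1)) ∧
    (l = 2 → ContDiffOn ℝ ∞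
      (fun q : (Fin 3 → ℝ) × ℝ => HomNS.U q.1 (HomNS.gammaPlus q.1) q.2)
      (HomNS.Jk k ×ˢ Ioo (-1 : ℝ) 1)) ∧
    (l = 3 → ContDiffOn ℝ ∞
      (fun q : (Fin 3 → ℝ) × ℝ => HomNS.U q.1 (HomNS.gammaMinus q.1) q.2)
      (HomNS.Jk k ×ˢ Ioo (-1 : ℝ) 1)) ∧
    -- estimates on compact subsets of the stratum
    ∀ K : Set ((Fin 3 → ℝ) × ℝ), IsCompact K → K ⊆ HomNS.Ikl k l → ∀ m : ℕ,
      ((k = 1 ∨ (k, l) = (2, 2) ∨ (k, l) = (3, 3)) →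
        ∃ C : ℝ, ∀ (α : Fin 3 → ℕ) (j : ℕ), α 0 + α 1 + α 2 + j ≤ m →
          (l = 2 ∨ l = 3 → j = 0) → (k = 2 → α 0 = 0) → (k = 3 → α 1 = 0) →
          ∀ p ∈ K, ∀ x ∈ Ioo (-1 : ℝ) 1, |HomNS.dU l α j p.1 p.2 x| ≤ C) ∧
      (((k, l) = (2, 1) ∨ (k, l) = (2, 3) ∨ (k, l) = (4, 3)) →
        ∃ C : ℝ, ∀ (α : Fin 3 → ℕ) (j : ℕ),
          1 ≤ α 0 + α 1 + α 2 + j → α 0 + α 1 + α 2 + j ≤ m →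
          α 0 = 0 → (l = 3 → j = 0) → (k = 4 → α 1 = 0) →
          ∀ p ∈ K, ∀ x ∈ Ioo (-1 : ℝ) 1,
            Real.log ((1 + x) / 3) ^ 2 * |HomNS.dU l α j p.1 p.2 x| ≤ C) ∧
      (((k, l) = (3, 1) ∨ (k, l) = (3, 2) ∨ (k, l) = (4, 2)) →
        ∃ C : ℝ, ∀ (α : Fin 3 → ℕ) (j : ℕ),
          1 ≤ α 0 + α 1 + α 2 + j → α 0 + α 1 + α 2 + j ≤ m →
          α 1 = 0 → (l = 2 → j = 0) → (k = 4 → α 0 = 0) →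
          ∀ p ∈ K, ∀ x ∈ Ioo (-1 : ℝ) 1,
            Real.log ((1 - x) / 3) ^ 2 * |HomNS.dU l α j p.1 p.2 x| ≤ C) ∧
      ((k, l) = (4, 1) →
        ∃ C : ℝ, ∀ (α : Fin 3 → ℕ) (j : ℕ),
          1 ≤ α 0 + α 1 + α 2 + j → α 0 + α 1 + α 2 + j ≤ m →
          α 0 = 0 → α 1 = 0 →
          ∀ p ∈ K, ∀ x ∈ Ioo (-1 : ℝ) 1,
            Real.log ((1 + x) / 3) ^ 2 * Real.log ((1 - x) / 3) ^ 2 *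
              |HomNS.dU l α j p.1 p.2 x| ≤ C) := by
  obtain ⟨za, zb, hza, hzb, hJ⟩ := HomNS.Jk_subset hk
  refine ⟨?_, ?_, ?_, fun K hK hKI m => ?_⟩
  · rintro rfl
    have hI := HomNS.Ikl_subset hl hJ
    refine ((HomNS.contDiffOn_Uext (za := za) (zb := zb) hl).mono
      (prod_mono_left fun p hp => (hI hp).1)).congr fun q hq => ?_
    exact HomNS.Ustratum_eq_Uext hl (hI hq.1).1 (hI hq.1).2 hq.2
  · rintro rfl
    refine ((HomNS.contDiffOn_Uext_const (za := za) (zb := zb) (Or.inl rfl)).mono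
      (prod_mono_left fun c hc => (hJ c hc).1)).congr fun q hq => ?_
    exact HomNS.Ustratum_eq_Uext (p := (q.1, 0)) hl ⟨(hJ _ hq.1).1, by omega⟩ (hJ _ hq.1).2 hq.2
  · rintro rfl
    refine ((HomNS.contDiffOn_Uext_const (za := za) (zb := zb) (Or.inr rfl)).mono
      (prod_mono_left fun c hc => (hJ c hc).1)).congr fun q hq => ?_
    exact HomNS.Ustratum_eq_Uext (p := (q.1, 0)) hl ⟨(hJ _ hq.1).1, by omega⟩ (hJ _ hq.1).2 hq.2
  have hKS := hKI.trans (HomNS.Ikl_subset hl hJ)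
  have hf : ∀ {z : Bool}, z ≠ true → z = false := fun h => by simpa using h
  have hinv : ∀ t : HomNS.HalfInterval, 0 ≤ (HomNS.logWt t ^ 2)⁻¹ := fun t => by positivity
  simp only [Prod.mk.injEq]
  refine ⟨fun h => ?_, fun h => ?_, fun h => ?_, fun h => ?_⟩
  · have hL : za = false ∨ l = 2 := by
      by_cases h2 : l = 2
      · exact Or.inr h2
      · exact Or.inl (hf fun hz => by have := hza.1 hz; omega)
    have hR : zb = false ∨ l = 3 := by
      by_cases h3 : l = 3
      · exact Or.inr h3
      · exact Or.inl (hf fun hz => by have := hzb.1 hz; omega)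
    obtain ⟨C, hC⟩ := HomNS.exists_weighted_bound_dU (W := fun _ => 1) (B := 1) hl
      (HomNS.left_regular hl hL 0) (HomNS.right_regular hl hR 0) (fun _ => zero_le_one)
      (fun _ => zero_le_one) (fun _ => zero_le_one) (fun _ => by simp) (fun _ => by simp) hK hKS m
    refine ⟨C, fun α j hm _ h0 h1 p hp x hx => ?_⟩
    simpa using hC α j (Nat.zero_le _) hm (fun hz => h0 (by have := hza.1 hz; omega))
      (fun hz => h1 (by have := hzb.1 hz; omega)) p hp x hx
  · have hL : za = true := hza.2 (by omega)
    have hR : zb = false ∨ l = 3 := by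
      by_cases h3 : l = 3
      · exact Or.inr h3
      · exact Or.inl (hf fun hz => by have := hzb.1 hz; omega)
    -- B = 4 serves both halves: near x = -1 the weight is at most 4w² against the decay w⁻², and
    -- for x ≥ 0 it is itself at most 4.
    obtain ⟨C, hC⟩ := HomNS.exists_weighted_bound_dU (W := fun x => Real.log ((1 + x) / 3) ^ 2)
      (B := 4) hl (HomNS.left_log hl hL (by omega)) (HomNS.right_regular hl hR 1)
      (fun _ => sq_nonneg _) hinv (fun _ => zero_le_one)
      (fun t => HomNS.mul_inv_logWt_le' t (HomNS.log_near_le t))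
      (fun t => by simpa using HomNS.log_far_le t) hK hKS m
    exact ⟨C, fun α j h1 hm h0 _ h4 => hC α j h1 hm (fun _ => h0)
      fun hz => h4 (by have := hzb.1 hz; omega)⟩
  · have hL : za = false ∨ l = 2 := by
      by_cases h2 : l = 2
      · exact Or.inr h2
      · exact Or.inl (hf fun hz => by have := hza.1 hz; omega)
    have hR : zb = true := hzb.2 (by omega)
    obtain ⟨C, hC⟩ := HomNS.exists_weighted_bound_dU (W := fun x => Real.log ((1 - x) / 3) ^ 2)
      (B := 4) hl (HomNS.left_regular hl hL 1) (HomNS.right_log hl hR (by omega))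
      (fun _ => sq_nonneg _) (fun _ => zero_le_one) hinv
      (fun t => by
        have := HomNS.log_far_le t
        rw [show 1 + (1 - 2 * (t : ℝ)) = 1 - (2 * t - 1) by ring] at this
        simpa using this)
      (fun t => HomNS.mul_inv_logWt_le' t (by
        have := HomNS.log_near_le t
        rwa [show 1 + (2 * (t : ℝ) - 1) = 1 - (1 - 2 * t) by ring] at this)) hK hKS m
    exact ⟨C, fun α j h1 hm h0 _ h4 => hC α j h1 hm
      (fun hz => h4 (by have := hza.1 hz; omega)) fun _ => h0⟩
  · obtain ⟨C, hC⟩ := HomNS.exists_weighted_bound_dU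
      (W := fun x => Real.log ((1 + x) / 3) ^ 2 * Real.log ((1 - x) / 3) ^ 2) (B := 16) hl
      (HomNS.left_log hl (hza.2 (by omega)) (by omega))
      (HomNS.right_log hl (hzb.2 (by omega)) (by omega))
      (fun _ => by positivity) hinv hinv
      (fun t => HomNS.mul_inv_logWt_le t (HomNS.log_near_le t) (by
        have := HomNS.log_far_le t
        rwa [show 1 + (1 - 2 * (t : ℝ)) = 1 - (2 * t - 1) by ring] at this) (sq_nonneg _))
      (fun t => by
        have h1 := HomNS.log_near_le t
        rw [show 1 + (2 * (t : ℝ) - 1) = 1 - (1 - 2 * t) by ring] at h1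
        rw [mul_comm (Real.log ((1 + (1 - 2 * (t : ℝ))) / 3) ^ 2)]
        exact HomNS.mul_inv_logWt_le t h1 (HomNS.log_far_le t) (sq_nonneg _)) hK hKS m
    exact ⟨C, fun α j h1 hm h0 h1' => hC α j h1 hm (fun _ => h0) fun _ => h1'⟩
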